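/- For a finite or countably infinite alphabet $X$ and a set $A\subseteq X^\omega$, the Gale--Stewart game $G(A)$ is the game in which Player 1 and Player 2 alternately write letters of $X$, Player 1 first, and thus produce an infinite word $x=a_1b_1a_2b_2\cdots\in X^\omega$; Player 1 wins if $x\in A$, otherwise Player 2 wins. A strategy for Player 1 is a function $(X^2)^\star\to X$ and a strategy for Player 2 is a function $(X^2)^\star X\to X$. The game is determined if one of the two players has a winning strategy. For $X$ finite or $X=\omega$, a set $L\subseteq X^\omega$ is effective analytic (in the class $\Sigma^1_1$) if there is a recursive relation $R\subseteq\mathbb N\times\{0,1\}^\star\times X^\star$ such that $$L=\{\sigma\in X^\omega \mid \exists \tau\in\{0,1\}^\omega\ \forall n\ \exists m\ \ (n,\tau[m],\sigma[m])\in R\},$$ where $\sigma[m]$ is the prefix of length $m$ of $\sigma$. A 2-tape Büchi automaton over finite alphabets $\Sigma,\Gamma$ consists of a finite set $K$ of states, a finite set $\Delta\subseteq K\times\Sigma^\star\times\Gamma^\star\times K$ of transitions, an initial state $q_0\in K$ and a set $F\subseteq K$ of accepting states. It accepts $(u,v)\in\Sigma^\omega\times\Gamma^\omega$ if there is an infinite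 sequence of transitions $(q_{i-1},u_i,v_i,q_i)\in\Delta$, $i\ge 1$, starting in $q_0$, such that $u=u_1u_2u_3\cdots$, $v=v_1v_2v_3\cdots$ and some state of $F$ occurs infinitely often among the $q_i$. The sets of pairs accepted by such automata are the infinitary rational relations (the class $\mathbf{RAT}_\omega$); they are regarded as subsets of $(\Sigma\times\Gamma)^\omega$ by identifying $\Sigma^\omega\times\Gamma^\omega$ with $(\Sigma\times\Gamma)^\omega$. **Theorem.** $\mathbf{Det}(\Sigma^1_1)\Longleftrightarrow\mathbf{Det}(\mathbf{RAT}_\omega)$. Here $\mathbf{Det}(\mathbf{RAT}_\omega)$ says that $G(A)$ is determined for all finite alphabets $\Sigma,\Gamma$ and every infinitary rational relation $A\subseteq(\Sigma\times\Gamma)^\omega$, and $\mathbf{Det}(\Sigma^1_1)$ says that $G(A)$ is determined for every effective analytic set $A\subseteq X^\omega$; the equivalence holds both when $X$ ranges over all finite alphabets and when $X=\omega$. -/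

import Mathlib

/-- The word formed by the first `n` letters of the infinite word `x`
(infinite words are indexed from `0`). -/
def prefixWord {X : Type*} (x : ℕ → X) (n : ℕ) : List X :=
  (List.range n).map x

/-! ### Gale-Stewart games

A play is an infinite word `x = a₁ b₁ a₂ b₂ …`; the letter `aₖ₊₁ = x (2 * k)` is written by
Player 1 and the letter `bₖ₊₁ = x (2 * k + 1)` by Player 2. -/

/-- The first `n` rounds `(a₁, b₁), …, (aₙ, bₙ)` of the play `x`. -/
def rounds {X : Type*} (x : ℕ → X) (n : ℕ) : List (X × X) :=
  (List.range n).map fun k => (x (2 * k), x (2 * k + 1))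

/-- `F` is a winning strategy for Player 1 in the Gale-Stewart game `G(A)`. -/
def IsWinningStrategy₁ {X : Type*} (A : Set (ℕ → X)) (F : List (X × X) → X) : Prop :=
  ∀ x : ℕ → X, (∀ n, x (2 * n) = F (rounds x n)) → x ∈ A

/-- `F` is a winning strategy for Player 2 in the Gale-Stewart game `G(A)`; Player 2 sees the
finished rounds and the letter that Player 1 has just written. -/
def IsWinningStrategy₂ {X : Type*} (A : Set (ℕ → X)) (F : List (X × X) → X → X) : Prop :=
  ∀ x : ℕ → X, (∀ n, x (2 * n + 1) = F (rounds x n) (x (2 * n))) → x ∉ A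

/-- The Gale-Stewart game `G(A)` is determined. -/
def IsDetermined {X : Type*} (A : Set (ℕ → X)) : Prop :=
  (∃ F, IsWinningStrategy₁ A F) ∨ ∃ F, IsWinningStrategy₂ A F

/-! ### Effective analytic sets -/

/-- The lightface class `Σ¹₁`: `L` is the set of the `σ` for which there is an infinite binary
word `τ` with `∀ n, ∃ m, (n, τ[m], σ[m]) ∈ R`, where `R` is a recursive relation. -/
def IsEffectiveAnalytic {X : Type*} [Primcodable X] (L : Set (ℕ → X)) : Prop :=
  ∃ R : Set (ℕ × List Bool × List X), ComputablePred (fun p => p ∈ R) ∧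
    ∀ σ : ℕ → X, σ ∈ L ↔
      ∃ τ : ℕ → Bool, ∀ n, ∃ m, (n, prefixWord τ m, prefixWord σ m) ∈ R

/-- Determinacy of the effective analytic games over finite alphabets. (All codings of a finite
alphabet yield the same recursive relations.) -/
def DetEffectiveAnalyticFinite : Prop :=
  ∀ (X : Type) [Finite X] [Primcodable X] (A : Set (ℕ → X)),
    IsEffectiveAnalytic A → IsDetermined A

/-- Determinacy of the effective analytic games over the countably infinite alphabet `ω`. -/
def DetEffectiveAnalyticOmega : Prop :=
  ∀ A : Set (ℕ → ℕ), IsEffectiveAnalytic A → IsDetermined A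

/-! ### Infinitary rational relations -/

/-- A (nondeterministic, possibly asynchronous) 2-tape Büchi automaton with set of states `K` and
tape alphabets `S` and `G`. Finiteness of `K`, `S`, `G` is required where automata are used. -/
structure TwoTapeBuchi (K S G : Type) where
  trans : Set (K × List S × List G × K)
  finite_trans : trans.Finite
  start : K
  accept : Set K

/-- The infinite concatenation `w 0 . w 1 . w 2 …` of finite words is infinite and equals `x`. -/
def IsInfiniteConcat {S : Type*} (w : ℕ → List S) (x : ℕ → S) : Prop :=
  (∀ n, (prefixWord w n).flatten = prefixWord x (prefixWord w n).flatten.length) ∧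
    ∀ N, ∃ n, N ≤ (prefixWord w n).flatten.length

namespace TwoTapeBuchi

variable {K S G : Type}

/-- The transitions `(q i, u i, v i, q (i + 1))` form a computation. -/
def IsComputation (M : TwoTapeBuchi K S G) (q : ℕ → K) (u : ℕ → List S) (v : ℕ → List G) : Prop :=
  q 0 = M.start ∧ ∀ i, (q i, u i, v i, q (i + 1)) ∈ M.trans

/-- Some accepting state occurs infinitely often in the sequence `q`. -/
def IsSuccessful (M : TwoTapeBuchi K S G) (q : ℕ → K) : Prop :=
  ∃ f ∈ M.accept, ∃ᶠ i in Filter.atTop, q i = f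

/-- The relation accepted by the automaton. -/
def relation (M : TwoTapeBuchi K S G) : Set ((ℕ → S) × (ℕ → G)) :=
  {p | ∃ q u v, M.IsComputation q u v ∧ M.IsSuccessful q ∧
    IsInfiniteConcat u p.1 ∧ IsInfiniteConcat v p.2}

end TwoTapeBuchi

/-- `R` is an infinitary rational relation, i.e. is accepted by a 2-tape Büchi automaton. -/
def IsInfinitaryRational {S G : Type} (R : Set ((ℕ → S) × (ℕ → G))) : Prop :=
  ∃ (K : Type) (_ : Finite K) (M : TwoTapeBuchi K S G), R = M.relation

/-- A relation between infinite words, seen as a set of infinite words over the product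
alphabet. -/
def asProductLanguage {S G : Type} (R : Set ((ℕ → S) × (ℕ → G))) : Set (ℕ → S × G) :=
  {x | ((fun i => (x i).1), (fun i => (x i).2)) ∈ R}

/-- Determinacy of the games whose winning set is an infinitary rational relation. -/
def DetRational : Prop :=
  ∀ (S G : Type) [Finite S] [Finite G] (R : Set ((ℕ → S) × (ℕ → G))),
    IsInfinitaryRational R → IsDetermined (asProductLanguage R)

/-! The statements are linked in a cycle: determinacy over finite alphabets gives `DetRational`,
this gives determinacy over ω, and that gives back finite alphabets. For the first link, a rational
relation is effective analytic because the binary word τ can guess the sequence of transitions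
(`TwoTapeBuchi.isEffectiveAnalytic`). For the last link, a game over X is pulled back along a
surjection from ℕ to X (`isDetermined_of_comp`).

The substance is the middle link, which combines three reductions. First, an effective analytic set
has the form `branchSet B` with B computable: for some τ, infinitely many pairs of prefixes satisfy
B (`IsEffectiveAnalytic.exists_branchSet`). A running search for witnesses turns "for all n there is
m" into "infinitely often". Second, letters of ω are written in unary, and a player who never
finishes a letter loses; this leads to a game of the same kind over the binary alphabet
(`isDetermined_of_unaryProperty`).

Third, a binary game `branchSet B` is simulated by a game with a rational winning set. Player 2
writes one and the same word on both tapes: a record that lists, for each k, the first k bits X[k]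
of a play of the binary game, followed by the successive configurations of a stack machine computing
the table of all values B(t, X[k]) with t of length k. The bits of Player 1 in the record must be
copied from what Player 1 writes in the same round; those of Player 2 are free. Player 1 wins if the
record is faulty or if some branch τ meets infinitely many positive table entries.

This condition is rational because, the tapes being equal, the two heads of the automaton can stand
at different places of one word. A faulty record shows a local error or a mismatch between a block
and a later one, which is found with one head on each (`Comparison.automaton_accepts`). A branch is
followed with one head in table k and the other in table k + 1: while the first passes the entries
behind the current one, the second passes twice as many, and so arrives at the two successors
(`accepts_of_branch`, `exists_branch_of_accepts`).

Strategies transfer back. A winning strategy of Player 1 is confronted with correct records; up to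
the place where a bit is first shown, such a record depends only on earlier bits
(`honestWord_congr`), so the answers can be given in time (`exists_winning₁_of_protocolGame`). A
winning strategy of Player 2 can only produce correct records, from which the bits of Player 2 are
read off (`exists_winning₂_of_protocolGame`). -/

section

/-! ### Computable functions on binary words as finite-state multi-stack machines. -/

open Turing Turing.PartrecToTM2

/-! ### Multi-stack machines with one elementary action per step -/

/-- A machine with states `Q` and stacks `K` over the alphabet `Γ`. In state `q` the stack `k` is
kept (`act q k = none`), popped (`some none`) or receives a letter `a` (`some (some a)`). -/
structure StackMachine (Q K Γ : Type) where
  start : Q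
  halted : Q → Prop
  next : Q → (K → Option Γ) → Q
  act : Q → K → Option (Option Γ)

namespace StackMachine

variable {Q K Γ : Type}

/-- The effect of an elementary action on a stack. -/
def applyAct (o : Option (Option Γ)) (l : List Γ) : List Γ :=
  match o with
  | none => l
  | some none => l.tail
  | some (some a) => a :: l

/-- One step of the machine. -/
def step (M : StackMachine Q K Γ) (c : Q × (K → List Γ)) : Q × (K → List Γ) :=
  (M.next c.1 fun k => (c.2 k).head?, fun k => applyAct (M.act c.1 k) (c.2 k))

end StackMachine

/-! ### Machines for computable functions on binary words -/

/-- The stack letter that represents a bit. -/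
def bitSym (b : Bool) : Γ' := cond b Γ'.bit1 Γ'.bit0

/-- The stacks that represent a binary word as an input. -/
def inputStacks (s : List Bool) : K' → List Γ' :=
  K'.elim (s.map bitSym ++ [Γ'.bit1, Γ'.cons]) [] [] []

/-- The binary word as a positive number, least significant bit first, closed by a leading `1`. -/
def wordPosNum : List Bool → PosNum
  | [] => PosNum.one
  | b :: s => cond b (PosNum.bit1 (wordPosNum s)) (PosNum.bit0 (wordPosNum s))

/-- The value of `wordPosNum`. -/
def wordVal : List Bool → ℕ
  | [] => 1
  | b :: s => 2 * wordVal s + b.toNat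

theorem cast_wordPosNum (s : List Bool) : ((wordPosNum s : PosNum) : ℕ) = wordVal s := by
  induction s with
  | nil => rfl
  | cons b s ih => cases b <;> simp [wordPosNum, wordVal, ih] <;> omega

theorem trPosNum_wordPosNum (s : List Bool) :
    trPosNum (wordPosNum s) = s.map bitSym ++ [Γ'.bit1] := by
  induction s with
  | nil => rfl
  | cons b s ih => cases b <;> simp [wordPosNum, trPosNum, ih, bitSym]

/-- The closing `1` of `wordPosNum` protects the final zeros of the word, so that words, and not
only numbers, are represented. It leaves a letter `bit1` behind the bits, which later becomes an
additional table entry. -/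
theorem trNat_wordVal (s : List Bool) : trNat (wordVal s) = s.map bitSym ++ [Γ'.bit1] := by
  rw [← trPosNum_wordPosNum, trNat, ← cast_wordPosNum]
  have : (((wordPosNum s : PosNum) : ℕ) : Num) = Num.pos (wordPosNum s) := by
    rw [← Num.of_to_nat (Num.pos (wordPosNum s))]; rfl
  rw [this]; rfl

theorem trList_wordVal (s : List Bool) :
    trList [wordVal s] = s.map bitSym ++ [Γ'.bit1, Γ'.cons] := by
  simp [trNat_wordVal]

theorem wordVal_pos (s : List Bool) : 0 < wordVal s := by
  induction s with
  | nil => simp [wordVal]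
  | cons b s ih => simp [wordVal]; omega

theorem length_lt_wordVal (s : List Bool) : s.length < wordVal s := by
  induction s with
  | nil => simp [wordVal]
  | cons b s ih => simp [wordVal]; omega

theorem primrec_wordVal : Primrec wordVal := by
  have : Primrec fun s : List Bool => s.foldr (fun b n => 2 * n + b.toNat) 1 := by
    refine Primrec.list_foldr (h := fun _ (p : Bool × ℕ) => 2 * p.2 + p.1.toNat) Primrec.id
      (Primrec.const 1) ?_
    exact Primrec.nat_add.comp
      (Primrec.nat_mul.comp (Primrec.const 2) (Primrec.snd.comp Primrec.snd))
      ((Primrec.dom_finite Bool.toNat).comp (Primrec.fst.comp Primrec.snd))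
  refine this.of_eq fun s => ?_
  induction s with
  | nil => rfl
  | cons b s ih => simp [wordVal, ih]

/-- Moves the least significant bit of the number to the end of the word. -/
def bitShift (p : ℕ × List Bool) : ℕ × List Bool :=
  if p.1 ≤ 1 then p else (p.1.div2, p.2 ++ [p.1.bodd])

/-- Once only the closing `1` is left, `bitShift` is stationary, so too many iterations do no harm;
this allows `valWord` to iterate as often as the number itself says. -/
theorem bitShift_iterate (s acc : List Bool) (m : ℕ) (h : s.length ≤ m) :
    bitShift^[m] (wordVal s, acc) = (1, acc ++ s) := by
  induction m generalizing s acc with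
  | zero => obtain rfl : s = [] := by simpa using h
            simp [wordVal]
  | succ m ih =>
    rw [Function.iterate_succ_apply]
    cases s with
    | nil =>
      have : bitShift (wordVal [], acc) = (wordVal [], acc) := by simp [bitShift, wordVal]
      rw [this, ih [] acc (by simp)]
    | cons b s =>
      have : bitShift (wordVal (b :: s), acc) = (wordVal s, acc ++ [b]) := by
        have := wordVal_pos s
        have h2 : ¬ (2 * wordVal s + b.toNat ≤ 1) := by omega
        cases b <;> simp [bitShift, wordVal, Nat.div2_val] <;> omega
      rw [this, ih s _ (by simpa using h)]; simp

/-- The binary word with the given value. -/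
def valWord (n : ℕ) : List Bool := (bitShift^[n] (n, [])).2

theorem valWord_wordVal (s : List Bool) : valWord (wordVal s) = s := by
  rw [valWord, bitShift_iterate _ _ _ (length_lt_wordVal s).le]; simp

theorem primrec_valWord : Primrec valWord := by
  refine Primrec.snd.comp (Primrec.nat_iterate (α := ℕ) (β := ℕ × List Bool) Primrec.id
    (Primrec.pair Primrec.id (Primrec.const [])) (h := fun _ p => bitShift p) ?_)
  refine Primrec₂.mk (Primrec.ite ?_ Primrec.snd ?_)
  · exact Primrec.nat_le.comp (Primrec.fst.comp Primrec.snd) (Primrec.const 1)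
  · exact Primrec.pair (Primrec.nat_div2.comp (Primrec.fst.comp Primrec.snd))
      (Primrec.list_append.comp (Primrec.snd.comp Primrec.snd)
        (Primrec.list_cons.comp (Primrec.nat_bodd.comp (Primrec.fst.comp Primrec.snd))
          (Primrec.const [])))

/-- The function is conjugated with the coding `wordVal`, of which `valWord` is a left inverse. -/
theorem exists_code_of_computable {F : List Bool → List Bool} (hF : Computable F) :
    ∃ c : ToPartrec.Code, ∀ s, c.eval [wordVal s] = pure [wordVal (F s)] := by
  have hf : Computable fun n => wordVal (F (valWord n)) :=
    primrec_wordVal.to_comp.comp (hF.comp primrec_valWord.to_comp)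
  obtain ⟨c, hc⟩ := ToPartrec.Code.exists_code (Nat.Partrec'.part_iff₁.2 hf)
  refine ⟨c, fun s => ?_⟩
  have := hc (wordVal s ::ᵥ List.Vector.nil)
  simp only [List.Vector.head_cons, valWord_wordVal, PFun.coe_val] at this
  exact this

namespace Turing.TM2

variable {K Λ σ : Type} {Γ : K → Type}

/-- The statement that remains after the first action of a statement. -/
def Stmt.rest (M : Λ → Stmt Γ Λ σ) : Stmt Γ Λ σ → σ → Stmt Γ Λ σ
  | .push _ _ q, _ => q
  | .peek _ _ q, _ => q
  | .pop _ _ q, _ => q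
  | .load _ q, _ => q
  | .branch f q₁ q₂, v => cond (f v) q₁ q₂
  | .goto l, v => M (l v)
  | .halt, _ => .halt

theorem some_mem_stmts {M : Λ → Stmt Γ Λ σ} {S : Finset Λ} {l : Λ} (hl : l ∈ S) :
    some (M l) ∈ stmts M S := by
  simp only [stmts, Finset.mem_insertNone, Finset.mem_biUnion, Option.mem_def,
    Option.some.injEq, forall_eq']
  exact ⟨l, hl, stmts₁_self⟩

/-- The finite set of substatements is closed under execution, so statements can serve as the states
of a finite machine. The support condition is what handles the jumps. -/
theorem Stmt.rest_mem_stmts [Inhabited Λ] {M : Λ → Stmt Γ Λ σ} {S : Finset Λ}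
    (hS : Supports M S) {q : Stmt Γ Λ σ} (hq : some q ∈ stmts M S) (v : σ) :
    some (q.rest M v) ∈ stmts M S := by
  classical
  have hs := stmts_supportsStmt hS hq
  cases q with
  | branch f q₁ q₂ =>
    cases h : f v <;> simp only [Stmt.rest, h, cond_true, cond_false] <;>
      refine stmts_trans ?_ hq <;> simp [stmts₁, stmts₁_self]
  | goto l =>
    exact some_mem_stmts (hs v)
  | halt => exact hq
  | push | pop | peek | load => exact stmts_trans (by simp [stmts₁, stmts₁_self, Stmt.rest]) hq

end Turing.TM2

section FromTM2

variable {Λ σ K Γ : Type} [DecidableEq K]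

/-- The local store after the first action of a statement. -/
def stmtVar : TM2.Stmt (fun _ : K => Γ) Λ σ → σ → (K → Option Γ) → σ
  | .peek k f _, v, t => f v (t k)
  | .pop k f _, v, t => f v (t k)
  | .load f _, v, _ => f v
  | _, v, _ => v

/-- The stack action of the first action of a statement. -/
def stmtAct : TM2.Stmt (fun _ : K => Γ) Λ σ → σ → K → Option (Option Γ)
  | .push k f _, v, k' => if k' = k then some (some (f v)) else none
  | .pop k _ _, _, k' => if k' = k then some none else none
  | _, _, _ => none

/-- The multi-stack machine that executes a `TM2` program action by action. -/
def StackMachine.ofTM2 [Inhabited Λ] {M : Λ → TM2.Stmt (fun _ : K => Γ) Λ σ} {S : Finset Λ}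
    (hS : TM2.Supports M S) (q₀ : {q // some q ∈ TM2.stmts M S}) (v₀ : σ) :
    StackMachine ({q // some q ∈ TM2.stmts M S} × σ) K Γ where
  start := (q₀, v₀)
  halted c := c.1.1 = .halt
  next c t := (⟨c.1.1.rest M c.2, TM2.Stmt.rest_mem_stmts hS c.1.2 c.2⟩, stmtVar c.1.1 c.2 t)
  act c := stmtAct c.1.1 c.2

variable [Inhabited Λ] {M : Λ → TM2.Stmt (fun _ : K => Γ) Λ σ} {S : Finset Λ}
  (hS : TM2.Supports M S) (q₀ : {q // some q ∈ TM2.stmts M S}) (v₀ : σ)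

/-- The configuration `c` of the multi-stack machine stands for the configuration `d` of the
`TM2` program. -/
def Simulates (c : ({q // some q ∈ TM2.stmts M S} × σ) × (K → List Γ))
    (d : TM2.Cfg (fun _ : K => Γ) Λ σ) : Prop :=
  c.1.1.1 = d.l.elim .halt M ∧ c.1.2 = d.var ∧ c.2 = d.stk

theorem exists_simulates_of_rest {q : TM2.Stmt (fun _ : K => Γ) Λ σ}
    {hq : some q ∈ TM2.stmts M S} {v : σ} {T : K → List Γ} {d : TM2.Cfg (fun _ : K => Γ) Λ σ}
    (v' : σ) (T' : K → List Γ) (hv : v' = stmtVar q v (fun k => (T k).head?))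
    (hT : T' = (fun k => StackMachine.applyAct (stmtAct q v k) (T k)))
    (h : ∃ n, Simulates ((StackMachine.ofTM2 hS q₀ v₀).step^[n]
      ((⟨q.rest M v, TM2.Stmt.rest_mem_stmts hS hq v⟩, v'), T')) d) :
    ∃ n, Simulates ((StackMachine.ofTM2 hS q₀ v₀).step^[n] ((⟨q, hq⟩, v), T)) d := by
  obtain ⟨n, hn⟩ := h
  subst hv hT
  exact ⟨n + 1, hn⟩

/-- A step of the `TM2` program executes a statement up to its next jump; by induction on the
statement it is broken up into single actions. -/
theorem exists_simulates_stepAux (q : TM2.Stmt (fun _ : K => Γ) Λ σ)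
    (hq : some q ∈ TM2.stmts M S) (v : σ) (T : K → List Γ) :
    ∃ n, Simulates ((StackMachine.ofTM2 hS q₀ v₀).step^[n] ((⟨q, hq⟩, v), T))
      (TM2.stepAux q v T) := by
  induction q generalizing v T with
  | push k f q ih =>
    refine exists_simulates_of_rest hS q₀ v₀ _ (Function.update T k (f v :: T k)) rfl ?_ (ih _ _ _)
    ext1 k'
    by_cases h : k' = k
    · subst h; simp [stmtAct, StackMachine.applyAct]
    · simp [stmtAct, StackMachine.applyAct, h]
  | pop k f q ih =>
    refine exists_simulates_of_rest hS q₀ v₀ _ (Function.update T k (T k).tail) rfl ?_ (ih _ _ _)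
    ext1 k'
    by_cases h : k' = k
    · subst h; simp [stmtAct, StackMachine.applyAct]
    · simp [stmtAct, StackMachine.applyAct, h]
  | peek k f q ih => exact exists_simulates_of_rest hS q₀ v₀ _ T rfl rfl (ih _ _ _)
  | load f q ih => exact exists_simulates_of_rest hS q₀ v₀ _ T rfl rfl (ih _ _ _)
  | branch f q₁ q₂ ih₁ ih₂ =>
    refine exists_simulates_of_rest hS q₀ v₀ _ T rfl rfl ?_
    have hr := TM2.Stmt.rest_mem_stmts hS hq v
    cases h : f v
    · simp only [TM2.Stmt.rest, TM2.stepAux, h, cond_false] at hr ⊢; exact ih₂ _ _ _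
    · simp only [TM2.Stmt.rest, TM2.stepAux, h, cond_true] at hr ⊢; exact ih₁ _ _ _
  | goto l => exact ⟨1, rfl, rfl, rfl⟩
  | halt => exact ⟨0, rfl, rfl, rfl⟩

theorem exists_simulates_of_reaches {d d' : TM2.Cfg (fun _ : K => Γ) Λ σ}
    (h : StateTransition.Reaches (TM2.step M) d d')
    {c : ({q // some q ∈ TM2.stmts M S} × σ) × (K → List Γ)} (hc : Simulates c d) :
    ∃ n, Simulates ((StackMachine.ofTM2 hS q₀ v₀).step^[n] c) d' := by
  induction h with
  | refl => exact ⟨0, hc⟩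
  | @tail d d' _ hd ih =>
    obtain ⟨n, hn⟩ := ih
    obtain ⟨l, v, T⟩ := d
    cases l with
    | none => simp at hd
    | some l =>
      simp only [TM2.step, Option.mem_def, Option.some.injEq] at hd
      rcases h : (StackMachine.ofTM2 hS q₀ v₀).step^[n] c with ⟨⟨⟨q, hq⟩, w⟩, U⟩
      rw [h] at hn
      obtain ⟨rfl, h2, h3⟩ : q = M l ∧ w = v ∧ U = T := hn
      subst h2 h3
      obtain ⟨m, hm⟩ := exists_simulates_stepAux hS q₀ v₀ _ hq w U
      refine ⟨m + n, ?_⟩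
      rw [Function.iterate_add_apply, h, ← hd]
      exact hm

theorem step_ofTM2_of_halted {c : ({q // some q ∈ TM2.stmts M S} × σ) × (K → List Γ)}
    (hc : (StackMachine.ofTM2 hS q₀ v₀).halted c.1) : (StackMachine.ofTM2 hS q₀ v₀).step c = c := by
  obtain ⟨⟨⟨q, hq⟩, v⟩, T⟩ := c
  obtain rfl : q = .halt := hc
  rfl

end FromTM2

instance : Finite K' :=
  Finite.of_injective (β := Fin 4) (fun k => match k with
    | .main => 0 | .rev => 1 | .aux => 2 | .stack => 3) (by
    intro a b h; cases a <;> cases b <;> simp_all)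

/-- Every computable function on binary words is computed by a multi-stack machine. -/
theorem exists_stackMachine {F : List Bool → List Bool} (hF : Computable F) :
    ∃ (Q : Type) (_ : Finite Q) (M : StackMachine Q K' Γ'), ∀ s, ∃ t,
      M.halted (M.step^[t] (M.start, inputStacks s)).1 ∧
      (∀ t' < t, ¬ M.halted (M.step^[t'] (M.start, inputStacks s)).1) ∧
      (M.step^[t] (M.start, inputStacks s)).2 .main =
        (F s).map bitSym ++ [Γ'.bit1, Γ'.cons] := by
  classical
  obtain ⟨c, hc⟩ := exists_code_of_computable hF
  let _ : Inhabited Λ' := ⟨trNormal c .halt⟩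
  have hS := tr_supports c .halt
  have hq₀ : some (tr (trNormal c .halt)) ∈ TM2.stmts tr (codeSupp c .halt) :=
    TM2.some_mem_stmts hS.1
  have hfin : Finite {q // some q ∈ TM2.stmts tr (codeSupp c .halt)} :=
    Set.Finite.preimage (Option.some_injective _).injOn (Finset.finite_toSet _)
  refine ⟨_, inferInstance, StackMachine.ofTM2 hS ⟨_, hq₀⟩ none, fun s => ?_⟩
  set M := StackMachine.ofTM2 hS ⟨_, hq₀⟩ none with hM
  have hev := tr_eval c [wordVal s]
  rw [hc] at hev
  have hmem : halt [wordVal (F s)] ∈ StateTransition.eval (TM2.step tr) (init c [wordVal s]) := by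
    rw [hev]; exact Part.mem_map _ (Part.mem_some _)
  obtain ⟨hr, -⟩ := StateTransition.mem_eval.1 hmem
  obtain ⟨n, hn⟩ := exists_simulates_of_reaches hS ⟨_, hq₀⟩ none hr
    (c := (M.start, inputStacks s)) ⟨rfl, rfl, by
      rw [init, trList_wordVal]; rfl⟩
  rw [← hM] at hn
  -- The simulation yields some halting time `n`, but the first one is wanted. Halted configurations
  -- are fixed, so the stacks are the same at both times.
  have hex : ∃ t, M.halted (M.step^[t] (M.start, inputStacks s)).1 := ⟨n, hn.1⟩
  refine ⟨Nat.find hex, Nat.find_spec hex, fun t' h => Nat.find_min hex h, ?_⟩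
  have hle : Nat.find hex ≤ n := Nat.find_min' hex hn.1
  have hst : ∀ m, M.step^[m] (M.step^[Nat.find hex] (M.start, inputStacks s)) =
      M.step^[Nat.find hex] (M.start, inputStacks s) :=
    fun m => Function.iterate_fixed (step_ofTM2_of_halted hS _ _ (Nat.find_spec hex)) m
  rw [← hst (n - Nat.find hex), ← Function.iterate_add_apply, Nat.sub_add_cancel hle, hn.2.2,
    ← trList_wordVal]
  rfl

end

/-! ### Automata with two heads, and the rational relations accepted by them. -/

section

open Filter

/-! ### Two-headed automata -/

theorem prefixWord_succ {X : Type*} (x : ℕ → X) (n : ℕ) :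
    prefixWord x (n + 1) = prefixWord x n ++ [x n] := by
  simp [prefixWord, List.range_succ]

@[simp]
theorem length_prefixWord {X : Type*} (x : ℕ → X) (n : ℕ) : (prefixWord x n).length = n := by
  simp [prefixWord]

theorem prefixWord_append_two {X : Type*} (x : ℕ → X) (n : ℕ) :
    prefixWord x (n + 2) = prefixWord x n ++ [x n, x (n + 1)] := by
  simp [prefixWord_succ]

/-- The infinite word of consecutive pairs of letters. -/
def pairWord {X : Type*} (x : ℕ → X) (i : ℕ) : X × X := (x (2 * i), x (2 * i + 1))

/-- A nondeterministic automaton with two heads that move independently on two infinite words;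
a transition reads at most one letter on each of them. -/
structure HeadAutomaton (K L : Type) where
  start : K
  step : K → Option L → Option L → K → Prop
  accept : Set K

/-- Reading `o` moves the head on `z` from position `i` to position `i'`. -/
def Reads {L : Type} (z : ℕ → L) (o : Option L) (i i' : ℕ) : Prop :=
  (o = none ∧ i' = i) ∨ (o = some (z i) ∧ i' = i + 1)

theorem Reads.le {L : Type} {z : ℕ → L} {o : Option L} {i i' : ℕ} (h : Reads z o i i') :
    i ≤ i' := by
  rcases h with ⟨-, rfl⟩ | ⟨-, rfl⟩ <;> omega

theorem reads_none {L : Type} (z : ℕ → L) (i : ℕ) : Reads z none i i := Or.inl ⟨rfl, rfl⟩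

theorem reads_some {L : Type} (z : ℕ → L) (i : ℕ) : Reads z (some (z i)) i (i + 1) :=
  Or.inr ⟨rfl, rfl⟩

@[simp]
theorem reads_none_iff {L : Type} {z : ℕ → L} {i i' : ℕ} : Reads z none i i' ↔ i' = i := by
  simp [Reads]

@[simp]
theorem reads_some_iff {L : Type} {z : ℕ → L} {l : L} {i i' : ℕ} :
    Reads z (some l) i i' ↔ l = z i ∧ i' = i + 1 := by
  simp [Reads]

namespace HeadAutomaton

variable {K L : Type} (M : HeadAutomaton K L) (z₁ z₂ : ℕ → L)

/-- One move between configurations (state and positions of the heads). -/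
def Move (c c' : K × ℕ × ℕ) : Prop :=
  ∃ o₁ o₂, M.step c.1 o₁ o₂ c'.1 ∧ Reads z₁ o₁ c.2.1 c'.2.1 ∧ Reads z₂ o₂ c.2.2 c'.2.2

/-- There is a successful run from the configuration. -/
def AcceptsFrom (d : K × ℕ × ℕ) : Prop :=
  ∃ c : ℕ → K × ℕ × ℕ, c 0 = d ∧ (∀ n, M.Move z₁ z₂ (c n) (c (n + 1))) ∧
    (∃ᶠ n in atTop, (c n).1 ∈ M.accept) ∧
    Tendsto (fun n => (c n).2.1) atTop atTop ∧ Tendsto (fun n => (c n).2.2) atTop atTop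

/-- The pair of infinite words is accepted. -/
def Accepts : Prop := M.AcceptsFrom z₁ z₂ (M.start, 0, 0)

variable {M z₁ z₂}

theorem AcceptsFrom.head {d d' : K × ℕ × ℕ} (h : M.Move z₁ z₂ d d') (h' : M.AcceptsFrom z₁ z₂ d') :
    M.AcceptsFrom z₁ z₂ d := by
  obtain ⟨c, rfl, hc, ha, h1, h2⟩ := h'
  refine ⟨fun n => Nat.casesOn n d c, rfl, fun n => ?_, ?_, ?_, ?_⟩
  · cases n with
    | zero => exact h
    | succ n => exact hc n
  · rw [frequently_atTop] at ha ⊢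
    intro a
    obtain ⟨b, hb, hb'⟩ := ha a
    exact ⟨b + 1, by omega, hb'⟩
  · exact (tendsto_add_atTop_iff_nat 1).1 h1
  · exact (tendsto_add_atTop_iff_nat 1).1 h2

theorem AcceptsFrom.of_reflTransGen {d d' : K × ℕ × ℕ}
    (h : Relation.ReflTransGen (M.Move z₁ z₂) d d') (h' : M.AcceptsFrom z₁ z₂ d') :
    M.AcceptsFrom z₁ z₂ d := by
  induction h using Relation.ReflTransGen.head_induction_on with
  | refl => exact h'
  | head hm _ ih => exact ih.head hm

theorem reflTransGen_of_move {c : ℕ → K × ℕ × ℕ} (hc : ∀ n, M.Move z₁ z₂ (c n) (c (n + 1)))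
    (n : ℕ) : Relation.ReflTransGen (M.Move z₁ z₂) (c 0) (c n) := by
  induction n with
  | zero => exact .refl
  | succ n ih => exact ih.tail (hc n)

/-- Acceptance by reaching an absorbing state. -/
theorem accepts_iff_reach {a : K} (ha : M.accept = {a})
    (hloop : ∀ l₁ l₂, M.step a (some l₁) (some l₂) a) :
    M.Accepts z₁ z₂ ↔
      ∃ i j, Relation.ReflTransGen (M.Move z₁ z₂) (M.start, 0, 0) (a, i, j) := by
  constructor
  · rintro ⟨c, h0, hc, hf, -⟩
    obtain ⟨n, hn⟩ := hf.exists
    rw [ha, Set.mem_singleton_iff] at hn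
    refine ⟨(c n).2.1, (c n).2.2, ?_⟩
    rw [← h0, ← hn]
    exact reflTransGen_of_move hc n
  · rintro ⟨i, j, h⟩
    refine AcceptsFrom.of_reflTransGen h ⟨fun n => (a, i + n, j + n), rfl, fun n => ?_, ?_, ?_, ?_⟩
    · exact ⟨_, _, hloop (z₁ (i + n)) (z₂ (j + n)), reads_some _ _, reads_some _ _⟩
    · exact Frequently.of_forall fun n => by simp [ha]
    · exact tendsto_atTop_mono (fun n => Nat.le_add_left n i) tendsto_id
    · exact tendsto_atTop_mono (fun n => Nat.le_add_left n j) tendsto_id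

/-- The automaton that guesses which of two automata accepts. -/
def union {K' : Type} (M : HeadAutomaton K L) (M' : HeadAutomaton K' L) :
    HeadAutomaton (Option (K ⊕ K')) L where
  start := none
  step q o₁ o₂ q' :=
    (∃ k k', q = some (.inl k) ∧ q' = some (.inl k') ∧ M.step k o₁ o₂ k') ∨
    (∃ k k', q = some (.inr k) ∧ q' = some (.inr k') ∧ M'.step k o₁ o₂ k') ∨
    (q = none ∧ o₁ = none ∧ o₂ = none ∧
      (q' = some (.inl M.start) ∨ q' = some (.inr M'.start)))
  accept := some '' (Sum.inl '' M.accept ∪ Sum.inr '' M'.accept)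

/-- The first move reads nothing and chooses a component, which a run never leaves; dropping or
adding this move does not affect the conditions at infinity. -/
theorem union_accepts {K' : Type} {M' : HeadAutomaton K' L} :
    (M.union M').Accepts z₁ z₂ ↔ M.Accepts z₁ z₂ ∨ M'.Accepts z₁ z₂ := by
  constructor
  · rintro ⟨c, h0, hc, hf, h1, h2⟩
    have hf' : ∃ᶠ n in atTop, (c (n + 1)).1 ∈ (M.union M').accept := by
      rw [frequently_atTop] at hf ⊢
      intro a
      obtain ⟨b, hb, hb'⟩ := hf (a + 1)
      exact ⟨b - 1, by omega, by rwa [Nat.sub_add_cancel (by omega)]⟩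
    have h1' := (tendsto_add_atTop_iff_nat 1).2 h1
    have h2' := (tendsto_add_atTop_iff_nat 1).2 h2
    have hstart : (c 1 = (some (.inl M.start), 0, 0)) ∨ (c 1 = (some (.inr M'.start), 0, 0)) := by
      obtain ⟨o₁, o₂, hs, hr1, hr2⟩ := hc 0
      rw [h0] at hs hr1 hr2
      rcases hs with ⟨k, k', hk, -⟩ | ⟨k, k', hk, -⟩ | ⟨-, rfl, rfl, hs⟩
      · cases hk
      · cases hk
      · simp only [reads_none_iff] at hr1 hr2
        rcases hs with hs | hs
        · left; exact Prod.ext hs (Prod.ext hr1 hr2)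
        · right; exact Prod.ext hs (Prod.ext hr1 hr2)
    rcases hstart with hstart | hstart
    · left
      have hin : ∀ n, ∃ k, (c (n + 1)).1 = some (.inl k) := by
        intro n
        induction n with
        | zero => exact ⟨_, by rw [hstart]⟩
        | succ n ih =>
          obtain ⟨k, hk⟩ := ih
          obtain ⟨o₁, o₂, hs, -⟩ := hc (n + 1)
          rw [hk] at hs
          rcases hs with ⟨_, k', -, h, -⟩ | ⟨_, k', hk, -⟩ | ⟨hk, -⟩
          · exact ⟨k', h⟩
          · simp at hk
          · simp at hk
      choose q hq using hin
      refine ⟨fun n => (q n, (c (n + 1)).2), ?_, fun n => ?_, ?_, h1', h2'⟩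
      · have := hq 0
        simp only [zero_add, hstart, Option.some.injEq, Sum.inl.injEq] at this ⊢
        rw [this]
      · obtain ⟨o₁, o₂, hs, hr⟩ := hc (n + 1)
        rw [hq n, hq (n + 1)] at hs
        refine ⟨o₁, o₂, ?_, hr⟩
        rcases hs with ⟨k, k', hk, hk', h⟩ | ⟨_, k', hk, -⟩ | ⟨hk, -⟩
        · simp only [Option.some.injEq, Sum.inl.injEq] at hk hk'
          subst hk hk'; exact h
        · simp at hk
        · simp at hk
      · refine hf'.mono fun n hn => ?_
        rw [hq n] at hn
        simpa [union] using hn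
    · right
      have hin : ∀ n, ∃ k, (c (n + 1)).1 = some (.inr k) := by
        intro n
        induction n with
        | zero => exact ⟨_, by rw [hstart]⟩
        | succ n ih =>
          obtain ⟨k, hk⟩ := ih
          obtain ⟨o₁, o₂, hs, -⟩ := hc (n + 1)
          rw [hk] at hs
          rcases hs with ⟨_, k', hk, -⟩ | ⟨_, k', -, h, -⟩ | ⟨hk, -⟩
          · simp at hk
          · exact ⟨k', h⟩
          · simp at hk
      choose q hq using hin
      refine ⟨fun n => (q n, (c (n + 1)).2), ?_, fun n => ?_, ?_, h1', h2'⟩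
      · have := hq 0
        simp only [zero_add, hstart, Option.some.injEq, Sum.inr.injEq] at this ⊢
        rw [this]
      · obtain ⟨o₁, o₂, hs, hr⟩ := hc (n + 1)
        rw [hq n, hq (n + 1)] at hs
        refine ⟨o₁, o₂, ?_, hr⟩
        rcases hs with ⟨_, k', hk, -⟩ | ⟨k, k', hk, hk', h⟩ | ⟨hk, -⟩
        · simp at hk
        · simp only [Option.some.injEq, Sum.inr.injEq] at hk hk'
          subst hk hk'; exact h
        · simp at hk
      · refine hf'.mono fun n hn => ?_
        rw [hq n] at hn
        simpa [union] using hn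
  · rintro (⟨c, h0, hc, hf, h1, h2⟩ | ⟨c, h0, hc, hf, h1, h2⟩)
    · refine AcceptsFrom.head (d' := (some (.inl M.start), 0, 0)) ⟨none, none, ?_, by simp, by simp⟩
        ⟨fun n => (some (.inl (c n).1), (c n).2), by simp [h0], fun n => ?_, ?_, h1, h2⟩
      · simp [union]
      · obtain ⟨o₁, o₂, hs, hr⟩ := hc n
        exact ⟨o₁, o₂, Or.inl ⟨_, _, rfl, rfl, hs⟩, hr⟩
      · exact hf.mono fun n hn => ⟨_, Or.inl ⟨_, hn, rfl⟩, rfl⟩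
    · refine AcceptsFrom.head (d' := (some (.inr M'.start), 0, 0)) ⟨none, none, ?_, by simp, by simp⟩
        ⟨fun n => (some (.inr (c n).1), (c n).2), by simp [h0], fun n => ?_, ?_, h1, h2⟩
      · simp [union]
      · obtain ⟨o₁, o₂, hs, hr⟩ := hc n
        exact ⟨o₁, o₂, Or.inr (Or.inl ⟨_, _, rfl, rfl, hs⟩), hr⟩
      · exact hf.mono fun n hn => ⟨_, Or.inr ⟨_, hn, rfl⟩, rfl⟩

end HeadAutomaton

/-! ### Relations accepted by two-headed automata are rational -/

/-- The word of length `0` or `2` spelled by an optional pair of letters. -/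
def pairList {S : Type} (o : Option (S × S)) : List S := o.elim [] fun p => [p.1, p.2]

/-- A transition reads on each tape nothing or a whole round, one letter of each player. The word
spelled by the first `n` transitions therefore has length `2 * i n`, where `i n` is the position of
the head on `pairWord x`. -/
theorem isInfiniteConcat_pairList {S : Type} (o : ℕ → Option (S × S)) (x : ℕ → S) :
    IsInfiniteConcat (fun n => pairList (o n)) x ↔
      ∃ i : ℕ → ℕ, i 0 = 0 ∧ (∀ n, Reads (pairWord x) (o n) (i n) (i (n + 1))) ∧
        Tendsto i atTop atTop := by
  constructor
  · rintro ⟨h1, h2⟩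
    have hev : ∀ n, ∃ i, (prefixWord (fun n => pairList (o n)) n).flatten.length = 2 * i := by
      intro n
      induction n with
      | zero => exact ⟨0, rfl⟩
      | succ n ih =>
        obtain ⟨i, hi⟩ := ih
        rw [prefixWord_succ, List.flatten_append, List.length_append, hi]
        cases o n with
        | none => exact ⟨i, by simp [pairList]⟩
        | some p => exact ⟨i + 1, by simp [pairList]; ring⟩
    choose i hi using hev
    refine ⟨i, by have := hi 0; simpa [prefixWord] using this.symm, fun n => ?_, ?_⟩
    · have e0 := hi n
      have e1 := hi (n + 1)
      have w0 := h1 n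
      have w1 := h1 (n + 1)
      rw [e1] at w1
      rw [e0] at w0
      rw [prefixWord_succ, List.flatten_append, List.length_append, e0] at e1
      rw [prefixWord_succ, List.flatten_append, w0] at w1
      cases ho : o n with
      | none => simp [ho, pairList] at e1; simp; omega
      | some p =>
        simp [ho, pairList] at e1
        have e2 : i (n + 1) = i n + 1 := by omega
        rw [e2, mul_add, mul_one, prefixWord_append_two] at w1
        simp [ho, pairList] at w1
        simp [e2, pairWord, ← w1.1, ← w1.2]
    · rw [tendsto_atTop_atTop]
      intro b
      obtain ⟨n, hn⟩ := h2 (2 * b)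
      refine ⟨n, fun m hm => ?_⟩
      have mono : Monotone i := by
        refine monotone_nat_of_le_succ fun n => ?_
        have e0 := hi n
        have e1 := hi (n + 1)
        rw [prefixWord_succ, List.flatten_append, List.length_append, e0] at e1
        omega
      have := mono hm
      rw [hi n] at hn
      omega
  · rintro ⟨i, h0, hr, ht⟩
    have key : ∀ n, (prefixWord (fun n => pairList (o n)) n).flatten = prefixWord x (2 * i n) := by
      intro n
      induction n with
      | zero => simp [prefixWord, h0]
      | succ n ih =>
        rw [prefixWord_succ, List.flatten_append, ih]
        rcases hr n with ⟨h, h'⟩ | ⟨h, h'⟩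
        · rw [h, h']; simp [pairList]
        · rw [h, h', mul_add, mul_one, prefixWord_append_two]; simp [pairList, pairWord]
    refine ⟨fun n => by rw [key]; simp, fun N => ?_⟩
    obtain ⟨n, hn⟩ := (ht.eventually_ge_atTop N).exists
    exact ⟨n, by rw [key, length_prefixWord]; omega⟩

/-- The pigeonhole principle reconciles the two forms of the Büchi condition. -/
theorem frequently_mem_iff_of_finite {K : Type*} [Finite K] {q : ℕ → K} {A : Set K} :
    (∃ᶠ n in atTop, q n ∈ A) ↔ ∃ f ∈ A, ∃ᶠ n in atTop, q n = f := by
  constructor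
  · intro h
    by_contra! hcon
    refine h ?_
    have : ∀ᶠ n in atTop, ∀ f : K, f ∈ A → q n ≠ f := by
      rw [eventually_all]
      intro f
      by_cases hf : f ∈ A
      · filter_upwards [hcon f hf] with n hn _ using hn
      · exact Eventually.of_forall fun n h => absurd h hf
    filter_upwards [this] with n hn h using hn _ h rfl
  · rintro ⟨f, hf, h⟩
    exact h.mono fun n hn => hn ▸ hf

theorem HeadAutomaton.isInfinitaryRational {K S : Type} [Finite K] [Finite S]
    (M : HeadAutomaton K (S × S)) :
    IsInfinitaryRational {p : (ℕ → S) × (ℕ → S) | M.Accepts (pairWord p.1) (pairWord p.2)} := by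
  refine ⟨K, inferInstance, ⟨{t | ∃ o₁ o₂, M.step t.1 o₁ o₂ t.2.2.2 ∧ t.2.1 = pairList o₁ ∧
    t.2.2.1 = pairList o₂}, ?_, M.start, M.accept⟩, ?_⟩
  · refine (Set.finite_range fun t : K × Option (S × S) × Option (S × S) × K =>
      (t.1, pairList t.2.1, pairList t.2.2.1, t.2.2.2)).subset ?_
    rintro ⟨q, u, v, q'⟩ ⟨o₁, o₂, -, h1, h2⟩
    exact ⟨(q, o₁, o₂, q'), by simp_all⟩
  · ext ⟨x, y⟩
    simp only [Set.mem_ofPred_eq, TwoTapeBuchi.relation, TwoTapeBuchi.IsComputation,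
      TwoTapeBuchi.IsSuccessful]
    constructor
    · rintro ⟨c, h0, hc, hf, h1, h2⟩
      choose o₁ o₂ hs hr1 hr2 using hc
      refine ⟨fun n => (c n).1, fun n => pairList (o₁ n), fun n => pairList (o₂ n),
        ⟨by simp [h0], fun n => ⟨_, _, hs n, rfl, rfl⟩⟩, frequently_mem_iff_of_finite.1 hf, ?_, ?_⟩
      · exact (isInfiniteConcat_pairList _ _).2 ⟨_, by simp [h0], hr1, h1⟩
      · exact (isInfiniteConcat_pairList _ _).2 ⟨_, by simp [h0], hr2, h2⟩
    · rintro ⟨q, u, v, ⟨h0, hc⟩, hf, h1, h2⟩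
      choose o₁ o₂ hs hu hv using hc
      obtain rfl : u = fun n => pairList (o₁ n) := funext hu
      obtain rfl : v = fun n => pairList (o₂ n) := funext hv
      obtain ⟨i, hi0, hi, hit⟩ := (isInfiniteConcat_pairList _ _).1 h1
      obtain ⟨j, hj0, hj, hjt⟩ := (isInfiniteConcat_pairList _ _).1 h2
      exact ⟨fun n => (q n, i n, j n), by simp [h0, hi0, hj0],
        fun n => ⟨_, _, hs n, hi n, hj n⟩, frequently_mem_iff_of_finite.2 hf, hit, hjt⟩

/-! ### Gluing finite paths -/

theorem exists_path_of_transGen {α : Type*} {r : α → α → Prop} {a b : α}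
    (h : Relation.TransGen r a b) :
    ∃ (n : ℕ) (p : ℕ → α), p 0 = a ∧ p (n + 1) = b ∧ ∀ i ≤ n, r (p i) (p (i + 1)) := by
  induction h using Relation.TransGen.head_induction_on with
  | single h => exact ⟨0, fun n => Nat.casesOn n _ fun _ => b, rfl, rfl, fun i hi => by
      obtain rfl : i = 0 := by omega
      exact h⟩
  | @head a c h _ ih =>
    obtain ⟨n, p, h0, h1, hp⟩ := ih
    refine ⟨n + 1, fun n => Nat.casesOn n a p, rfl, h1, fun i hi => ?_⟩
    cases i with
    | zero => simpa [h0] using h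
    | succ i => exact hp i (by omega)

/-- Serves to build a run that is known only at selected moments `φ k`. Each piece has at least one
move, which makes `φ` strictly increasing. -/
theorem exists_run_of_transGen {α : Type*} {r : α → α → Prop} {d : ℕ → α}
    (h : ∀ k, Relation.TransGen r (d k) (d (k + 1))) :
    ∃ (c : ℕ → α) (φ : ℕ → ℕ), c 0 = d 0 ∧ (∀ n, r (c n) (c (n + 1))) ∧ StrictMono φ ∧
      ∀ k, c (φ k) = d k := by
  choose len p h0 h1 hp using fun k => exists_path_of_transGen (h k)
  let φ : ℕ → ℕ := fun k => ∑ i ∈ Finset.range k, (len i + 1)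
  have hφ : ∀ k, φ (k + 1) = φ k + (len k + 1) := fun k => Finset.sum_range_succ _ _
  have hmono : StrictMono φ := strictMono_nat_of_lt_succ fun k => by rw [hφ]; omega
  have hex : ∀ n, ∃ k, n < φ (k + 1) := fun n => ⟨n, hmono.id_le (n + 1)⟩
  let blk : ℕ → ℕ := fun n => Nat.find (hex n)
  have hblk : ∀ n k, φ k ≤ n → n < φ (k + 1) → blk n = k := by
    intro n k hk hk'
    refine (Nat.find_eq_iff _).2 ⟨hk', fun m hm => ?_⟩
    have := hmono.monotone (show m + 1 ≤ k from hm)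
    omega
  have hrep : ∀ n, ∃ k j, j ≤ len k ∧ n = φ k + j := by
    intro n
    have hlt : n < φ (blk n + 1) := Nat.find_spec (hex n)
    have hle : φ (blk n) ≤ n := by
      rcases Nat.eq_zero_or_pos (blk n) with hz | hz
      · rw [hz]; simp [φ]
      · have := Nat.find_min (hex n) (show blk n - 1 < blk n by omega)
        rw [Nat.sub_add_cancel hz] at this
        omega
    rw [hφ] at hlt
    exact ⟨blk n, n - φ (blk n), by omega, by omega⟩
  let c : ℕ → α := fun n => p (blk n) (n - φ (blk n))
  have hc : ∀ k j, j ≤ len k + 1 → c (φ k + j) = p k j := by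
    intro k j hj
    rcases Nat.lt_or_ge j (len k + 1) with hlt | hge
    · have : blk (φ k + j) = k := hblk _ _ (by omega) (by rw [hφ]; omega)
      simp [c, this]
    · obtain rfl : j = len k + 1 := by omega
      have : blk (φ k + (len k + 1)) = k + 1 :=
        hblk _ _ (by rw [hφ]) (by rw [hφ (k + 1), hφ k]; omega)
      simp [c, this, hφ, h0, h1]
  refine ⟨c, φ, ?_, fun n => ?_, hmono, fun k => by simpa [h0] using hc k 0 (by omega)⟩
  · simpa [h0, φ] using hc 0 0 (by omega)
  · obtain ⟨k, j, hj, rfl⟩ := hrep n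
    rw [hc k j (by omega), add_assoc, hc k (j + 1) (by omega)]
    exact hp k j hj

end

/-! ### Automata that find local errors and mismatched blocks. -/

section

open Filter

/-! ### Detecting errors of a synchronous deterministic automaton -/

section Local

variable {D L : Type} (δ : D → L → L → D) (bad : D → L → L → Prop) (d₀ : D)

/-- The two-headed automaton that accepts if a bad transition of a deterministic automaton,
reading both words synchronously, occurs. -/
def localAutomaton : HeadAutomaton (Option D) L where
  start := some d₀
  step q o₁ o₂ q' := ∃ l₁ l₂, o₁ = some l₁ ∧ o₂ = some l₂ ∧
    ((∃ d, q = some d ∧ (q' = some (δ d l₁ l₂) ∨ (bad d l₁ l₂ ∧ q' = none))) ∨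
      (q = none ∧ q' = none))
  accept := {none}

/-- The state of the deterministic automaton before reading the letters with index `i`. -/
def localState (z₁ z₂ : ℕ → L) : ℕ → D
  | 0 => d₀
  | i + 1 => δ (localState z₁ z₂ i) (z₁ i) (z₂ i)

/-- The only choice in a run is when to report a bad transition; until then both heads are at the
same position and the state is `localState`. -/
theorem localAutomaton_accepts (z₁ z₂ : ℕ → L) :
    (localAutomaton δ bad d₀).Accepts z₁ z₂ ↔
      ∃ i, bad (localState δ d₀ z₁ z₂ i) (z₁ i) (z₂ i) := by
  rw [HeadAutomaton.accepts_iff_reach (M := localAutomaton δ bad d₀) (a := none) rfl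
    (fun l₁ l₂ => ⟨l₁, l₂, rfl, rfl, Or.inr ⟨rfl, rfl⟩⟩)]
  constructor
  · rintro ⟨i, j, h⟩
    by_contra! hcon
    have inv : ∀ c, Relation.ReflTransGen ((localAutomaton δ bad d₀).Move z₁ z₂)
        ((localAutomaton δ bad d₀).start, 0, 0) c →
        c.1 = some (localState δ d₀ z₁ z₂ c.2.1) ∧ c.2.2 = c.2.1 := by
      intro c hc
      induction hc with
      | refl => exact ⟨rfl, rfl⟩
      | @tail c c' _ hm ih =>
        obtain ⟨q, i, j⟩ := c
        obtain ⟨q', i', j'⟩ := c'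
        obtain ⟨rfl, hj⟩ : q = some (localState δ d₀ z₁ z₂ i) ∧ j = i := ih
        subst hj
        obtain ⟨o₁, o₂, ⟨l₁, l₂, rfl, rfl, hs⟩, h1, h2⟩ := hm
        simp only [reads_some_iff] at h1 h2
        obtain ⟨rfl, rfl⟩ := h1
        obtain ⟨rfl, rfl⟩ := h2
        rcases hs with ⟨d, hd, hs⟩ | ⟨hd, -⟩
        · simp only [Option.some.injEq] at hd
          subst hd
          rcases hs with hs | ⟨hb, -⟩
          · exact ⟨hs, rfl⟩
          · exact absurd hb (hcon _)
        · simp at hd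
    have := (inv _ h).1
    simp at this
  · rintro ⟨i, hi⟩
    have hr : ∀ i, Relation.ReflTransGen ((localAutomaton δ bad d₀).Move z₁ z₂)
        ((localAutomaton δ bad d₀).start, 0, 0) (some (localState δ d₀ z₁ z₂ i), i, i) := by
      intro i
      induction i with
      | zero => exact .refl
      | succ i ih =>
        exact ih.tail ⟨_, _, ⟨_, _, rfl, rfl, Or.inl ⟨_, rfl, Or.inl rfl⟩⟩, reads_some _ _,
          reads_some _ _⟩
    exact ⟨i + 1, i + 1, (hr i).tail ⟨_, _, ⟨_, _, rfl, rfl, Or.inl ⟨_, rfl, Or.inr ⟨hi, rfl⟩⟩⟩,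
      reads_some _ _, reads_some _ _⟩⟩

end Local

/-! ### Comparing a block with a later one

Infinite words over `H ⊕ C` are seen as sequences of blocks, each formed by a header (in `H`)
and cells (in `C`). -/

/-- A comparison of a block whose header satisfies `src` with the first later block whose header
satisfies `tgt`: `okHead` relates the headers, and `ok` relates each cell of the later block, which
has to be one cell longer, with the cells of the earlier one at the previous, the same and the
next place. -/
structure Comparison (H C : Type) where
  src : H → Prop
  tgt : H → Prop
  okHead : H → Option C → H → Prop
  ok : H → H → Option C → Option C → Option C → C → Prop

/-- The states of the automaton that looks for a failure of a comparison. -/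
inductive CompareState (H C : Type)
  | scan
  | seek (h : H)
  | first (h g : H)
  | walk (h g : H) (l c : Option C)
  | tail
  | fail

instance {H C : Type} [Finite H] [Finite C] : Finite (CompareState H C) :=
  Finite.of_injective
    (β := Fin 3 ⊕ H ⊕ (H × H) ⊕ (H × H × Option C × Option C))
    (fun
      | .scan => .inl 0
      | .tail => .inl 1
      | .fail => .inl 2
      | .seek h => .inr (.inl h)
      | .first h g => .inr (.inr (.inl (h, g)))
      | .walk h g l c => .inr (.inr (.inr (h, g, l, c))))
    (by intro a b h; cases a <;> cases b <;> simp_all)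

namespace Comparison

variable {H C L : Type} (P : Comparison H C)

/-- `p'` is the position of the first header after position `p` that satisfies `tgt`. -/
structure Follows (y : ℕ → H ⊕ C) (p p' : ℕ) (h g : H) : Prop where
  head : y p = .inl h
  src : P.src h
  lt : p < p'
  head' : y p' = .inl g
  tgt : P.tgt g
  between : ∀ i g', p < i → i < p' → y i = .inl g' → ¬ P.tgt g'

/-- The cell with number `j` of the later block is as required. -/
def CellOK (y : ℕ → H ⊕ C) (p p' : ℕ) (h g : H) (j : ℕ) : Prop :=
  ∃ n, y (p' + 1 + j) = .inr n ∧ P.ok h g (y (p + j)).getRight? (y (p + 1 + j)).getRight?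
    ((y (p + 1 + j)).getRight?.bind fun _ => (y (p + 2 + j)).getRight?) n

/-- The infinite word passes the comparison. -/
def Holds (y : ℕ → H ⊕ C) : Prop :=
  ∀ p p' h g, P.Follows y p p' h g → P.okHead h (y (p + 1)).getRight? g ∧
    ∀ j, (∀ i < j, (y (p + 1 + i)).isRight) → P.CellOK y p p' h g j ∧
      ((y (p + 1 + j)).isLeft → (y (p' + 2 + j)).isLeft)

open CompareState in
/-- The transitions of the automaton that looks for a failure of the comparison. -/
inductive FailStep : CompareState H C → Option (H ⊕ C) → Option (H ⊕ C) → CompareState H C → Prop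
  | scan (a b) : FailStep scan (some a) (some b) scan
  | guess (h b) : P.src h → FailStep scan (some (.inl h)) (some b) (seek h)
  | skip (h b) : (∀ g, b = .inl g → ¬ P.tgt g) → FailStep (seek h) none (some b) (seek h)
  | found (h g) : P.tgt g → FailStep (seek h) none (some (.inl g)) (first h g)
  | badHead (h g a) : ¬ P.okHead h a.getRight? g → FailStep (first h g) (some a) none fail
  | goodHead (h g a) : FailStep (first h g) (some a) none (walk h g none a.getRight?)
  | badCell (h g l c a b) : (∀ n, b = .inr n → ¬ P.ok h g l (some c) a.getRight? n) →
      FailStep (walk h g l (some c)) (some a) (some b) fail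
  | goodCell (h g l c a b) :
      FailStep (walk h g l (some c)) (some a) (some b) (walk h g (some c) a.getRight?)
  | badLast (h g l b) : (∀ n, b = .inr n → ¬ P.ok h g l none none n) →
      FailStep (walk h g l none) none (some b) fail
  | goodLast (h g l b) : FailStep (walk h g l none) none (some b) tail
  | tooLong (c) : FailStep tail none (some (.inr c)) fail
  | loop (a b) : FailStep fail (some a) (some b) fail

/-- The two-headed automaton that looks for a failure of the comparison. -/
def automaton (lett : L → H ⊕ C) : HeadAutomaton (CompareState H C) L where
  start := .scan
  step q o₁ o₂ q' := P.FailStep q (o₁.map lett) (o₂.map lett) q'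
  accept := {.fail}

/-- What is known about the reachable configurations. -/
def Inv (y : ℕ → H ⊕ C) : CompareState H C × ℕ × ℕ → Prop
  | (.scan, i, j) => i = j
  | (.seek h, i, j) => ∃ p, y p = .inl h ∧ P.src h ∧ i = p + 1 ∧ p < j ∧
      ∀ i' g', p < i' → i' < j → y i' = .inl g' → ¬ P.tgt g'
  | (.first h g, i, j) => ∃ p p', P.Follows y p p' h g ∧ i = p + 1 ∧ j = p' + 1
  | (.walk h g l c, i, j) => ∃ p p' k, P.Follows y p p' h g ∧
      (∀ i' < k, (y (p + 1 + i')).isRight) ∧ l = (y (p + k)).getRight? ∧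
      c = (y (p + 1 + k)).getRight? ∧ i = p + 2 + k ∧ j = p' + 1 + k
  | (.tail, _, j) => ∃ p p' h g k, P.Follows y p p' h g ∧
      (∀ i' < k, (y (p + 1 + i')).isRight) ∧ (y (p + 1 + k)).isLeft ∧ j = p' + 2 + k
  | (.fail, _, _) => False

theorem move_iff (lett : L → H ⊕ C) {z₁ z₂ : ℕ → L} {q q' : CompareState H C} {i j i' j' : ℕ} :
    (P.automaton lett).Move z₁ z₂ (q, i, j) (q', i', j') ↔
      ∃ o₁ o₂, P.FailStep q o₁ o₂ q' ∧ Reads (lett ∘ z₁) o₁ i i' ∧ Reads (lett ∘ z₂) o₂ j j' := by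
  constructor
  · rintro ⟨o₁, o₂, hs, h1, h2⟩
    refine ⟨_, _, hs, ?_, ?_⟩
    · rcases h1 with ⟨h, h'⟩ | ⟨h, h'⟩ <;> simp_all
    · rcases h2 with ⟨h, h'⟩ | ⟨h, h'⟩ <;> simp_all
  · have lift : ∀ {z : ℕ → L} {o i i'}, Reads (lett ∘ z) o i i' →
        ∃ o', o'.map lett = o ∧ Reads z o' i i' := by
      rintro z o i i' (⟨rfl, rfl⟩ | ⟨rfl, rfl⟩)
      · exact ⟨none, rfl, by simp⟩
      · exact ⟨some (z i), rfl, by simp⟩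
    rintro ⟨o₁, o₂, hs, h1, h2⟩
    obtain ⟨o₁, rfl, h1'⟩ := lift h1
    obtain ⟨o₂, rfl, h2'⟩ := lift h2
    exact ⟨o₁, o₂, hs, h1', h2'⟩

/-- Each transition into `fail` from a configuration that satisfies the invariant would exhibit a
violation of `Holds`. As the invariant is false at `fail`, this state is unreachable. -/
theorem inv_of_move {P : Comparison H C} {y : ℕ → H ⊕ C} (hy : P.Holds y)
    {q q' : CompareState H C} {i j i' j' : ℕ} {o₁ o₂ : Option (H ⊕ C)}
    (hs : P.FailStep q o₁ o₂ q') (h1 : Reads y o₁ i i') (h2 : Reads y o₂ j j')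
    (hinv : P.Inv y (q, i, j)) : P.Inv y (q', i', j') := by
  cases hs with
  | scan =>
    simp only [reads_some_iff] at h1 h2
    simp only [Inv] at hinv ⊢
    omega
  | guess h b hh =>
    simp only [reads_some_iff] at h1 h2
    simp only [Inv] at hinv ⊢
    exact ⟨i, h1.1.symm, hh, h1.2, by omega, fun i' _ _ _ => by omega⟩
  | skip h b hb =>
    simp only [reads_some_iff, reads_none_iff] at h1 h2
    obtain ⟨p, hp, hsrc, rfl, hlt, hbet⟩ := hinv
    refine ⟨p, hp, hsrc, h1, by omega, fun i' g' hi hi' hg => ?_⟩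
    rcases Nat.lt_or_ge i' j with hij | hij
    · exact hbet i' g' hi hij hg
    · obtain rfl : i' = j := by omega
      exact hb g' (h2.1.trans hg)
  | found h g hg =>
    simp only [reads_some_iff, reads_none_iff] at h1 h2
    obtain ⟨p, hp, hsrc, rfl, hlt, hbet⟩ := hinv
    exact ⟨p, j, ⟨hp, hsrc, hlt, h2.1.symm, hg, hbet⟩, h1, h2.2⟩
  | badHead h g a ha =>
    simp only [reads_some_iff, reads_none_iff] at h1 h2
    obtain ⟨p, p', hf, rfl, rfl⟩ := hinv
    exact ha (h1.1 ▸ (hy _ _ _ _ hf).1)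
  | goodHead h g a =>
    simp only [reads_some_iff, reads_none_iff] at h1 h2
    obtain ⟨p, p', hf, rfl, rfl⟩ := hinv
    exact ⟨p, p', 0, hf, by simp, by simp [hf.head], by simp [h1.1], by omega, by omega⟩
  | badCell h g l c a b hb =>
    simp only [reads_some_iff] at h1 h2
    obtain ⟨p, p', k, hf, hk, rfl, hc, rfl, rfl⟩ := hinv
    obtain ⟨⟨n, hn, hok⟩, -⟩ := (hy _ _ _ _ hf).2 k hk
    rw [← hc] at hok
    exact hb n (h2.1.trans hn) (by simpa [h1.1] using hok)
  | goodCell h g l c a b =>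
    simp only [reads_some_iff] at h1 h2
    obtain ⟨p, p', k, hf, hk, rfl, hc, rfl, rfl⟩ := hinv
    refine ⟨p, p', k + 1, hf, fun i' hi' => ?_, ?_, ?_, by omega, by omega⟩
    · rcases Nat.lt_or_ge i' k with hik | hik
      · exact hk i' hik
      · obtain rfl : i' = k := by omega
        rw [eq_comm, Sum.getRight?_eq_some_iff] at hc
        simp [hc]
    · rw [hc]; congr 2; omega
    · rw [h1.1]; congr 2; omega
  | badLast h g l b hb =>
    simp only [reads_some_iff, reads_none_iff] at h1 h2
    obtain ⟨p, p', k, hf, hk, rfl, hc, rfl, rfl⟩ := hinv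
    obtain ⟨⟨n, hn, hok⟩, -⟩ := (hy _ _ _ _ hf).2 k hk
    rw [← hc] at hok
    exact hb n (h2.1.trans hn) (by simpa using hok)
  | goodLast h g l b =>
    simp only [reads_some_iff, reads_none_iff] at h1 h2
    obtain ⟨p, p', k, hf, hk, rfl, hc, rfl, rfl⟩ := hinv
    refine ⟨p, p', h, g, k, hf, hk, ?_, by omega⟩
    rwa [eq_comm, Sum.getRight?_eq_none_iff] at hc
  | tooLong c =>
    simp only [reads_some_iff, reads_none_iff] at h1 h2
    obtain ⟨p, p', h, g, k, hf, hk, hc, rfl⟩ := hinv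
    have := ((hy _ _ _ _ hf).2 k hk).2 hc
    rw [← h2.1] at this
    simp at this
  | loop a b => exact hinv

/-- Given a violation, the automaton scans to the header of the earlier block, parks the first head
there, sends the second one to the next target, and then moves both through their blocks until the
violation is seen. -/
theorem automaton_accepts (lett : L → H ⊕ C) {z₁ z₂ : ℕ → L} {y : ℕ → H ⊕ C}
    (h₁ : lett ∘ z₁ = y) (h₂ : lett ∘ z₂ = y) :
    (P.automaton lett).Accepts z₁ z₂ ↔ ¬ P.Holds y := by
  rw [HeadAutomaton.accepts_iff_reach (M := P.automaton lett) (a := .fail) rfl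
    (fun _ _ => FailStep.loop _ _)]
  constructor
  · rintro ⟨i, j, h⟩ hy
    have inv : ∀ c, Relation.ReflTransGen ((P.automaton lett).Move z₁ z₂)
        ((P.automaton lett).start, 0, 0) c → P.Inv y c := by
      intro c hc
      induction hc with
      | refl => exact rfl
      | @tail c c' _ hm ih =>
        obtain ⟨o₁, o₂, hs, hr1, hr2⟩ := (P.move_iff lett).1 hm
        rw [h₁] at hr1
        rw [h₂] at hr2
        exact inv_of_move hy hs hr1 hr2 ih
    exact inv _ h
  · intro hy
    have mv : ∀ {q q' i j i' j'} (o₁ o₂), P.FailStep q o₁ o₂ q' → Reads y o₁ i i' →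
        Reads y o₂ j j' → (P.automaton lett).Move z₁ z₂ (q, i, j) (q', i', j') :=
      fun o₁ o₂ hs hr1 hr2 => (P.move_iff lett).2 ⟨o₁, o₂, hs, h₁ ▸ hr1, h₂ ▸ hr2⟩
    have scan : ∀ p, Relation.ReflTransGen ((P.automaton lett).Move z₁ z₂)
        ((P.automaton lett).start, 0, 0) (.scan, p, p) := by
      intro p
      induction p with
      | zero => exact .refl
      | succ p ih => exact ih.tail (mv _ _ (.scan _ _) (reads_some _ _) (reads_some _ _))
    simp only [Holds, not_forall] at hy
    obtain ⟨p, p', h, g, hf, hy⟩ := hy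
    have seek : ∀ r, p + 1 + r ≤ p' → Relation.ReflTransGen ((P.automaton lett).Move z₁ z₂)
        ((P.automaton lett).start, 0, 0) (.seek h, p + 1, p + 1 + r) := by
      intro r
      induction r with
      | zero =>
        exact fun _ => (scan p).tail (mv (some (.inl h)) _ (.guess h _ hf.src)
          (hf.head ▸ reads_some _ _) (reads_some _ _))
      | succ r ih =>
        exact fun hr => (ih (by omega)).tail (mv none _ (.skip h _
          fun g' hg => hf.between _ g' (by omega) (by omega) hg) (reads_none _ _) (reads_some _ _))
    have hfirst : Relation.ReflTransGen ((P.automaton lett).Move z₁ z₂)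
        ((P.automaton lett).start, 0, 0) (.first h g, p + 1, p' + 1) := by
      have := seek (p' - (p + 1)) (by have := hf.lt; omega)
      rw [Nat.add_sub_cancel' hf.lt] at this
      exact this.tail (mv none (some (.inl g)) (.found h g hf.tgt) (reads_none _ _)
        (hf.head' ▸ reads_some _ _))
    -- The first head has already read the cell with number `k`, hence the position `p + 2 + k`: the
    -- next letter it reads is the right neighbour, while the left neighbour and the cell itself are
    -- kept in the state.
    have walk : ∀ k, (∀ i' < k, (y (p + 1 + i')).isRight) →
        Relation.ReflTransGen ((P.automaton lett).Move z₁ z₂) ((P.automaton lett).start, 0, 0)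
          (.walk h g (y (p + k)).getRight? (y (p + 1 + k)).getRight?, p + 2 + k, p' + 1 + k) := by
      intro k
      induction k with
      | zero =>
        intro _
        have := hfirst.tail (mv _ none (.goodHead h g _) (reads_some _ _) (reads_none _ _))
        simpa [hf.head] using this
      | succ k ih =>
        intro hk
        obtain ⟨c, hc⟩ := Sum.isRight_iff.1 (hk k (by omega))
        have hr := ih fun i' hi' => hk i' (by omega)
        rw [hc, Sum.getRight?_inr] at hr
        have := hr.tail (mv _ _ (.goodCell h g _ c _ _) (reads_some _ _) (reads_some _ _))
        rw [show p + (k + 1) = p + 1 + k by omega, hc, Sum.getRight?_inr,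
          show p + 1 + (k + 1) = p + 2 + k by omega]
        exact this
    by_cases hhead : P.okHead h (y (p + 1)).getRight? g
    · simp only [hhead, true_and, not_forall] at hy
      obtain ⟨k, hk, hy⟩ := hy
      have hr := walk k hk
      by_cases hcell : P.CellOK y p p' h g k
      · simp only [hcell, true_and, not_forall] at hy
        obtain ⟨hl, hy⟩ := hy
        rw [Sum.not_isLeft, Sum.isRight_iff] at hy
        obtain ⟨c, hc⟩ := hy
        rw [Sum.getRight?_eq_none_iff.2 hl] at hr
        refine ⟨_, p' + 2 + k + 1, (hr.tail (mv none _ (.goodLast h g _ _) (reads_none _ _)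
          (reads_some _ _))).tail (mv none (some (.inr c)) (.tooLong c) (reads_none _ _) ?_)⟩
        rw [show p' + 1 + k + 1 = p' + 2 + k by omega, ← hc]
        exact reads_some _ _
      · rcases hcur : y (p + 1 + k) with h' | c
        · rw [hcur, Sum.getRight?_inl] at hr
          refine ⟨_, _, hr.tail (mv none _ (.badLast h g _ _ fun n hn hok => hcell ?_)
            (reads_none _ _) (reads_some _ _))⟩
          exact ⟨n, hn, by simpa [hcur] using hok⟩
        · rw [hcur, Sum.getRight?_inr] at hr
          refine ⟨_, _, hr.tail (mv _ _ (.badCell h g _ c _ _ fun n hn hok => hcell ?_)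
            (reads_some _ _) (reads_some _ _))⟩
          exact ⟨n, hn, by simpa [hcur] using hok⟩
    · exact ⟨_, _, hfirst.tail (mv _ none (.badHead h g _ hhead) (reads_some _ _)
        (reads_none _ _))⟩

end Comparison

end

/-! ### Following a branch through a sequence of tables with two heads. -/

section

open Filter

/-! ### An automaton that follows a branch through a sequence of tables -/

/-- The positions of the tables in an infinite word: the `k`-th table starts at position `s k`, has
`2 ^ k + 3` entries, and there are entries only in the tables. -/
structure IsTableSequence (v : ℕ → Option Bool) (s : ℕ → ℕ) : Prop where
  before : ∀ i < s 0, v i = none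
  entry : ∀ k i, i < 2 ^ k + 3 → (v (s k + i)).isSome
  lt : ∀ k, s k + (2 ^ k + 3) < s (k + 1)
  gap : ∀ k i, s k + (2 ^ k + 3) ≤ i → i < s (k + 1) → v i = none

/-- The place of the entry of the branch `τ` in the `k`-th table. The order of the entries is
reversed from each table to the next one. -/
def branchIdx (τ : ℕ → Bool) : ℕ → ℕ
  | 0 => 2
  | k + 1 => 2 * (2 ^ k + 2 - branchIdx τ k) + (τ k).toNat

theorem branchIdx_congr {τ τ' : ℕ → Bool} {k : ℕ} (h : ∀ i < k, τ i = τ' i) :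
    branchIdx τ k = branchIdx τ' k := by
  induction k with
  | zero => rfl
  | succ k ih => rw [branchIdx, branchIdx, ih fun i hi => h i (by omega), h k (by omega)]

/-- Places `2` to `2 ^ k + 1` carry the branches; the places `0`, `1` and `2 ^ k + 2` are fillers.
Behind place `i` there are `2 ^ k + 2 - i` entries, and the successors stand at twice this number.
The final filler, which is always among these entries, makes up for the two initial fillers of the
next table. -/
theorem branchIdx_bounds (τ : ℕ → Bool) (k : ℕ) :
    2 ≤ branchIdx τ k ∧ branchIdx τ k ≤ 2 ^ k + 1 := by
  induction k with
  | zero => simp [branchIdx]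
  | succ k ih =>
    have := Bool.toNat_le (τ k)
    rw [branchIdx, pow_succ]
    omega

/-- The modes of the automaton. One of the heads leads: it is placed behind the chosen entry of a
table, while the other head goes to the next table and finds there the two successors of that
entry, whereupon the roles change. -/
inductive BranchMode
  | start | skip₁ | skip₂
  | picked (b : Bool)
  | before | inside | behind
  | walk | half | choose₀ | choose₁

instance : Finite BranchMode :=
  Finite.of_injective (β := Fin 12)
    (fun
      | .start => 0 | .skip₁ => 1 | .skip₂ => 2 | .picked false => 3 | .picked true => 4
      | .before => 5 | .inside => 6 | .behind => 7 | .walk => 8 | .half => 9 | .choose₀ => 10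
      | .choose₁ => 11)
    (by
      intro a b h
      rcases a with _ | _ | _ | (_ | _) <;> rcases b with _ | _ | _ | (_ | _) <;> simp_all)

open BranchMode in
/-- The transitions: mode, what is read by the leading and by the other head, new mode, and
whether the roles are exchanged. -/
inductive BranchRule :
    BranchMode → Option (Option Bool) → Option (Option Bool) → BranchMode → Bool → Prop
  | start : BranchRule start (some none) none start false
  | skip₁ (b) : BranchRule start (some (some b)) none skip₁ false
  | skip₂ (b) : BranchRule skip₁ (some (some b)) none skip₂ false
  | first (b) : BranchRule skip₂ (some (some b)) none (picked b) false
  | leave (b) : BranchRule (picked b) none none before false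
  | before : BranchRule before none (some none) before false
  | enter (b) : BranchRule before none (some (some b)) inside false
  | inside (b) : BranchRule inside none (some (some b)) inside false
  | exit : BranchRule inside none (some none) behind false
  | behind : BranchRule behind none (some none) behind false
  | arrive : BranchRule behind none none walk false
  | half (b b') : BranchRule walk (some (some b)) (some (some b')) half false
  | walk (b) : BranchRule half none (some (some b)) walk false
  | finish : BranchRule walk (some none) none choose₀ false
  | pick₀ (b) : BranchRule choose₀ none (some (some b)) (picked b) true
  | skip (b) : BranchRule choose₀ none (some (some b)) choose₁ false
  | pick₁ (b) : BranchRule choose₁ none (some (some b)) (picked b) true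

/-- Exchanges two objects if the flag is set. -/
def swapIf {α : Type*} (r : Bool) (a b : α) : α × α := cond r (b, a) (a, b)

/-- The two-headed automaton that follows a branch through the tables. -/
def branchAutomaton {L : Type} (val : L → Option Bool) : HeadAutomaton (Bool × BranchMode) L where
  start := (false, .start)
  step q o₁ o₂ q' := ∃ sw, q'.1 = xor q.1 sw ∧
    BranchRule q.2 ((swapIf q.1 o₁ o₂).1.map val) ((swapIf q.1 o₁ o₂).2.map val) q'.2 sw
  accept := {q | q.2 = .picked true}

section

variable {L : Type} {val : L → Option Bool} {z₁ z₂ : ℕ → L} {v : ℕ → Option Bool}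

theorem Reads.map {M : Type} (f : L → M) {z : ℕ → L} {o : Option L} {i i' : ℕ}
    (h : Reads z o i i') : Reads (f ∘ z) (o.map f) i i' := by
  rcases h with ⟨rfl, rfl⟩ | ⟨rfl, rfl⟩ <;> simp

theorem Reads.exists_of_comp {M : Type} {f : L → M} {z : ℕ → L} {o : Option M} {i i' : ℕ}
    (h : Reads (f ∘ z) o i i') : ∃ o', o'.map f = o ∧ Reads z o' i i' := by
  rcases h with ⟨rfl, rfl⟩ | ⟨rfl, rfl⟩
  · exact ⟨none, rfl, by simp⟩
  · exact ⟨some (z i), rfl, by simp⟩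

theorem branchAutomaton_move (h₁ : val ∘ z₁ = v) (h₂ : val ∘ z₂ = v) {r sw : Bool}
    {m m' : BranchMode} {a b : Option (Option Bool)} {l o l' o' : ℕ}
    (hr : BranchRule m a b m' sw) (hl : Reads v a l l') (ho : Reads v b o o') :
    (branchAutomaton val).Move z₁ z₂ ((r, m), swapIf r l o) ((xor r sw, m'), swapIf r l' o') := by
  subst h₁
  cases r
  · obtain ⟨a, rfl, ha⟩ := hl.exists_of_comp
    rw [← h₂] at ho
    obtain ⟨b, rfl, hb⟩ := ho.exists_of_comp
    exact ⟨a, b, ⟨sw, rfl, hr⟩, ha, hb⟩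
  · obtain ⟨b, rfl, hb⟩ := ho.exists_of_comp
    rw [← h₂] at hl
    obtain ⟨a, rfl, ha⟩ := hl.exists_of_comp
    exact ⟨b, a, ⟨sw, rfl, hr⟩, hb, ha⟩

theorem exists_of_branchAutomaton_move (h₁ : val ∘ z₁ = v) (h₂ : val ∘ z₂ = v) {r : Bool}
    {m : BranchMode} {l o : ℕ} {c' : (Bool × BranchMode) × ℕ × ℕ}
    (h : (branchAutomaton val).Move z₁ z₂ ((r, m), swapIf r l o) c') :
    ∃ a b sw m' l' o', c' = ((xor r sw, m'), swapIf r l' o') ∧ BranchRule m a b m' sw ∧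
      Reads v a l l' ∧ Reads v b o o' := by
  obtain ⟨⟨r', m'⟩, i', j'⟩ := c'
  obtain ⟨o₁, o₂, ⟨sw, hsw, hr⟩, hi, hj⟩ := h
  simp only at hsw hi hj
  subst hsw
  have hi' := hi.map val
  have hj' := hj.map val
  rw [h₁] at hi'
  rw [h₂] at hj'
  cases r
  · exact ⟨_, _, sw, m', i', j', rfl, hr, hi', hj'⟩
  · exact ⟨_, _, sw, m', j', i', rfl, hr, hj', hi'⟩

variable {s : ℕ → ℕ}

/-- A lower bound for the position of the other head when an entry of table `k` is picked. -/
def gapStart (s : ℕ → ℕ) : ℕ → ℕ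
  | 0 => 0
  | k + 1 => s k + (2 ^ k + 3)

theorem IsTableSequence.eq_none (hv : IsTableSequence v s) {k i : ℕ} (h : gapStart s k ≤ i)
    (h' : i < s k) : v i = none := by
  cases k with
  | zero => exact hv.before i h'
  | succ k => exact hv.gap k i h h'

theorem IsTableSequence.exists_eq_some (hv : IsTableSequence v s) {k i : ℕ} (h : s k ≤ i)
    (h' : i < s k + (2 ^ k + 3)) : ∃ b, v i = some b := by
  have := hv.entry k (i - s k) (by omega)
  rwa [Nat.add_sub_cancel' h, Option.isSome_iff_exists] at this

theorem IsTableSequence.eq_none_end (hv : IsTableSequence v s) (k : ℕ) :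
    v (s k + (2 ^ k + 3)) = none :=
  hv.gap k _ le_rfl (hv.lt k)

/-- What is known about the configurations of the automaton; `j` is the number of picked entries,
`l` and `o` are the positions of the leading and of the other head. -/
def BranchInv (v : ℕ → Option Bool) (s : ℕ → ℕ) (τ : ℕ → Bool) :
    ℕ → BranchMode → ℕ → ℕ → Prop
  | 0, .start, l, o => l ≤ s 0 ∧ o = 0
  | 0, .skip₁, l, o => l = s 0 + 1 ∧ o = 0
  | 0, .skip₂, l, o => l = s 0 + 2 ∧ o = 0
  | k + 1, .picked b, l, o => l = s k + branchIdx τ k + 1 ∧ gapStart s k ≤ o ∧ o ≤ s k ∧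
      v (s k + branchIdx τ k) = some b
  | k + 1, .before, l, o => l = s k + branchIdx τ k + 1 ∧ gapStart s k ≤ o ∧ o ≤ s k
  | k + 1, .inside, l, o => l = s k + branchIdx τ k + 1 ∧ s k ≤ o ∧ o ≤ s k + (2 ^ k + 3)
  | k + 1, .behind, l, o => l = s k + branchIdx τ k + 1 ∧ gapStart s (k + 1) ≤ o ∧ o ≤ s (k + 1)
  | k + 1, .walk, l, o => ∃ m, branchIdx τ k + m ≤ 2 ^ k + 2 ∧ l = s k + branchIdx τ k + 1 + m ∧
      (o = s (k + 1) + 2 * m ∨ (m = 0 ∧ gapStart s (k + 1) ≤ o ∧ o ≤ s (k + 1)))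
  | k + 1, .half, l, o => ∃ m, branchIdx τ k + m + 1 ≤ 2 ^ k + 2 ∧
      l = s k + branchIdx τ k + 2 + m ∧ o = s (k + 1) + 2 * m + 1
  | k + 1, .choose₀, l, o => ∃ m, branchIdx τ k + m = 2 ^ k + 2 ∧ l = s k + (2 ^ k + 3) + 1 ∧
      (o = s (k + 1) + 2 * m ∨ (m = 0 ∧ gapStart s (k + 1) ≤ o ∧ o ≤ s (k + 1)))
  | k + 1, .choose₁, l, o => ∃ m, branchIdx τ k + m = 2 ^ k + 2 ∧ l = s k + (2 ^ k + 3) + 1 ∧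
      o = s (k + 1) + 2 * m + 1
  | _, _, _, _ => False

/-- The invariant with the positions of the first and of the second head. -/
def BranchInvAt (v : ℕ → Option Bool) (s : ℕ → ℕ) (g : ℕ × (ℕ → Bool))
    (c : (Bool × BranchMode) × ℕ × ℕ) : Prop :=
  ∃ l o, c.2 = swapIf c.1.1 l o ∧ BranchInv v s g.2 g.1 c.1.2 l o

end

section

variable {L : Type} {val : L → Option Bool} {z₁ z₂ : ℕ → L} {v : ℕ → Option Bool} {s : ℕ → ℕ}

/-- Here `m` counts the entries behind the chosen one in table `k`, so the place `2 * m + c` in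
table `k + 1` is that of the branch with bit `k` set to `c`. After the exchange of roles, the former
leading head, just past table `k`, is in the right place to start towards table `k + 2`. -/
theorem BranchInv.pick (hv : IsTableSequence v s) {τ : ℕ → Bool} {k m l o : ℕ} {b c : Bool}
    (hm : branchIdx τ k + m = 2 ^ k + 2) (hl : l = s k + (2 ^ k + 3) + 1)
    (ho : o = s (k + 1) + 2 * m + c.toNat) (hb : v o = some b) :
    BranchInv v s (Function.update τ k c) (k + 2) (.picked b) (o + 1) l := by
  have hidx : branchIdx (Function.update τ k c) (k + 1) = 2 * m + c.toNat := by
    rw [branchIdx, branchIdx_congr (τ' := τ) fun i hi => Function.update_of_ne (by omega) _ _,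
      Function.update_self]
    omega
  have := hv.lt k
  refine ⟨by omega, by rw [gapStart]; omega, by omega, ?_⟩
  rw [hidx, ← add_assoc, ← ho, hb]

/-- The guess `arrive` may be made too early, which the invariant tolerates: the next time the other
head has to read an entry, it must be the first entry of the table, because the gap shows no
entries. Only a pick alters τ, and only in the bit just decided. -/
theorem BranchInv.step (hv : IsTableSequence v s) {τ : ℕ → Bool} {j l o l' o' : ℕ}
    {m m' : BranchMode} {a b : Option (Option Bool)} {sw : Bool} (hinv : BranchInv v s τ j m l o)
    (hr : BranchRule m a b m' sw) (hl : Reads v a l l') (ho : Reads v b o o') :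
    ∃ j' τ', (∀ i, i + 1 < j → τ' i = τ i) ∧ j ≤ j' ∧ ((∃ b, m' = .picked b) → j' = j + 1) ∧
      BranchInv v s τ' j' m' (swapIf sw l' o').1 (swapIf sw l' o').2 := by
  -- These three facts locate a head by what it reads: an entry seen by a head coming from the gap
  -- is the first of the table, a blank seen by a head coming from the table is the one right behind
  -- it, and an entry is not past the end.
  have gapz : ∀ {k i b}, gapStart s k ≤ i → i ≤ s k → v i = some b → i = s k := by
    intro k i b h h' hb
    by_contra hne
    rw [hv.eq_none h (by omega)] at hb
    simp at hb
  have ent : ∀ {k i}, s k ≤ i → i ≤ s k + (2 ^ k + 3) → v i = none → i = s k + (2 ^ k + 3) := by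
    intro k i h h' hb
    by_contra hne
    obtain ⟨b, hb'⟩ := hv.exists_eq_some h (by omega)
    simp [hb'] at hb
  have fin : ∀ {k i b}, i ≤ s k + (2 ^ k + 3) → v i = some b → i < s k + (2 ^ k + 3) := by
    intro k i b h hb
    refine lt_of_le_of_ne h fun hne => ?_
    rw [hne, hv.eq_none_end k] at hb
    simp at hb
  have bd := branchIdx_bounds τ
  cases hr <;> simp only [reads_none_iff, reads_some_iff] at hl ho
  case start =>
    rcases j with _ | k
    · refine ⟨0, τ, by simp, le_rfl, by simp, ?_⟩
      obtain ⟨h1, h2⟩ := hinv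
      refine ⟨?_, by simp [swapIf, ho, h2]⟩
      have : l ≠ s 0 := by
        rintro rfl
        have := hv.entry 0 0 (by simp)
        simp [← hl.1] at this
      simp [swapIf, hl.2]; omega
    · exact hinv.elim
  case skip₁ b =>
    rcases j with _ | k
    · refine ⟨0, τ, by simp, le_rfl, by simp, ?_⟩
      obtain ⟨h1, h2⟩ := hinv
      have := gapz (Nat.zero_le _) h1 hl.1.symm
      exact ⟨by simp [swapIf, hl.2, this], by simp [swapIf, ho, h2]⟩
    · exact hinv.elim
  case skip₂ b =>
    rcases j with _ | k
    · exact ⟨0, τ, by simp, le_rfl, by simp, by simp [swapIf, hl.2, hinv.1],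
        by simp [swapIf, ho, hinv.2]⟩
    · exact hinv.elim
  case first b =>
    rcases j with _ | k
    · refine ⟨1, τ, by simp, by simp, by simp, by simp [swapIf, hl.2, hinv.1, branchIdx], ?_, ?_, ?_⟩
      · simp [swapIf, gapStart]
      · simp [swapIf, ho, hinv.2]
      · simp [branchIdx, ← hinv.1, hl.1]
    · exact hinv.elim
  case leave b =>
    rcases j with _ | k
    · exact hinv.elim
    · subst hl ho
      exact ⟨k + 1, τ, fun _ _ => rfl, le_rfl, by simp, hinv.1, hinv.2.1, hinv.2.2.1⟩
  case before =>
    rcases j with _ | k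
    · exact hinv.elim
    · refine ⟨k + 1, τ, fun _ _ => rfl, le_rfl, by simp, ?_⟩
      obtain ⟨h1, h2, h3⟩ := hinv
      have : o ≠ s k := by
        rintro rfl
        have := hv.entry k 0 (by simp)
        simp [← ho.1] at this
      simp only [swapIf, cond_false, BranchInv]
      omega
  case enter b =>
    rcases j with _ | k
    · exact hinv.elim
    · refine ⟨k + 1, τ, fun _ _ => rfl, le_rfl, by simp, ?_⟩
      obtain ⟨h1, h2, h3⟩ := hinv
      have := gapz h2 h3 ho.1.symm
      have := Nat.two_pow_pos k
      simp only [swapIf, cond_false, BranchInv]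
      omega
  case inside b =>
    rcases j with _ | k
    · exact hinv.elim
    · refine ⟨k + 1, τ, fun _ _ => rfl, le_rfl, by simp, ?_⟩
      obtain ⟨h1, h2, h3⟩ := hinv
      have := fin h3 ho.1.symm
      simp only [swapIf, cond_false, BranchInv]
      omega
  case exit =>
    rcases j with _ | k
    · exact hinv.elim
    · refine ⟨k + 1, τ, fun _ _ => rfl, le_rfl, by simp, ?_⟩
      obtain ⟨h1, h2, h3⟩ := hinv
      have := ent h2 h3 ho.1.symm
      have := hv.lt k
      simp only [swapIf, cond_false, BranchInv, gapStart]
      omega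
  case behind =>
    rcases j with _ | k
    · exact hinv.elim
    · refine ⟨k + 1, τ, fun _ _ => rfl, le_rfl, by simp, ?_⟩
      obtain ⟨h1, h2, h3⟩ := hinv
      have : o ≠ s (k + 1) := by
        rintro rfl
        have := hv.entry (k + 1) 0 (by simp)
        simp [← ho.1] at this
      simp only [swapIf, cond_false, BranchInv]
      omega
  case arrive =>
    rcases j with _ | k
    · exact hinv.elim
    · refine ⟨k + 1, τ, fun _ _ => rfl, le_rfl, by simp, 0, ?_⟩
      obtain ⟨h1, h2, h3⟩ := hinv
      have := bd k
      simp only [swapIf, cond_false]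
      exact ⟨by omega, by omega, Or.inr ⟨trivial, by omega, by omega⟩⟩
  case half b b' =>
    rcases j with _ | k
    · exact hinv.elim
    · obtain ⟨m, h1, h2, h3⟩ := hinv
      refine ⟨k + 1, τ, fun _ _ => rfl, le_rfl, by simp, m, ?_⟩
      have := fin (k := k) (by omega) hl.1.symm
      have : o = s (k + 1) + 2 * m := by
        rcases h3 with h3 | ⟨rfl, h3, h4⟩
        · exact h3
        · exact gapz h3 h4 ho.1.symm
      simp only [swapIf, cond_false]
      omega
  case walk b =>
    rcases j with _ | k
    · exact hinv.elim
    · obtain ⟨m, h1, h2, h3⟩ := hinv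
      refine ⟨k + 1, τ, fun _ _ => rfl, le_rfl, by simp, m + 1, ?_⟩
      simp only [swapIf, cond_false]
      omega
  case finish =>
    rcases j with _ | k
    · exact hinv.elim
    · obtain ⟨m, h1, h2, h3⟩ := hinv
      refine ⟨k + 1, τ, fun _ _ => rfl, le_rfl, by simp, m, ?_⟩
      have := ent (k := k) (by omega) (by omega) hl.1.symm
      simp only [swapIf, cond_false]
      omega
  case pick₀ b =>
    rcases j with _ | k
    · exact hinv.elim
    · obtain ⟨m, h1, h2, h3⟩ := hinv
      have : o = s (k + 1) + 2 * m := by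
        rcases h3 with h3 | ⟨rfl, h3, h4⟩
        · exact h3
        · exact gapz h3 h4 ho.1.symm
      refine ⟨k + 2, Function.update τ k false, fun i hi => Function.update_of_ne (by omega) _ _,
        by omega, by simp, ?_⟩
      simp only [swapIf, cond_true]
      rw [hl, ho.2]
      exact BranchInv.pick hv h1 h2 (by simpa using this) ho.1.symm
  case skip b =>
    rcases j with _ | k
    · exact hinv.elim
    · obtain ⟨m, h1, h2, h3⟩ := hinv
      have : o = s (k + 1) + 2 * m := by
        rcases h3 with h3 | ⟨rfl, h3, h4⟩
        · exact h3
        · exact gapz h3 h4 ho.1.symm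
      refine ⟨k + 1, τ, fun _ _ => rfl, le_rfl, by simp, m, ?_⟩
      simp only [swapIf, cond_false]
      omega
  case pick₁ b =>
    rcases j with _ | k
    · exact hinv.elim
    · obtain ⟨m, h1, h2, h3⟩ := hinv
      refine ⟨k + 2, Function.update τ k true, fun i hi => Function.update_of_ne (by omega) _ _,
        by omega, by simp, ?_⟩
      simp only [swapIf, cond_true]
      rw [hl, ho.2]
      exact BranchInv.pick hv h1 h2 (by simpa using h3) ho.1.symm

theorem BranchInvAt.move (h₁ : val ∘ z₁ = v) (h₂ : val ∘ z₂ = v) (hv : IsTableSequence v s)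
    {g : ℕ × (ℕ → Bool)} {c c' : (Bool × BranchMode) × ℕ × ℕ} (hinv : BranchInvAt v s g c)
    (hm : (branchAutomaton val).Move z₁ z₂ c c') :
    ∃ g' : ℕ × (ℕ → Bool), (∀ i, i + 1 < g.1 → g'.2 i = g.2 i) ∧ g.1 ≤ g'.1 ∧
      ((∃ b, c'.1.2 = .picked b) → g'.1 = g.1 + 1) ∧ BranchInvAt v s g' c' := by
  obtain ⟨⟨r, m⟩, p⟩ := c
  obtain ⟨l, o, hp, hinv⟩ := hinv
  obtain rfl : p = swapIf r l o := hp
  obtain ⟨a, b, sw, m', l', o', rfl, hr, hl, ho⟩ := exists_of_branchAutomaton_move h₁ h₂ hm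
  obtain ⟨j', τ', h1, h2, h3, h4⟩ := hinv.step hv hr hl ho
  refine ⟨(j', τ'), h1, h2, h3, _, _, ?_, h4⟩
  cases r <;> cases sw <;> rfl

/-- Along an accepting run the invariant supplies finite approximations of τ. Bits of earlier stages
are never revised and the stage grows without bound, so the approximations converge to a branch that
agrees with every pick of the run. -/
theorem exists_branch_of_accepts (h₁ : val ∘ z₁ = v) (h₂ : val ∘ z₂ = v)
    (hv : IsTableSequence v s) (h : (branchAutomaton val).Accepts z₁ z₂) :
    ∃ τ, ∃ᶠ k in atTop, v (s k + branchIdx τ k) = some true := by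
  obtain ⟨c, h0, hc, hf, -⟩ := h
  have base : BranchInvAt v s (0, fun _ => false) (c 0) := by
    rw [h0]
    exact ⟨0, 0, rfl, Nat.zero_le _, rfl⟩
  choose! nxt hn using fun (n : ℕ) (g : ℕ × (ℕ → Bool)) (hg : BranchInvAt v s g (c n)) =>
    hg.move h₁ h₂ hv (hc n)
  let g : ℕ → ℕ × (ℕ → Bool) := fun n => Nat.rec (0, fun _ => false) nxt n
  have hg : ∀ n, BranchInvAt v s (g n) (c n) := by
    intro n
    induction n with
    | zero => exact base
    | succ n ih => exact (hn n _ ih).2.2.2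
  have hg1 : ∀ n i, i + 1 < (g n).1 → (g (n + 1)).2 i = (g n).2 i := fun n => (hn n _ (hg n)).1
  have hg2 : Monotone fun n => (g n).1 := monotone_nat_of_le_succ fun n => (hn n _ (hg n)).2.1
  have hg3 : ∀ n, (∃ b, (c (n + 1)).1.2 = .picked b) → (g (n + 1)).1 = (g n).1 + 1 :=
    fun n => (hn n _ (hg n)).2.2.1
  -- Each entrance into a state `picked` raises the stage by one, and acceptance provides infinitely
  -- many of them.
  have hunb : ∀ N, ∃ n, N < (g n).1 := by
    intro N
    induction N with
    | zero =>
      obtain ⟨n, hn, hn'⟩ := frequently_atTop.1 hf 1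
      refine ⟨n, ?_⟩
      have := hg3 (n - 1) ⟨true, by rw [Nat.sub_add_cancel hn]; exact hn'⟩
      rw [Nat.sub_add_cancel hn] at this
      omega
    | succ N ih =>
      obtain ⟨n, ih⟩ := ih
      obtain ⟨m, hm, hm'⟩ := frequently_atTop.1 hf (n + 1)
      refine ⟨m, ?_⟩
      have := hg3 (m - 1) ⟨true, by rw [Nat.sub_add_cancel (by omega)]; exact hm'⟩
      rw [Nat.sub_add_cancel (by omega)] at this
      have : (g n).1 ≤ (g (m - 1)).1 := hg2 (by omega)
      omega
  have hstab : ∀ n m i, n ≤ m → i + 1 < (g n).1 → (g m).2 i = (g n).2 i := by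
    intro n m i hnm hi
    induction m, hnm using Nat.le_induction with
    | base => rfl
    | succ m hm ih =>
      rw [hg1 m i (lt_of_lt_of_le hi (hg2 hm)), ih]
  choose w hw using hunb
  -- Bit `i` is taken at a moment when the stage exceeds `i + 1`, from which on it is final.
  refine ⟨fun i => (g (w (i + 1))).2 i, ?_⟩
  have hτ : ∀ n i, i + 1 < (g n).1 → (g (w (i + 1))).2 i = (g n).2 i := by
    intro n i hi
    rcases le_total n (w (i + 1)) with h | h
    · exact hstab _ _ _ h hi
    · exact (hstab _ _ _ h (hw (i + 1))).symm
  rw [frequently_atTop]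
  intro N
  obtain ⟨n, hn, hn'⟩ := frequently_atTop.1 hf (w (N + 1))
  obtain ⟨l, o, -, hinv⟩ := hg n
  have hn'' : (c n).1.2 = .picked true := hn'
  rw [hn''] at hinv
  have hN : N + 1 < (g n).1 := lt_of_lt_of_le (hw _) (hg2 hn)
  rcases hj : (g n).1 with _ | k
  · omega
  · rw [hj] at hinv
    refine ⟨k, by omega, ?_⟩
    rw [branchIdx_congr fun i hi => hτ n i (by omega)]
    exact hinv.2.2.2

theorem accepts_of_branch (h₁ : val ∘ z₁ = v) (h₂ : val ∘ z₂ = v) (hv : IsTableSequence v s)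
    {τ : ℕ → Bool} (h : ∃ᶠ k in atTop, v (s k + branchIdx τ k) = some true) :
    (branchAutomaton val).Accepts z₁ z₂ := by
  have mv : ∀ {r sw m m' l o l' o'} (a b), BranchRule m a b m' sw → Reads v a l l' →
      Reads v b o o' → (branchAutomaton val).Move z₁ z₂ ((r, m), swapIf r l o)
        ((xor r sw, m'), swapIf r l' o') := fun a b hr hl ho => branchAutomaton_move h₁ h₂ hr hl ho
  have mv0 : ∀ {r m m' l o l' o'} (a b), BranchRule m a b m' false → Reads v a l l' →
      Reads v b o o' → (branchAutomaton val).Move z₁ z₂ ((r, m), swapIf r l o)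
        ((r, m'), swapIf r l' o') := fun {r} _ _ _ _ _ _ a b hr hl ho => by
    have := mv (r := r) a b hr hl ho
    rwa [Bool.xor_false] at this
  have rd : ∀ {i x}, v i = x → Reads v (some x) i (i + 1) := fun {i x} h => h ▸ reads_some v i
  have bd := branchIdx_bounds τ
  have hidx : ∀ k, branchIdx τ k < 2 ^ k + 3 := fun k => by have := bd k; omega
  choose e he using fun k => hv.exists_eq_some (k := k) (i := s k + branchIdx τ k)
    (Nat.le_add_right _ _) (by have := hidx k; omega)
  -- the other head crosses a gap or a table
  have cross : ∀ (m : BranchMode) (P : ℕ → Prop) (r l o), (∀ i, P i → ∃ x,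
      v i = x ∧ BranchRule m none (some x) m false) → ∀ n, (∀ i, o ≤ i → i < o + n → P i) →
      Relation.ReflTransGen ((branchAutomaton val).Move z₁ z₂) ((r, m), swapIf r l o)
        ((r, m), swapIf r l (o + n)) := by
    intro m P r l o hP n
    induction n with
    | zero => exact fun _ => .refl
    | succ n ih =>
      intro hn
      obtain ⟨x, hx, hr⟩ := hP (o + n) (hn _ (by omega) (by omega))
      exact (ih fun i hi hi' => hn i hi (by omega)).tail (mv0 none _ hr (reads_none _ _) (rd hx))
  let oth : ℕ → ℕ := fun k => Nat.casesOn k 0 fun k => s k + (2 ^ k + 3) + 1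
  have hoth : ∀ k, gapStart s k ≤ oth k ∧ oth k ≤ s k := by
    rintro (_ | k)
    · simp [oth, gapStart]
    · have := hv.lt k
      simp only [oth, gapStart]
      omega
  let role : ℕ → Bool := fun k => Nat.bodd k
  -- The configuration right after the entry of table `k` has been picked. The roles have then been
  -- exchanged `k` times, and the other head is still where it stood at the end of the previous walk
  -- (at the origin for `k = 0`).
  let d : ℕ → (Bool × BranchMode) × ℕ × ℕ := fun k =>
    ((role k, .picked (e k)), swapIf (role k) (s k + branchIdx τ k + 1) (oth k))
  have hstart : Relation.ReflTransGen ((branchAutomaton val).Move z₁ z₂)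
      ((branchAutomaton val).start, 0, 0) (d 0) := by
    have h1 : ∀ n ≤ s 0, Relation.ReflTransGen ((branchAutomaton val).Move z₁ z₂)
        ((branchAutomaton val).start, 0, 0) ((false, .start), swapIf false n 0) := by
      intro n
      induction n with
      | zero => exact fun _ => .refl
      | succ n ih =>
        exact fun hn => (ih (by omega)).tail
          (mv0 _ none .start (rd (hv.before n (by omega))) (reads_none _ _))
    obtain ⟨b, hb⟩ := hv.exists_eq_some (k := 0) (i := s 0) le_rfl (by omega)
    obtain ⟨b', hb'⟩ := hv.exists_eq_some (k := 0) (i := s 0 + 1) (by omega) (by omega)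
    exact (((h1 _ le_rfl).tail (mv0 _ none (.skip₁ b) (rd hb) (reads_none _ _))).tail
      (mv0 _ none (.skip₂ b') (rd hb') (reads_none _ _))).tail
      (mv0 _ none (.first (e 0)) (rd (he 0)) (reads_none _ _))
  have hstep : ∀ k, Relation.TransGen ((branchAutomaton val).Move z₁ z₂) (d k) (d (k + 1)) := by
    intro k
    set r := role k
    set l := s k + branchIdx τ k + 1 with hl
    have hlt := hv.lt k
    have hpow := Nat.two_pow_pos k
    have p1 : (branchAutomaton val).Move z₁ z₂ (d k) ((r, .before), swapIf r l (oth k)) :=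
      mv0 none none (.leave _) (reads_none _ _) (reads_none _ _)
    have p2 := cross .before (fun i => gapStart s k ≤ i ∧ i < s k) r l (oth k)
      (fun i hi => ⟨none, hv.eq_none hi.1 hi.2, .before⟩) (s k - oth k)
      (fun i hi hi' => by have := hoth k; omega)
    rw [Nat.add_sub_cancel' (hoth k).2] at p2
    obtain ⟨b, hb⟩ := hv.exists_eq_some (k := k) (i := s k) le_rfl (by omega)
    have p3 := p2.tail (mv0 none _ (.enter b) (reads_none _ _) (rd hb))
    have p4 := cross .inside (fun i => s k ≤ i ∧ i < s k + (2 ^ k + 3)) r l (s k + 1)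
      (fun i hi => by
        obtain ⟨b, hb⟩ := hv.exists_eq_some hi.1 hi.2
        exact ⟨some b, hb, .inside b⟩) (2 ^ k + 2)
      (fun i hi hi' => by omega)
    have p5 := (p3.trans p4).tail (mv0 (o' := s k + (2 ^ k + 3) + 1) none _ .exit (reads_none _ _)
      (by rw [show s k + 1 + (2 ^ k + 2) = s k + (2 ^ k + 3) by omega]; exact rd (hv.eq_none_end k)))
    have p6 := cross .behind (fun i => gapStart s (k + 1) ≤ i ∧ i < s (k + 1)) r l
      (s k + (2 ^ k + 3) + 1) (fun i hi => ⟨none, hv.eq_none hi.1 hi.2, .behind⟩)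
      (s (k + 1) - (s k + (2 ^ k + 3) + 1)) (fun i hi hi' => by rw [gapStart]; omega)
    rw [Nat.add_sub_cancel' hlt] at p6
    have p7 := (p5.trans p6).tail (mv0 none none .arrive (reads_none _ _) (reads_none _ _))
    -- One entry of table `k` is passed for every two entries of table `k + 1`.
    have p8 : ∀ m, branchIdx τ k + m ≤ 2 ^ k + 2 →
        Relation.ReflTransGen ((branchAutomaton val).Move z₁ z₂)
          ((r, .walk), swapIf r l (s (k + 1)))
          ((r, .walk), swapIf r (l + m) (s (k + 1) + 2 * m)) := by
      intro m
      induction m with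
      | zero => exact fun _ => .refl
      | succ m ih =>
        intro hm
        have h2 : 2 ^ (k + 1) = 2 * 2 ^ k := by ring
        have := bd k
        obtain ⟨b, hb⟩ := hv.exists_eq_some (k := k) (i := l + m) (by omega) (by omega)
        obtain ⟨b', hb'⟩ := hv.exists_eq_some (k := k + 1) (i := s (k + 1) + 2 * m)
          (by omega) (by omega)
        obtain ⟨b'', hb''⟩ := hv.exists_eq_some (k := k + 1) (i := s (k + 1) + 2 * m + 1)
          (by omega) (by omega)
        exact ((ih (by omega)).tail (mv0 _ _ (.half b b') (rd hb) (rd hb'))).tail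
          (mv0 none _ (.walk b'') (reads_none _ _) (rd hb''))
    have hk := bd k
    set m := 2 ^ k + 2 - branchIdx τ k with hm
    have p9 := (p7.trans (p8 m (by omega))).tail (mv0 (l' := s k + (2 ^ k + 3) + 1) _ none .finish
      (by rw [show l + m = s k + (2 ^ k + 3) by omega]; exact rd (hv.eq_none_end k))
      (reads_none _ _))
    have hi : branchIdx τ (k + 1) = 2 * m + (τ k).toNat := rfl
    have hdk : d (k + 1) = ((xor r true, .picked (e (k + 1))),
        swapIf r (s k + (2 ^ k + 3) + 1) (s (k + 1) + branchIdx τ (k + 1) + 1)) := by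
      simp only [d, role, oth, r, Nat.bodd_succ]
      cases k.bodd <;> rfl
    have hek := he (k + 1)
    refine Relation.TransGen.head' p1 ?_
    rw [hdk]
    cases hτ : τ k
    · rw [hi, hτ] at hek ⊢
      exact p9.tail (mv none _ (.pick₀ _) (reads_none _ _) (rd hek))
    · rw [hi, hτ] at hek ⊢
      obtain ⟨b, hb⟩ := hv.exists_eq_some (k := k + 1) (i := s (k + 1) + 2 * m) (by omega)
        (by have := hidx (k + 1); rw [hi] at this; omega)
      exact (p9.tail (mv0 none _ (.skip b) (reads_none _ _) (rd hb))).tail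
        (mv none _ (.pick₁ _) (reads_none _ _) (rd hek))
  obtain ⟨c, φ, hc0, hc, hφ, hcφ⟩ := exists_run_of_transGen hstep
  refine HeadAutomaton.AcceptsFrom.of_reflTransGen hstart ⟨c, hc0, hc, ?_, ?_, ?_⟩
  · rw [frequently_atTop] at h ⊢
    intro N
    obtain ⟨k, hk, hk'⟩ := h N
    refine ⟨φ k, hk.trans (hφ.id_le k), ?_⟩
    rw [hcφ]
    rw [he k] at hk'
    simp only [Option.some.injEq] at hk'
    simp [d, branchAutomaton, hk']
  all_goals
    have hs : StrictMono s := strictMono_nat_of_lt_succ fun k => by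
      have := hv.lt k; have := Nat.two_pow_pos k; omega
    -- At a pick in table `k + 1` both heads are beyond the start of table `k`; positions being
    -- monotone, this suffices for both heads to tend to infinity.
    have hd : ∀ k, k ≤ (d (k + 1)).2.1 ∧ k ≤ (d (k + 1)).2.2 := by
      intro k
      have h1 := hs.id_le k
      have h2 := hs.id_le (k + 1)
      have := Nat.two_pow_pos k
      simp only [id_eq] at h1 h2
      simp only [d, swapIf, oth]
      cases role (k + 1) <;> simp only [cond_true, cond_false] <;> omega
  · refine tendsto_atTop_atTop_of_monotone (monotone_nat_of_le_succ fun n => ?_)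
      fun N => ⟨φ (N + 1), by rw [hcφ]; exact (hd N).1⟩
    obtain ⟨o₁, o₂, -, h, -⟩ := hc n
    exact h.le
  · refine tendsto_atTop_atTop_of_monotone (monotone_nat_of_le_succ fun n => ?_)
      fun N => ⟨φ (N + 1), by rw [hcφ]; exact (hd N).2⟩
    obtain ⟨o₁, o₂, -, -, h⟩ := hc n
    exact h.le

end

end

/-! ### The format of the record: blocks, configurations and inputs. -/

section

open Turing.PartrecToTM2

/-! ### Blocks -/

/-- The block with header `h` and the given cells starts at position `p`. -/
structure BlockAt {H C : Type} (y : ℕ → H ⊕ C) (p : ℕ) (h : H) (cells : List C) : Prop where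
  head : y p = .inl h
  cell : ∀ j c, cells[j]? = some c → y (p + 1 + j) = .inr c
  last : (y (p + 1 + cells.length)).isLeft

/-- The cell before the one with number `j`. -/
def prevCell {C : Type} (cells : List C) (j : ℕ) : Option C :=
  Nat.casesOn j none fun j => cells[j]?

namespace BlockAt

variable {H C : Type} {y : ℕ → H ⊕ C} {p : ℕ} {h : H} {cells : List C}

theorem getRight?_eq (hb : BlockAt y p h cells) {j : ℕ} (hj : j ≤ cells.length) :
    (y (p + 1 + j)).getRight? = cells[j]? := by
  rcases hc : cells[j]? with _ | c
  · obtain rfl : j = cells.length := by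
      rw [List.getElem?_eq_none_iff] at hc; omega
    exact Sum.getRight?_eq_none_iff.2 hb.last
  · rw [hb.cell j c hc, Sum.getRight?_inr]

theorem getRight?_prev (hb : BlockAt y p h cells) {j : ℕ} (hj : j ≤ cells.length + 1) :
    (y (p + j)).getRight? = prevCell cells j := by
  cases j with
  | zero => simp [hb.head, prevCell]
  | succ j => rw [show p + (j + 1) = p + 1 + j by omega, hb.getRight?_eq (by omega)]; rfl

theorem isRight_iff (hb : BlockAt y p h cells) {j : ℕ} (hj : j ≤ cells.length) :
    (y (p + 1 + j)).isRight ↔ j < cells.length := by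
  rcases Nat.lt_or_ge j cells.length with hlt | hge
  · rw [hb.cell j _ (List.getElem?_eq_getElem hlt)]; simp [hlt]
  · obtain rfl : j = cells.length := by omega
    have := hb.last
    rw [← Sum.not_isRight] at this
    simp [this]

theorem forall_isRight_iff (hb : BlockAt y p h cells) (j : ℕ) :
    (∀ i < j, (y (p + 1 + i)).isRight) ↔ j ≤ cells.length := by
  constructor
  · intro hj
    by_contra! hlt
    have := (hb.isRight_iff le_rfl).1 (hj _ hlt)
    omega
  · exact fun hj i hi => (hb.isRight_iff (by omega)).2 (by omega)

/-- No header lies strictly inside a block. -/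
theorem isRight_of_lt (hb : BlockAt y p h cells) {i : ℕ} (h1 : p < i)
    (h2 : i < p + 1 + cells.length) : (y i).isRight := by
  have := (hb.isRight_iff (j := i - (p + 1)) (by omega)).2 (by omega)
  rwa [Nat.add_sub_cancel' h1] at this

end BlockAt

namespace Comparison

variable {H C : Type} (P : Comparison H C)

/-- The comparison as a relation between blocks. -/
structure Rel (h : H) (cells : List C) (g : H) (cells' : List C) : Prop where
  head : P.okHead h cells[0]? g
  length : cells'.length = cells.length + 1
  cell : ∀ j n, cells'[j]? = some n → P.ok h g (prevCell cells j) cells[j]? cells[j + 1]? n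

variable {P} {y : ℕ → H ⊕ C} {p p' : ℕ} {h g : H} {cells cells' : List C}

/-- The `bind` in `CellOK` blinds the comparison to letters beyond the end of the earlier block:
behind its closing header there may be a cell of another block. On the list of cells it makes no
difference. -/
theorem bind_getElem? (cells : List C) (j : ℕ) :
    (cells[j]?.bind fun _ => cells[j + 1]?) = cells[j + 1]? := by
  rcases hc : cells[j]? with _ | c
  · rw [List.getElem?_eq_none_iff] at hc
    rw [Option.bind_none, List.getElem?_eq_none (by omega)]
  · rfl

theorem cellOK_iff (hb : BlockAt y p h cells) {j : ℕ} (hj : j ≤ cells.length) :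
    P.CellOK y p p' h g j ↔
      ∃ n, y (p' + 1 + j) = .inr n ∧ P.ok h g (prevCell cells j) cells[j]? cells[j + 1]? n := by
  have e : ((y (p + 1 + j)).getRight?.bind fun _ => (y (p + 2 + j)).getRight?) = cells[j + 1]? := by
    rw [hb.getRight?_eq hj, ← bind_getElem? cells j]
    rcases Nat.lt_or_ge j cells.length with hlt | hge
    · rw [show p + 2 + j = p + 1 + (j + 1) by omega, hb.getRight?_eq (by omega)]
    · rw [List.getElem?_eq_none hge, Option.bind_none, Option.bind_none]
  rw [CellOK, e, hb.getRight?_eq hj, hb.getRight?_prev (by omega)]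

/-- A block that follows the rules is determined by the comparison. -/
theorem Holds.exists_block (hy : P.Holds y) (hb : BlockAt y p h cells)
    (hf : P.Follows y p p' h g) : ∃ cells', BlockAt y p' g cells' ∧ P.Rel h cells g cells' := by
  obtain ⟨h1, h2⟩ := hy _ _ _ _ hf
  have h3 : ∀ j, j ≤ cells.length → ∃ n, y (p' + 1 + j) = .inr n ∧
      P.ok h g (prevCell cells j) cells[j]? cells[j + 1]? n := fun j hj =>
    (cellOK_iff hb hj).1 (h2 j ((hb.forall_isRight_iff j).2 hj)).1
  have : Nonempty C := (h3 0 (Nat.zero_le _)).nonempty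
  choose! n hn hok using h3
  have hget : ∀ j c, ((List.range (cells.length + 1)).map n)[j]? = some c →
      j ≤ cells.length ∧ n j = c := by
    intro j c hc
    simp only [List.getElem?_map, Option.map_eq_some_iff] at hc
    obtain ⟨a, ha, rfl⟩ := hc
    rw [List.getElem?_eq_some_iff] at ha
    obtain ⟨ha, rfl⟩ := ha
    simp only [List.length_range] at ha
    simp only [List.getElem_range, and_true]
    omega
  refine ⟨(List.range (cells.length + 1)).map n, ⟨hf.head', ?_, ?_⟩, ?_, by simp, ?_⟩
  · intro j c hc
    obtain ⟨hj, rfl⟩ := hget j c hc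
    exact hn j hj
  · have := (h2 cells.length ((hb.forall_isRight_iff _).2 le_rfl)).2 hb.last
    simpa [add_assoc, add_comm, add_left_comm] using this
  · rwa [← hb.getRight?_eq (Nat.zero_le _)]
  · intro j c hc
    obtain ⟨hj, rfl⟩ := hget j c hc
    exact hok j hj

/-- A word all of whose blocks are related passes the comparison. -/
theorem holds_of_rel (H' : ∀ p p' h g, P.Follows y p p' h g → ∃ cells cells',
    BlockAt y p h cells ∧ BlockAt y p' g cells' ∧ P.Rel h cells g cells') : P.Holds y := by
  intro p p' h g hf
  obtain ⟨cells, cells', hb, hb', hr⟩ := H' p p' h g hf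
  refine ⟨hb.getRight?_eq (Nat.zero_le _) ▸ hr.head, fun j hj => ?_⟩
  rw [hb.forall_isRight_iff] at hj
  constructor
  · rw [cellOK_iff hb hj]
    have hj' : j < cells'.length := by rw [hr.length]; omega
    have := List.getElem?_eq_getElem hj'
    exact ⟨_, hb'.cell j _ this, hr.cell j _ this⟩
  · intro hl
    have : j = cells.length := by
      by_contra hne
      have := (hb.isRight_iff hj).2 (by omega)
      rw [← Sum.not_isRight] at hl
      simp [this] at hl
    subst this
    have := hb'.last
    rw [hr.length] at this
    simpa [add_assoc, add_comm, add_left_comm] using this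

end Comparison

/-! ### The protocol of a sequence of computations -/

/-- Headers of blocks: a block either lists the input of a computation (with a parity bit), or is a
configuration with the given state. -/
inductive Header (Q : Type)
  | init (par : Bool)
  | state (q : Q)

/-- Cells of blocks: input bits, the last one of which is new, an end marker, and the columns of a
configuration, flagged in halting configurations. -/
inductive Cell
  | old (b : Bool)
  | new (par b : Bool)
  | last
  | col (flag : Bool) (c : K' → Option Γ')

instance {Q : Type} [Finite Q] : Finite (Header Q) :=
  Finite.of_injective (β := Bool ⊕ Q) (fun | .init p => .inl p | .state q => .inr q)
    (by intro a b h; cases a <;> cases b <;> simp_all)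

instance : Finite Cell :=
  Finite.of_injective (β := Bool ⊕ (Bool × Bool) ⊕ Unit ⊕ (Bool × (K' → Option Γ')))
    (fun
      | .old b => .inl b
      | .new p b => .inr (.inl (p, b))
      | .last => .inr (.inr (.inl ()))
      | .col f c => .inr (.inr (.inr (f, c))))
    (by intro a b h; cases a <;> cases b <;> simp_all)

/-- The input bit in a cell. -/
def Cell.bit? : Cell → Option Bool
  | .old b => some b
  | .new _ b => some b
  | _ => none

/-- The letters of the stacks in a cell. -/
def colAt : Option Cell → K' → Option Γ'
  | some (.col _ c) => c
  | _ => fun _ => none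

/-- The column in which only the main stack has a letter. -/
def mainCol (a : Γ') (k : K') : Option Γ' := if k = .main then some a else none

section Protocol

variable {Q : Type} (M : StackMachine Q K' Γ')

open Classical in
/-- Whether the header belongs to a halting configuration. -/
noncomputable def haltFlag (h : Header Q) : Bool := decide (∃ q, h = .state q ∧ M.halted q)

/-- The header of the block after a block of a computation that has not halted. -/
def nextHead (h : Header Q) (c : Option Cell) : Header Q :=
  match h with
  | .init _ => .state M.start
  | .state q => .state (M.next q (colAt c))

/-- A column of the next block. -/
def nextCol (h : Header Q) (l c r : Option Cell) : K' → Option Γ' :=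
  match h with
  | .init _ =>
    match c with
    | none => mainCol .cons
    | some c => mainCol (bitSym (c.bit?.getD true))
  | .state q => fun k =>
    match M.act q k with
    | none => colAt c k
    | some none => colAt r k
    | some (some a) => l.elim (some a) fun l => colAt (some l) k

/-- Each block of a computation that has not halted is followed by the next configuration. -/
noncomputable def stepComparison : Comparison (Header Q) Cell where
  src h := haltFlag M h = false
  tgt _ := True
  okHead h c g := g = nextHead M h c
  ok h g l c r n := n = .col (haltFlag M g) (nextCol M h l c r)

/-- The input of each computation extends the input of the previous one by one bit. -/
def initComparison (Q : Type) : Comparison (Header Q) Cell where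
  src h := ∃ p, h = .init p
  tgt h := ∃ p, h = .init p
  okHead h _ g := ∃ p, h = .init p ∧ g = .init !p
  ok _ g _ c _ n :=
    match c with
    | none => n = .last
    | some .last => ∃ p b, g = .init p ∧ n = .new p b
    | some c => ∃ b, c.bit? = some b ∧ n = .old b

/-- Whether the last block that started before position `i` is a halting configuration. -/
noncomputable def lastHalted (y : ℕ → Header Q ⊕ Cell) : ℕ → Bool
  | 0 => false
  | i + 1 => (y i).elim (haltFlag M) fun _ => lastHalted y i

/-- The infinite word `y` is a sequence of computations whose inputs are extended bit by bit; the
new bits at even places are taken from the infinite word `x`. -/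
structure IsProtocol (x : ℕ → Bool) (y : ℕ → Header Q ⊕ Cell) : Prop where
  zero : y 0 = .inl (.init false)
  one : y 1 = .inr .last
  two : (y 2).isLeft
  restart : ∀ i q, lastHalted M y i → y i ≠ .inl (.state q)
  copy : ∀ i b, y i = .inr (.new true b) → x i = b
  step : (stepComparison M).Holds y
  init : (initComparison Q).Holds y

/-- The cells of a configuration. -/
def confCells (f : Bool) (n : ℕ) (S : K' → List Γ') : List Cell :=
  (List.range n).map fun j => .col f fun k => (S k)[j]?

/-- The cells that list an input. -/
def initCells (s : List Bool) : List Cell :=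
  s.mapIdx (fun j b => if j + 1 = s.length then .new s.length.bodd b else .old b) ++ [.last]

/-- The header of the block that lists an input. -/
def initHead (s : List Bool) : Header Q := .init s.length.bodd

@[simp]
theorem length_confCells (f : Bool) (n : ℕ) (S : K' → List Γ') : (confCells f n S).length = n := by
  simp [confCells]

@[simp]
theorem length_initCells (s : List Bool) : (initCells s).length = s.length + 1 := by
  simp [initCells]

theorem confCells_getElem? (f : Bool) {n : ℕ} (S : K' → List Γ') {j : ℕ} (hj : j < n) :
    (confCells f n S)[j]? = some (.col f fun k => (S k)[j]?) := by
  simp [confCells, hj]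

theorem colAt_confCells {f : Bool} {n : ℕ} {S : K' → List Γ'} (hS : ∀ k, (S k).length ≤ n)
    (j : ℕ) : colAt (confCells f n S)[j]? = fun k => (S k)[j]? := by
  rcases Nat.lt_or_ge j n with hj | hj
  · rw [confCells_getElem? f S hj]; rfl
  · rw [List.getElem?_eq_none (by simpa using hj)]
    funext k
    rw [List.getElem?_eq_none ((hS k).trans hj)]
    rfl

theorem initCells_getElem?_of_lt {s : List Bool} {j : ℕ} (hj : j < s.length) :
    (initCells s)[j]? = some (if j + 1 = s.length then .new s.length.bodd s[j] else .old s[j]) := by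
  simp [initCells, List.getElem?_append, hj]

theorem initCells_getElem?_length (s : List Bool) : (initCells s)[s.length]? = some .last := by
  simp [initCells]

theorem bit?_initCells {s : List Bool} {j : ℕ} (hj : j < s.length) {c : Cell}
    (hc : (initCells s)[j]? = some c) : c.bit? = some s[j] := by
  rw [initCells_getElem?_of_lt hj] at hc
  simp only [Option.some.injEq] at hc
  subst hc
  split_ifs <;> simp [Cell.bit?]

/-- Header and cells of the later block are prescribed outright, so this relation is the graph of a
function. -/
theorem stepComparison_rel_iff {h g : Header Q} {cells cells' : List Cell} :
    (stepComparison M).Rel h cells g cells' ↔ g = nextHead M h cells[0]? ∧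
      cells' = (List.range (cells.length + 1)).map fun j =>
        .col (haltFlag M g) (nextCol M h (prevCell cells j) cells[j]? cells[j + 1]?) := by
  constructor
  · rintro ⟨h1, h2, h3⟩
    refine ⟨h1, List.ext_getElem (by simpa using h2) fun j hj hj' => ?_⟩
    have := h3 j _ (List.getElem?_eq_getElem hj)
    simpa [stepComparison] using this
  · rintro ⟨h1, rfl⟩
    refine ⟨h1, by simp, fun j n hn => ?_⟩
    rw [List.getElem?_eq_some_iff] at hn
    obtain ⟨hj, rfl⟩ := hn
    simp [stepComparison]

theorem nextHead_conf {f : Bool} {n : ℕ} {S : K' → List Γ'} (hS : ∀ k, (S k).length ≤ n) (q : Q) :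
    nextHead M (.state q) (confCells f n S)[0]? = .state (M.step (q, S)).1 := by
  simp only [nextHead, colAt_confCells hS, StackMachine.step, List.head?_eq_getElem?]

/-- The number of a cell is the depth in the stacks. Popping and pushing shift a stack by one place,
so each new column is determined by three neighbouring ones. A stack gains at most one letter per
step, and one additional cell per block always provides the room. -/
theorem nextCells_conf {f f' : Bool} {n : ℕ} {S : K' → List Γ'} (hS : ∀ k, (S k).length ≤ n)
    (q : Q) : ((List.range ((confCells f n S).length + 1)).map fun j => Cell.col f'
      (nextCol M (.state q) (prevCell (confCells f n S) j) (confCells f n S)[j]?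
        (confCells f n S)[j + 1]?)) = confCells f' (n + 1) (M.step (q, S)).2 := by
  rw [length_confCells, confCells.eq_def f']
  refine List.map_congr_left fun j hj => ?_
  rw [List.mem_range] at hj
  congr 1
  funext k
  simp only [nextCol, StackMachine.step]
  rcases M.act q k with _ | _ | a
  · simp [colAt_confCells hS, StackMachine.applyAct]
  · simp [colAt_confCells hS, StackMachine.applyAct]
  · cases j with
    | zero => simp [prevCell, StackMachine.applyAct]
    | succ j =>
      simp only [prevCell, StackMachine.applyAct, List.getElem?_cons_succ]
      rw [confCells_getElem? f S (by omega)]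
      rfl

theorem length_step_le {n : ℕ} {S : K' → List Γ'} (hS : ∀ k, (S k).length ≤ n) (q : Q) (k : K') :
    ((M.step (q, S)).2 k).length ≤ n + 1 := by
  have := hS k
  simp only [StackMachine.step, StackMachine.applyAct]
  split <;> simp <;> omega

/-- The marker `last`, which has no bit, gets the default `true` and so becomes the closing `bit1`
of the input; the additional cell receives `cons`. -/
theorem nextCells_init {f : Bool} (s : List Bool) (p : Bool) :
    ((List.range ((initCells s).length + 1)).map fun j => Cell.col f
      (nextCol M (.init p) (prevCell (initCells s) j) (initCells s)[j]? (initCells s)[j + 1]?)) =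
      confCells f (s.length + 2) (inputStacks s) := by
  rw [length_initCells, confCells]
  refine List.map_congr_left fun j hj => ?_
  rw [List.mem_range] at hj
  congr 1
  have hcol : ∀ a, ((s.map bitSym ++ [Γ'.bit1, Γ'.cons])[j]? = some a) →
      mainCol a = fun k => (inputStacks s k)[j]? := by
    intro a ha
    funext k
    cases k <;> simp [mainCol, inputStacks, ha]
  rcases Nat.lt_trichotomy j s.length with hlt | rfl | hgt
  · have hc := initCells_getElem?_of_lt hlt
    simp only [nextCol]
    rw [hc]
    refine hcol _ ?_
    rw [bit?_initCells hlt hc]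
    simp [List.getElem?_append, hlt]
  · simp only [nextCol]
    rw [initCells_getElem?_length]
    exact hcol _ (by simp [Cell.bit?, bitSym])
  · obtain rfl : j = s.length + 1 := by omega
    simp only [nextCol]
    rw [List.getElem?_eq_none (by simp)]
    exact hcol _ (by simp)

theorem length_inputStacks_le (s : List Bool) (k : K') :
    (inputStacks s k).length ≤ s.length + 2 := by
  cases k <;> simp [inputStacks]

theorem initComparison_ok_iff {h g : Header Q} {l r : Option Cell} {c n : Cell} {b : Bool}
    (hb : c.bit? = some b) : (initComparison Q).ok h g l (some c) r n ↔ n = .old b := by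
  cases c with
  | old b' =>
    obtain rfl : b' = b := by simpa [Cell.bit?] using hb
    simp only [initComparison, Cell.bit?, Option.some.injEq, exists_eq_left']
  | new p b' =>
    obtain rfl : b' = b := by simpa [Cell.bit?] using hb
    simp only [initComparison, Cell.bit?, Option.some.injEq, exists_eq_left']
  | last => simp [Cell.bit?] at hb
  | col => simp [Cell.bit?] at hb

/-- The marker `last` gives way to a new bit and moves on by one cell. The value of this bit is not
constrained: this is where the moves of the binary game enter the record. -/
theorem initComparison_rel_iff {s : List Bool} {g : Header Q} {cells' : List Cell} :
    (initComparison Q).Rel (initHead s) (initCells s) g cells' ↔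
      ∃ b, g = initHead (s ++ [b]) ∧ cells' = initCells (s ++ [b]) := by
  have hpar : ∀ b, (initHead (s ++ [b]) : Header Q) = .init (!s.length.bodd) := by
    simp [initHead]
  constructor
  · rintro ⟨⟨p, hp, rfl⟩, h2, h3⟩
    simp only [initHead, Header.init.injEq] at hp
    subst hp
    rw [length_initCells] at h2
    have hl := h3 s.length _ (List.getElem?_eq_getElem (by omega))
    rw [initCells_getElem?_length] at hl
    obtain ⟨p, b, hp, hb⟩ := hl
    simp only [Header.init.injEq] at hp
    subst hp
    refine ⟨b, (hpar b).symm, List.ext_getElem (by simp [h2]) fun j hj hj' => ?_⟩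
    rw [← Option.some_inj, ← List.getElem?_eq_getElem hj']
    rcases Nat.lt_trichotomy j s.length with hlt | rfl | hgt
    · have := h3 j _ (List.getElem?_eq_getElem hj)
      have hc := List.getElem?_eq_getElem (l := initCells s) (i := j) (by simp; omega)
      rw [hc, initComparison_ok_iff (bit?_initCells hlt hc)] at this
      rw [initCells_getElem?_of_lt (by simp; omega), if_neg (by simp; omega), this,
        List.getElem_append_left hlt]
    · rw [initCells_getElem?_of_lt (by simp), if_pos (by simp), hb]
      simp
    · obtain rfl : j = s.length + 1 := by omega
      have := h3 (s.length + 1) _ (List.getElem?_eq_getElem hj)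
      rw [List.getElem?_eq_none (l := initCells s) (by simp)] at this
      have e : (s ++ [b]).length = s.length + 1 := by simp
      rw [this, ← e, initCells_getElem?_length]
  · rintro ⟨b, rfl, rfl⟩
    refine ⟨⟨_, rfl, hpar b⟩, by simp, fun j n hn => ?_⟩
    have hj : j < (initCells (s ++ [b])).length := (List.getElem?_eq_some_iff.1 hn).1
    simp only [length_initCells, List.length_append, List.length_singleton] at hj
    rcases Nat.lt_trichotomy j s.length with hlt | rfl | hgt
    · rw [initCells_getElem?_of_lt (by simp; omega), if_neg (by simp; omega)] at hn
      have hc := List.getElem?_eq_getElem (l := initCells s) (i := j) (by simp; omega)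
      rw [hc, initComparison_ok_iff (bit?_initCells hlt hc)]
      rw [List.getElem_append_left hlt, Option.some.injEq] at hn
      exact hn.symm
    · rw [initCells_getElem?_of_lt (by simp), if_pos (by simp)] at hn
      rw [initCells_getElem?_length]
      exact ⟨_, _, rfl, by simpa using hn.symm⟩
    · obtain rfl : j = s.length + 1 := by omega
      have e : (s ++ [b]).length = s.length + 1 := by simp
      rw [← e, initCells_getElem?_length] at hn
      rw [List.getElem?_eq_none (l := initCells s) (by simp)]
      simpa [initComparison] using hn.symm

end Protocol

end

/-! ### What the protocol forces: stages, inputs and tables. -/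

section

open Turing.PartrecToTM2

/-! ### The structure of the words that follow the protocol -/

/-- The machine computes the function `F` on binary words. -/
def StackMachine.Computes {Q : Type} (M : StackMachine Q K' Γ') (F : List Bool → List Bool) :
    Prop :=
  ∀ s, ∃ t, M.halted (M.step^[t] (M.start, inputStacks s)).1 ∧
    (∀ t' < t, ¬ M.halted (M.step^[t'] (M.start, inputStacks s)).1) ∧
    (M.step^[t] (M.start, inputStacks s)).2 .main = (F s).map bitSym ++ [Γ'.bit1, Γ'.cons]

/-- The bit represented by a stack letter. -/
def symBit : Option Γ' → Option Bool
  | some .bit1 => some true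
  | some .bit0 => some false
  | _ => none

/-- The table entry shown by a cell. -/
def Cell.val : Cell → Option Bool
  | .col true c => symBit (c .main)
  | _ => none

/-- The table entry shown by a letter. -/
def letterVal {Q : Type} (a : Header Q ⊕ Cell) : Option Bool := a.elim (fun _ => none) Cell.val

section

variable {Q : Type} {M : StackMachine Q K' Γ'} {F : List Bool → List Bool} {x : ℕ → Bool}
  {y : ℕ → Header Q ⊕ Cell}

theorem BlockAt.letterVal_eq_none {p : ℕ} {h : Header Q} {cells : List Cell}
    (hb : BlockAt y p h cells) (hc : ∀ c ∈ cells, c.val = none) {i : ℕ} (h1 : p ≤ i)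
    (h2 : i < p + 1 + cells.length) : letterVal (y i) = none := by
  rcases Nat.eq_or_lt_of_le h1 with rfl | h1
  · rw [hb.head]; rfl
  · obtain ⟨j, rfl⟩ : ∃ j, i = p + 1 + j := ⟨i - (p + 1), by omega⟩
    have hj : j < cells.length := by omega
    rw [hb.cell j _ (List.getElem?_eq_getElem hj)]
    exact hc _ (List.getElem_mem hj)

theorem BlockAt.lastHalted_eq {p : ℕ} {h : Header Q} {cells : List Cell}
    (hb : BlockAt y p h cells) : lastHalted M y (p + 1 + cells.length) = haltFlag M h := by
  have : ∀ j ≤ cells.length, lastHalted M y (p + 1 + j) = haltFlag M h := by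
    intro j
    induction j with
    | zero => intro _; rw [add_zero, lastHalted, hb.head]; rfl
    | succ j ih =>
      intro hj
      rw [← add_assoc, lastHalted, hb.cell j _ (List.getElem?_eq_getElem (by omega))]
      exact ih (by omega)
  exact this _ le_rfl

theorem val_initCells {s : List Bool} : ∀ c ∈ initCells s, c.val = none := by
  intro c hc
  obtain ⟨j, hj, rfl⟩ := List.getElem_of_mem hc
  rw [length_initCells] at hj
  rcases Nat.lt_or_ge j s.length with hlt | hge
  · have h1 := initCells_getElem?_of_lt hlt
    have h2 := List.getElem?_eq_getElem (l := initCells s) (i := j) (by simpa using hj)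
    rw [h2, Option.some.injEq] at h1
    rw [h1]
    split_ifs <;> rfl
  · obtain rfl : j = s.length := by omega
    have h1 := initCells_getElem?_length s
    have h2 := List.getElem?_eq_getElem (l := initCells s) (i := s.length) (by simp)
    rw [h2, Option.some.injEq] at h1
    rw [h1]
    rfl

theorem val_confCells {n : ℕ} {S : K' → List Γ'} : ∀ c ∈ confCells false n S, c.val = none := by
  intro c hc
  obtain ⟨j, -, rfl⟩ := List.mem_map.1 hc
  rfl

theorem IsProtocol.next_block (hy : IsProtocol M x y) {p : ℕ} {h : Header Q} {cells : List Cell}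
    (hb : BlockAt y p h cells) (hh : haltFlag M h = false) :
    BlockAt y (p + 1 + cells.length) (nextHead M h cells[0]?)
      ((List.range (cells.length + 1)).map fun j =>
        .col (haltFlag M (nextHead M h cells[0]?))
          (nextCol M h (prevCell cells j) cells[j]? cells[j + 1]?)) := by
  obtain ⟨g, hg⟩ := Sum.isLeft_iff.1 hb.last
  have hf : (stepComparison M).Follows y p (p + 1 + cells.length) h g := by
    refine ⟨hb.head, hh, by omega, hg, trivial, fun i g' h1 h2 hi => ?_⟩
    have := hb.isRight_of_lt h1 h2
    simp [hi] at this
  obtain ⟨cells', hb', hr⟩ := hy.step.exists_block hb hf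
  rw [stepComparison_rel_iff] at hr
  obtain ⟨rfl, rfl⟩ := hr
  exact hb'

theorem haltFlag_state {q : Q} : haltFlag M (.state q) = true ↔ M.halted q := by
  simp [haltFlag]

/-- The configuration after `t` steps of the computation on the word `s`. -/
def confAt (M : StackMachine Q K' Γ') (s : List Bool) (t : ℕ) : Q × (K' → List Γ') :=
  M.step^[t] (M.start, inputStacks s)

theorem confAt_succ (s : List Bool) (t : ℕ) : confAt M s (t + 1) = M.step (confAt M s t) :=
  Function.iterate_succ_apply' _ _ _

theorem length_confAt_le (s : List Bool) (t : ℕ) (k : K') :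
    ((confAt M s t).2 k).length ≤ s.length + 2 + t := by
  induction t generalizing k with
  | zero => exact length_inputStacks_le s k
  | succ t ih => rw [confAt_succ, ← add_assoc]; exact length_step_le M ih _ _

/-- The cells of the configuration after `t` steps. -/
noncomputable def runCells (M : StackMachine Q K' Γ') (s : List Bool) (t : ℕ) : List Cell :=
  confCells (haltFlag M (.state (confAt M s t).1)) (s.length + 2 + t) (confAt M s t).2

/-- As long as the machine has not halted, every block is forced by the step comparison. The blocks
before halting carry no flag, so none of their cells shows an entry. -/
theorem IsProtocol.run_block (hy : IsProtocol M x y) {p : ℕ} {s : List Bool}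
    (hb : BlockAt y p (initHead s) (initCells s)) (t : ℕ)
    (ht : ∀ t' < t, ¬ M.halted (confAt M s t').1) :
    ∃ q, p < q ∧ BlockAt y q (.state (confAt M s t).1) (runCells M s t) ∧
      (∀ i par, p < i → i ≤ q → y i ≠ .inl (.init par)) ∧
      ∀ i, p ≤ i → i < q → letterVal (y i) = none := by
  induction t with
  | zero =>
    have hb' := hy.next_block hb (by simp [haltFlag, initHead])
    have e := nextCells_init M (f := haltFlag M (.state (confAt M s 0).1)) s s.length.bodd
    refine ⟨_, by omega, ?_, fun i par h1 h2 hi => ?_,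
      fun i h1 h2 => hb.letterVal_eq_none val_initCells h1 h2⟩
    · rw [runCells, add_zero]
      exact e ▸ hb'
    · rcases Nat.eq_or_lt_of_le h2 with rfl | h2
      · have := hb'.head
        rw [hi] at this
        simp [nextHead, initHead] at this
      · have := hb.isRight_of_lt h1 h2
        simp [hi] at this
  | succ t ih =>
    obtain ⟨q, hpq, hbq, hinit, hval⟩ := ih fun t' h => ht t' (by omega)
    have hnh : haltFlag M (.state (confAt M s t).1) = false := by
      rw [← Bool.not_eq_true, haltFlag_state]
      exact ht t (by omega)
    have hb' := hy.next_block hbq hnh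
    have e1 := nextHead_conf M (f := haltFlag M (.state (confAt M s t).1))
      (length_confAt_le (M := M) s t) (confAt M s t).1
    have e2 := nextCells_conf M (f := haltFlag M (.state (confAt M s t).1))
      (f' := haltFlag M (.state (confAt M s (t + 1)).1))
      (length_confAt_le (M := M) s t) (confAt M s t).1
    rw [Prod.mk.eta, ← confAt_succ] at e1 e2
    rw [runCells, e1, e2] at hb'
    refine ⟨_, by omega, hb', fun i par h1 h2 hi => ?_, fun i h1 h2 => ?_⟩
    · rcases Nat.lt_or_ge q i with h3 | h3
      · rcases Nat.eq_or_lt_of_le h2 with rfl | h2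
        · have := hb'.head
          rw [hi] at this
          simp at this
        · have := hbq.isRight_of_lt h3 h2
          simp [hi] at this
      · exact hinit i par h1 h3 hi
    · rcases Nat.lt_or_ge i q with h3 | h3
      · exact hval i h1 h3
      · refine hbq.letterVal_eq_none ?_ h3 h2
        rw [runCells, hnh]
        exact val_confCells

theorem symBit_map (o : Option Bool) : symBit (o.map bitSym) = o := by
  rcases o with _ | _ | _ <;> rfl

/-- The halting configuration shows the output on the main stack, then one entry `true` coming from
the closing `bit1`, and blanks from `cons` on. The rule `restart` makes the following header an
input header, the first one after `p`, so that the input comparison applies to it. -/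
theorem IsProtocol.stage (hM : M.Computes F) (hy : IsProtocol M x y) {p : ℕ} {s : List Bool}
    (hb : BlockAt y p (initHead s) (initCells s)) :
    ∃ q p' b, p < q ∧ q + ((F s).length + 1) < p' ∧
      (∀ i, p ≤ i → i < q → letterVal (y i) = none) ∧
      (∀ i, i ≤ (F s).length → letterVal (y (q + i)) = (F s ++ [true])[i]?) ∧
      (∀ i, q + ((F s).length + 1) ≤ i → i < p' → letterVal (y i) = none) ∧
      (∀ i par, p < i → i < p' → y i ≠ .inl (.init par)) ∧
      BlockAt y p' (initHead (s ++ [b])) (initCells (s ++ [b])) := by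
  obtain ⟨t, hhalt, hbefore, hmain⟩ := hM s
  obtain ⟨q, hpq, hbq, hinit, hval⟩ := hy.run_block hb t hbefore
  have hlen := length_confAt_le (M := M) s t .main
  rw [show (confAt M s t).2 .main = _ from hmain] at hlen
  simp only [List.length_append, List.length_map, List.length_cons, List.length_nil] at hlen
  have hfl : haltFlag M (.state (confAt M s t).1) = true := haltFlag_state.2 hhalt
  have hrun : (runCells M s t).length = s.length + 2 + t := by simp [runCells]
  have hcell : ∀ j < s.length + 2 + t, letterVal (y (q + 1 + j)) =
      symBit ((F s).map bitSym ++ [Γ'.bit1, Γ'.cons])[j]? := by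
    intro j hj
    have := hbq.cell j (.col true fun k => ((confAt M s t).2 k)[j]?) (by
      rw [runCells, hfl, confCells_getElem? _ _ hj])
    rw [this, ← hmain]
    rfl
  obtain ⟨g, hg⟩ := Sum.isLeft_iff.1 hbq.last
  have hg' : ∃ par, g = .init par := by
    cases g with
    | init par => exact ⟨par, rfl⟩
    | state q' =>
      refine absurd hg (hy.restart _ _ ?_)
      rw [hbq.lastHalted_eq, hfl]
  rw [hrun] at hg
  have hnoinit : ∀ i par, p < i → i < q + 1 + (s.length + 2 + t) → y i ≠ .inl (.init par) := by
    intro i par h1 h2 hi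
    rcases Nat.lt_or_ge q i with h3 | h3
    · have := hbq.isRight_of_lt h3 (by rw [hrun]; exact h2)
      simp [hi] at this
    · exact hinit i par h1 h3 hi
  have hf : (initComparison Q).Follows y p (q + 1 + (s.length + 2 + t)) (initHead s) g := by
    refine ⟨hb.head, ⟨_, rfl⟩, by omega, hg, hg', fun i g' h1 h2 hi => ?_⟩
    rintro ⟨par, rfl⟩
    exact hnoinit i par h1 h2 hi
  obtain ⟨cells', hb', hr⟩ := hy.init.exists_block hb hf
  rw [initComparison_rel_iff] at hr
  obtain ⟨b, rfl, rfl⟩ := hr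
  -- The halting block starts at `q`, and its header is no entry.
  refine ⟨q + 1, _, b, by omega, by omega, fun i h1 h2 => ?_, fun i hi => ?_, fun i h1 h2 => ?_,
    hnoinit, hb'⟩
  · rcases Nat.lt_or_ge i q with h3 | h3
    · exact hval i h1 h3
    · obtain rfl : i = q := by omega
      rw [hbq.head]; rfl
  · rw [hcell i (by omega)]
    rcases Nat.lt_or_ge i (F s).length with h3 | h3
    · rw [List.getElem?_append_left (by simpa using h3), List.getElem?_append_left h3,
        List.getElem?_map, symBit_map]
    · obtain rfl : i = (F s).length := by omega
      simp [symBit]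
  · obtain ⟨j, rfl⟩ : ∃ j, i = q + 1 + j := ⟨i - (q + 1), by omega⟩
    rw [hcell j (by omega), List.getElem?_append_right (by simp; omega), List.length_map]
    obtain ⟨m, hm⟩ : ∃ m, j - (F s).length = m + 1 := ⟨j - (F s).length - 1, by omega⟩
    rw [hm]
    rcases m with _ | m <;> rfl

/-- The blocks that list the inputs start at the positions `P k`; they list the prefixes of the
infinite word `X`. -/
structure InitStages (y : ℕ → Header Q ⊕ Cell) (X : ℕ → Bool) (P : ℕ → ℕ) : Prop where
  zero : P 0 = 0
  lt : ∀ k, P k < P (k + 1)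
  block : ∀ k, BlockAt y (P k) (initHead (prefixWord X k)) (initCells (prefixWord X k))
  first : ∀ k i par, P k < i → i < P (k + 1) → y i ≠ .inl (.init par)

/-- The results of the computations start at the positions `T k`. -/
structure TableStages (F : List Bool → List Bool) (y : ℕ → Header Q ⊕ Cell) (X : ℕ → Bool)
    (P T : ℕ → ℕ) : Prop extends InitStages y X P where
  lt_table : ∀ k, P k < T k
  table_lt : ∀ k, T k + ((F (prefixWord X k)).length + 1) < P (k + 1)
  before : ∀ k i, P k ≤ i → i < T k → letterVal (y i) = none
  entry : ∀ k i, i ≤ (F (prefixWord X k)).length →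
    letterVal (y (T k + i)) = (F (prefixWord X k) ++ [true])[i]?
  after : ∀ k i, T k + ((F (prefixWord X k)).length + 1) ≤ i → i < P (k + 1) →
    letterVal (y i) = none

theorem IsProtocol.exists_stages (hM : M.Computes F) (hy : IsProtocol M x y) :
    ∃ X P T, TableStages F y X P T := by
  choose! q p' b h1 h2 h3 h4 h5 h6 h7 using
    fun (c : ℕ × List Bool) (hb : BlockAt y c.1 (initHead c.2) (initCells c.2)) => hy.stage hM hb
  let st : ℕ → ℕ × List Bool := fun k => Nat.rec (0, []) (fun _ c => (p' c, c.2 ++ [b c])) k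
  have hst : ∀ k, st (k + 1) = (p' (st k), (st k).2 ++ [b (st k)]) := fun _ => rfl
  have hb : ∀ k, BlockAt y (st k).1 (initHead (st k).2) (initCells (st k).2) := by
    intro k
    induction k with
    | zero =>
      refine ⟨hy.zero.trans (by simp [st, initHead]), fun j c hc => ?_, hy.two⟩
      rcases j with _ | j
      · obtain rfl : Cell.last = c := by simpa [st, initCells] using hc
        exact hy.one
      · simp [st, initCells] at hc
    | succ k ih => exact h7 _ ih
  have hpre : ∀ k, (st k).2 = prefixWord (fun k => b (st k)) k := by
    intro k
    induction k with
    | zero => rfl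
    | succ k ih => rw [prefixWord_succ, hst, ih]
  refine ⟨fun k => b (st k), fun k => (st k).1, fun k => q (st k), ⟨rfl, fun k => ?_, fun k => ?_,
    fun k i par hi hi' => h6 (st k) (hb k) i par hi hi'⟩, fun k => h1 _ (hb k), fun k => ?_,
    fun k i hi hi' => h3 _ (hb k) i hi hi', fun k i hi => ?_, fun k i hi hi' => ?_⟩
  · have := h1 _ (hb k)
    have := h2 _ (hb k)
    rw [hst]
    omega
  · rw [← hpre]; exact hb k
  · rw [← hpre]; exact h2 _ (hb k)
  · rw [← hpre] at hi ⊢; exact h4 _ (hb k) i hi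
  · rw [← hpre] at hi; exact h5 _ (hb k) i hi hi'

/-- Bit `k` is first shown in the last cell but one of input block `k + 1`. Its flag is `true`
exactly for even `k`, that is for the letters of Player 1, to which the rule `copy` applies. -/
theorem InitStages.new_eq {X : ℕ → Bool} {P : ℕ → ℕ} (h : InitStages y X P) (k : ℕ) :
    y (P (k + 1) + 1 + k) = .inr (.new (k + 1).bodd (X k)) := by
  refine (h.block (k + 1)).cell k _ ?_
  rw [initCells_getElem?_of_lt (by simp), if_pos (by simp)]
  simp [prefixWord]

/-- The stages are determined by the infinite word. -/
theorem InitStages.unique {y' : ℕ → Header Q ⊕ Cell} {X X' : ℕ → Bool} {P P' : ℕ → ℕ}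
    (h : InitStages y X P) (h' : InitStages y' X' P') {N : ℕ} (hN : ∀ i < N, y i = y' i) (k : ℕ)
    (hk : P k + k < N) : P' k = P k ∧ ∀ i < k, X' i = X i := by
  induction k with
  | zero => exact ⟨by rw [h.zero, h'.zero], by simp⟩
  | succ k ih =>
    have hlt := h.lt k
    have hlt' := h'.lt k
    obtain ⟨ih1, ih2⟩ := ih (by omega)
    have hP : P' (k + 1) = P (k + 1) := by
      have hle : P' (k + 1) ≤ P (k + 1) := by
        by_contra! hcon
        have := (h.block (k + 1)).head
        rw [hN _ (by omega)] at this
        exact h'.first k _ _ (by omega) hcon this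
      refine le_antisymm hle ?_
      by_contra! hcon
      have := (h'.block (k + 1)).head
      rw [← hN _ (by omega)] at this
      exact h.first k _ _ (by omega) hcon this
    refine ⟨hP, fun i hi => ?_⟩
    rcases Nat.lt_or_ge i k with h1 | h1
    · exact ih2 i h1
    · obtain rfl : i = k := by omega
      have h2 := h.new_eq i
      have h3 := h'.new_eq i
      rw [hP, ← hN _ (by omega), h2] at h3
      simpa using h3.symm

end

end

/-! ### The winning condition as an automaton, and the tables of values. -/

section

open Filter Turing.PartrecToTM2

/-! ### The automaton that checks the protocol and follows a branch -/

section

variable {Q : Type} (M : StackMachine Q K' Γ')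

/-- The states of the local check: the position, up to `3`, and whether the last block is a halting
configuration. -/
noncomputable def checkNext (d : Fin 4 × Bool) (l _l' : (Header Q ⊕ Cell) × (Header Q ⊕ Cell)) :
    Fin 4 × Bool :=
  (⟨min (d.1 + 1) 3, by omega⟩, l.2.elim (haltFlag M) fun _ => d.2)

/-- The local violations of the protocol. -/
def CheckBad (d : Fin 4 × Bool) (l l' : (Header Q ⊕ Cell) × (Header Q ⊕ Cell)) : Prop :=
  l.2 ≠ l'.2 ∨ (d.1 = 0 ∧ l.2 ≠ .inl (.init false)) ∨ (d.1 = 1 ∧ l.2 ≠ .inr .last) ∨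
    (d.1 = 2 ∧ ¬ l.2.isLeft) ∨ (d.2 ∧ ∃ q, l.2 = .inl (.state q)) ∨
    ∃ b, l.2 = .inr (.new true b) ∧ l.1.isLeft ≠ b

/-- The automaton that accepts if the protocol is violated or a branch with infinitely many
positive entries exists. -/
noncomputable def gameAutomaton :=
  (localAutomaton (checkNext M) CheckBad (0, false)).union
    ((((stepComparison M).automaton Prod.snd).union ((initComparison Q).automaton Prod.snd)).union
      (branchAutomaton (L := (Header Q ⊕ Cell) × (Header Q ⊕ Cell)) (letterVal ∘ Prod.snd)))

variable {M} {z₁ z₂ : ℕ → (Header Q ⊕ Cell) × (Header Q ⊕ Cell)}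

theorem localState_check (i : ℕ) :
    (localState (checkNext M) (0, false) z₁ z₂ i).1.val = min i 3 ∧
      (localState (checkNext M) (0, false) z₁ z₂ i).2 = lastHalted M (Prod.snd ∘ z₁) i := by
  induction i with
  | zero => exact ⟨rfl, rfl⟩
  | succ i ih =>
    rw [localState, lastHalted, checkNext]
    refine ⟨?_, ?_⟩
    · simp only [ih.1]; omega
    · simp [ih.2]

/-- The implication is the union of its negated premises and its conclusion. The local automaton
finds differing tapes and violations of the pointwise rules, and the two comparison automata cover
the remaining rules. -/
theorem gameAutomaton_accepts_iff : (gameAutomaton M).Accepts z₁ z₂ ↔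
    (Prod.snd ∘ z₁ = Prod.snd ∘ z₂ →
      IsProtocol M (fun i => (z₁ i).1.isLeft) (Prod.snd ∘ z₁) →
      (branchAutomaton (letterVal ∘ Prod.snd)).Accepts z₁ z₂) := by
  rw [gameAutomaton, HeadAutomaton.union_accepts, HeadAutomaton.union_accepts,
    HeadAutomaton.union_accepts, localAutomaton_accepts]
  constructor
  · intro h he hp
    have e2 : Prod.snd ∘ z₂ = Prod.snd ∘ z₁ := he.symm
    rcases h with ⟨i, hi⟩ | (h | h) | h
    · exfalso
      obtain ⟨l1, l2⟩ := localState_check (M := M) (z₁ := z₁) (z₂ := z₂) i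
      rcases hi with hi | ⟨h1, hi⟩ | ⟨h1, hi⟩ | ⟨h1, hi⟩ | ⟨h1, q, hi⟩ | ⟨b, hb, hi⟩
      · exact hi (congrFun he i)
      · obtain rfl : i = 0 := by rw [h1, Fin.val_zero] at l1; omega
        exact hi hp.zero
      · obtain rfl : i = 1 := by rw [h1, Fin.val_one] at l1; omega
        exact hi hp.one
      · obtain rfl : i = 2 := by rw [h1, Fin.val_two] at l1; omega
        exact hi hp.two
      · exact hp.restart i q (l2 ▸ h1) hi
      · exact hi (hp.copy i b hb)
    · exact absurd hp.step (((stepComparison M).automaton_accepts _ rfl e2).1 h)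
    · exact absurd hp.init (((initComparison Q).automaton_accepts _ rfl e2).1 h)
    · exact h
  · intro h
    by_contra! hcon
    obtain ⟨hl, ⟨hs, hi⟩, hb⟩ := hcon
    simp only [CheckBad, not_or, not_and, not_exists, not_not] at hl
    have he : Prod.snd ∘ z₁ = Prod.snd ∘ z₂ := funext fun i => (hl i).1
    have e2 : Prod.snd ∘ z₂ = Prod.snd ∘ z₁ := he.symm
    rw [Comparison.automaton_accepts _ _ rfl e2, not_not] at hs hi
    refine hb (h he ⟨(hl 0).2.1 ?_, (hl 1).2.2.1 ?_, (hl 2).2.2.2.1 ?_, fun i q h1 => ?_,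
      fun i b => (hl i).2.2.2.2.2 b, hs, hi⟩)
    · exact Fin.ext (localState_check 0).1
    · exact Fin.ext (localState_check 1).1
    · exact Fin.ext (localState_check 2).1
    · exact (hl i).2.2.2.2.1 ((localState_check i).2 ▸ h1) q

end

/-! ### Tables -/

/-- The infinite words `x` such that, for some infinite binary word `τ`, infinitely many pairs of
prefixes of `τ` and `x` have the property `B`. -/
def branchSet {X : Type*} (B : List Bool → List X → Bool) : Set (ℕ → X) :=
  {x | ∃ τ : ℕ → Bool, ∃ᶠ k in atTop, B (prefixWord τ k) (prefixWord x k) = true}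

/-- The binary words of length `k` in the order of the entries of the `k`-th table. -/
def tableOrder : ℕ → List (List Bool)
  | 0 => [[]]
  | k + 1 => (tableOrder k).reverse.flatMap fun t => [t ++ [false], t ++ [true]]

/-- The table of the values of `B` for the word `s`. -/
def table (B : List Bool → List Bool → Bool) (s : List Bool) : List Bool :=
  true :: true :: (tableOrder s.length).map fun t => B t s

theorem length_tableOrder (k : ℕ) : (tableOrder k).length = 2 ^ k := by
  induction k with
  | zero => rfl
  | succ k ih =>
    simp [tableOrder, List.length_flatMap, ih, pow_succ]

theorem getElem?_flatMap_pair {α β : Type*} (f : Bool → α → β) (l : List α) (i : ℕ) (b : Bool) :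
    (l.flatMap fun t => [f false t, f true t])[2 * i + b.toNat]? = l[i]?.map (f b) := by
  induction l generalizing i with
  | nil => simp
  | cons a l ih =>
    cases i with
    | zero => cases b <;> simp
    | succ i =>
      rw [List.flatMap_cons, List.getElem?_append_right (by simp; omega), List.getElem?_cons_succ,
        ← ih]
      congr 1
      simp; omega

/-- Counting the entries behind the current one reverses the order; the reversal in `tableOrder`
compensates for it. The offset `2` skips the fillers. -/
theorem tableOrder_branchIdx (τ : ℕ → Bool) (k : ℕ) :
    (tableOrder k)[branchIdx τ k - 2]? = some (prefixWord τ k) := by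
  induction k with
  | zero => rfl
  | succ k ih =>
    have := branchIdx_bounds τ k
    rw [tableOrder, branchIdx, show 2 * (2 ^ k + 2 - branchIdx τ k) + (τ k).toNat - 2 =
      2 * (2 ^ k + 1 - branchIdx τ k) + (τ k).toNat by omega,
      getElem?_flatMap_pair (fun b t => t ++ [b]), List.getElem?_reverse, length_tableOrder,
      show 2 ^ k - 1 - (2 ^ k + 1 - branchIdx τ k) = branchIdx τ k - 2 by omega, ih,
      prefixWord_succ]
    · rfl
    · rw [length_tableOrder]; omega

/-- With the entry `true` that follows every output, this gives the `2 ^ k + 3` entries expected by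
`IsTableSequence`. -/
theorem length_table (B : List Bool → List Bool → Bool) (s : List Bool) :
    (table B s).length = 2 ^ s.length + 2 := by
  simp [table, length_tableOrder]

theorem table_branchIdx (B : List Bool → List Bool → Bool) (τ x : ℕ → Bool) (k : ℕ) :
    (table B (prefixWord x k) ++ [true])[branchIdx τ k]? =
      some (B (prefixWord τ k) (prefixWord x k)) := by
  have := branchIdx_bounds τ k
  rw [List.getElem?_append_left (by rw [length_table, length_prefixWord]; omega), table,
    length_prefixWord]
  obtain ⟨m, hm⟩ : ∃ m, branchIdx τ k = m + 2 := ⟨branchIdx τ k - 2, by omega⟩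
  have h := tableOrder_branchIdx τ k
  rw [hm, Nat.add_sub_cancel] at h
  rw [hm, List.getElem?_cons_succ, List.getElem?_cons_succ, List.getElem?_map, h]
  rfl

theorem primrec_tableOrder : Primrec tableOrder := by
  have : Primrec fun l : List (List Bool) =>
      l.reverse.flatMap fun t => [t ++ [false], t ++ [true]] := by
    refine Primrec.list_flatMap Primrec.list_reverse ?_
    refine Primrec.list_cons.comp (Primrec.list_append.comp Primrec.snd (Primrec.const _))
      (Primrec.list_cons.comp (Primrec.list_append.comp Primrec.snd (Primrec.const _))
        (Primrec.const _))
  refine (Primrec.nat_rec₁ [[]] (this.comp Primrec.snd).to₂).of_eq fun n => ?_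
  induction n with
  | zero => rfl
  | succ n ih => simp only [tableOrder, ← ih]

theorem Computable.list_map_of_computable {α β σ : Type*} [Primcodable α] [Primcodable β]
    [Primcodable σ]   {f : α → List β} {g : α → β → σ} (hf : Computable f) (hg : Computable₂ g) :
    Computable fun a => (f a).map (g a) := by
  have h : Computable fun a => Nat.rec (motive := fun _ => List σ) []
      (fun n r => Option.casesOn ((f a)[n]?) r fun b => r ++ [g a b]) (f a).length := by
    refine Computable.nat_rec (h := fun a (p : ℕ × List σ) =>
      Option.casesOn ((f a)[p.1]?) p.2 fun b => p.2 ++ [g a b]) (Computable.list_length.comp hf)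
      (Computable.const ([] : List σ)) ?_
    have h1 : Computable fun p : α × ℕ × List σ => (f p.1)[p.2.1]? :=
      Computable.list_getElem?.comp (hf.comp Computable.fst) (Computable.fst.comp Computable.snd)
    have h2 : Computable fun p : α × ℕ × List σ => p.2.2 := Computable.snd.comp Computable.snd
    exact Computable.option_casesOn h1 h2 (Computable.list_append.comp
      (Computable.snd.comp (Computable.snd.comp Computable.fst))
      (Computable.list_cons.comp (hg.comp (Computable.fst.comp Computable.fst) Computable.snd)
        (Computable.const ([] : List σ)))).to₂
  refine h.of_eq fun a => ?_
  have : ∀ n ≤ (f a).length, Nat.rec (motive := fun _ => List σ) []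
      (fun n r => Option.casesOn ((f a)[n]?) r fun b => r ++ [g a b]) n =
        ((f a).take n).map (g a) := by
    intro n
    induction n with
    | zero => intro _; rfl
    | succ n ih =>
      intro hn
      simp only [ih (by omega), List.getElem?_eq_getElem (show n < (f a).length by omega),
        ← List.take_append_getElem (show n < (f a).length by omega), List.map_append]
      rfl
  rw [this _ le_rfl, List.take_length]

theorem computable_table {B : List Bool → List Bool → Bool} (hB : Computable₂ B) :
    Computable (table B) := by
  refine Computable.list_cons.comp (Computable.const _)
    (Computable.list_cons.comp (Computable.const _) (Computable.list_map_of_computable ?_ ?_))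
  · exact primrec_tableOrder.to_comp.comp Computable.list_length
  · exact (hB.comp Computable.snd Computable.fst).to₂

section

variable {Q : Type} {B : List Bool → List Bool → Bool} {y : ℕ → Header Q ⊕ Cell} {X : ℕ → Bool}
  {P T : ℕ → ℕ}

theorem TableStages.isTableSequence (h : TableStages (table B) y X P T) :
    IsTableSequence (fun i => letterVal (y i)) T := by
  have hl : ∀ k, (table B (prefixWord X k)).length + 1 = 2 ^ k + 3 := fun k => by
    rw [length_table, length_prefixWord]
  refine ⟨fun i hi => h.before 0 i (by rw [h.zero]; omega) hi, fun k i hi => ?_, fun k => ?_,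
    fun k i h1 h2 => ?_⟩
  · have := hl k
    show (letterVal (y (T k + i))).isSome
    rw [h.entry k i (by omega), List.getElem?_eq_getElem (by simp; omega)]
    rfl
  · have := h.table_lt k
    rw [hl] at this
    exact this.trans (h.lt_table _)
  · rcases Nat.lt_or_ge i (P (k + 1)) with h3 | h3
    · exact h.after k i (by rw [hl]; exact h1) h3
    · exact h.before (k + 1) i h3 h2

theorem TableStages.branch_iff (h : TableStages (table B) y X P T) {L : Type}
    {val : L → Option Bool} {z₁ z₂ : ℕ → L} (h₁ : val ∘ z₁ = fun i => letterVal (y i))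
    (h₂ : val ∘ z₂ = fun i => letterVal (y i)) :
    (branchAutomaton val).Accepts z₁ z₂ ↔ X ∈ branchSet B := by
  have he : ∀ τ k, letterVal (y (T k + branchIdx τ k)) = some true ↔
      B (prefixWord τ k) (prefixWord X k) = true := by
    intro τ k
    have := branchIdx_bounds τ k
    rw [h.entry k _ (by rw [length_table, length_prefixWord]; omega), table_branchIdx]
    simp
  constructor
  · intro ha
    obtain ⟨τ, hτ⟩ := exists_branch_of_accepts h₁ h₂ h.isTableSequence ha
    exact ⟨τ, hτ.mono fun k hk => (he τ k).1 hk⟩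
  · rintro ⟨τ, hτ⟩
    exact accepts_of_branch h₁ h₂ h.isTableSequence (hτ.mono fun k hk => (he τ k).2 hk)

end

end

/-! ### Correct records for given inputs. -/

section

open Turing.PartrecToTM2

/-! ### Concatenation of blocks -/

section Concat

variable {H C : Type} (bl : ℕ → H × List C)

/-- The position of the `i`-th block. -/
def blockStart : ℕ → ℕ
  | 0 => 0
  | i + 1 => blockStart i + 1 + (bl i).2.length

/-- The number of the block at position `p`. -/
def blockNumber (p : ℕ) : ℕ := Nat.findGreatest (fun i => blockStart bl i ≤ p) p

/-- The infinite concatenation of the blocks. -/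
def blockWord (p : ℕ) : H ⊕ C :=
  (Sum.inl (bl (blockNumber bl p)).1 :: (bl (blockNumber bl p)).2.map Sum.inr).getD
    (p - blockStart bl (blockNumber bl p)) (Sum.inl (bl (blockNumber bl p)).1)

theorem strictMono_blockStart : StrictMono (blockStart bl) :=
  strictMono_nat_of_lt_succ fun i => by rw [blockStart]; omega

variable {bl}

/-- Every block has a header, so `i ≤ blockStart bl i`, and the search bound `p` in `blockNumber`
excludes nothing. -/
theorem blockNumber_eq {i p : ℕ} (h1 : blockStart bl i ≤ p) (h2 : p < blockStart bl (i + 1)) :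
    blockNumber bl p = i := by
  have hm := strictMono_blockStart bl
  rw [blockNumber, Nat.findGreatest_eq_iff]
  refine ⟨(hm.id_le i).trans h1, fun _ => h1, fun n hn _ hle => ?_⟩
  have : blockStart bl (i + 1) ≤ blockStart bl n := hm.monotone hn
  omega

theorem blockNumber_spec (p : ℕ) : blockStart bl (blockNumber bl p) ≤ p ∧
    p < blockStart bl (blockNumber bl p + 1) := by
  have hm := strictMono_blockStart bl
  refine ⟨Nat.findGreatest_spec (P := fun i => blockStart bl i ≤ p) (Nat.zero_le p)
    (Nat.zero_le _), ?_⟩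
  by_contra! hcon
  have h1 : blockNumber bl p + 1 ≤ p := (hm.id_le _).trans hcon
  have := Nat.le_findGreatest (P := fun i => blockStart bl i ≤ p) h1 hcon
  rw [blockNumber] at this
  omega

theorem blockWord_eq {i p : ℕ} (h1 : blockStart bl i ≤ p) (h2 : p < blockStart bl (i + 1)) :
    blockWord bl p =
      (Sum.inl (bl i).1 :: (bl i).2.map Sum.inr).getD (p - blockStart bl i) (Sum.inl (bl i).1) := by
  rw [blockWord, blockNumber_eq h1 h2]

theorem blockWord_start (i : ℕ) : blockWord bl (blockStart bl i) = .inl (bl i).1 := by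
  rw [blockWord_eq le_rfl (strictMono_blockStart bl (Nat.lt_succ_self i))]
  simp

theorem blockAt_blockWord (i : ℕ) :
    BlockAt (blockWord bl) (blockStart bl i) (bl i).1 (bl i).2 := by
  refine ⟨blockWord_start i, fun j c hc => ?_, ?_⟩
  · have hj : j < (bl i).2.length := (List.getElem?_eq_some_iff.1 hc).1
    rw [blockWord_eq (i := i) (by omega) (by rw [blockStart]; omega),
      show blockStart bl i + 1 + j - blockStart bl i = j + 1 by omega]
    simp [hc]
  · have := blockWord_start (bl := bl) (i + 1)
    rw [blockStart] at this
    rw [this]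
    rfl

theorem exists_eq_blockStart {p : ℕ} {h : H} (hp : blockWord bl p = .inl h) :
    ∃ i, p = blockStart bl i ∧ h = (bl i).1 := by
  obtain ⟨h1, h2⟩ := blockNumber_spec (bl := bl) p
  set i := blockNumber bl p
  rcases Nat.eq_or_lt_of_le h1 with h3 | h3
  · refine ⟨i, h3.symm, ?_⟩
    rw [← h3, blockWord_start] at hp
    exact (Sum.inl.inj hp).symm
  · have := (blockAt_blockWord (bl := bl) i).isRight_of_lt h3 h2
    simp [hp] at this

theorem blockStart_congr {bl' : ℕ → H × List C} {n : ℕ} (h : ∀ i < n, bl i = bl' i) :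
    blockStart bl n = blockStart bl' n := by
  induction n with
  | zero => rfl
  | succ n ih => rw [blockStart, blockStart, ih fun i hi => h i (by omega), h n (by omega)]

theorem blockWord_congr {bl' : ℕ → H × List C} {n p : ℕ} (h : ∀ i < n, bl i = bl' i)
    (hp : p < blockStart bl n) : blockWord bl p = blockWord bl' p := by
  obtain ⟨h1, h2⟩ := blockNumber_spec (bl := bl) p
  set i := blockNumber bl p
  have hi : i < n := (strictMono_blockStart bl).lt_iff_lt.1 (h1.trans_lt hp)
  have e1 : blockStart bl i = blockStart bl' i := blockStart_congr fun j hj => h j (by omega)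
  have e2 : blockStart bl (i + 1) = blockStart bl' (i + 1) :=
    blockStart_congr fun j hj => h j (by omega)
  rw [blockWord_eq h1 h2, blockWord_eq (e1 ▸ h1) (e2 ▸ h2), h i hi, e1]

end Concat

theorem BlockAt.cells_unique {H C : Type} {y : ℕ → H ⊕ C} {p : ℕ} {h h' : H} {cells cells' : List C}
    (hb : BlockAt y p h cells) (hb' : BlockAt y p h' cells') : cells = cells' := by
  have hle : ∀ {h h'} {l l' : List C}, BlockAt y p h l → BlockAt y p h' l' →
      l.length ≤ l'.length := by
    intro h h' l l' hl hl'
    exact (hl'.forall_isRight_iff _).1 ((hl.forall_isRight_iff _).2 le_rfl)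
  refine List.ext_getElem (le_antisymm (hle hb hb') (hle hb' hb)) fun j h1 h2 => ?_
  have e1 := hb.cell j _ (List.getElem?_eq_getElem h1)
  rw [hb'.cell j _ (List.getElem?_eq_getElem h2)] at e1
  exact (Sum.inr.inj e1).symm

/-! ### The infinite word that follows the protocol -/

section Honest

variable {Q : Type} (M : StackMachine Q K' Γ') (x : ℕ → Bool)

open Classical in
/-- The stage, and the time of the computation, of the `i`-th block. -/
noncomputable def blockTime : ℕ → ℕ × Option ℕ
  | 0 => (0, none)
  | i + 1 => match blockTime i with
    | (k, none) => (k, some 0)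
    | (k, some t) =>
      if M.halted (confAt M (prefixWord x k) t).1 then (k + 1, none) else (k, some (t + 1))

/-- The block of the given stage and time. -/
noncomputable def timeBlock : ℕ × Option ℕ → Header Q × List Cell
  | (k, none) => (initHead (prefixWord x k), initCells (prefixWord x k))
  | (k, some t) => (.state (confAt M (prefixWord x k) t).1, runCells M (prefixWord x k) t)

/-- The blocks of the protocol for the inputs `x`. -/
noncomputable def honestBlock (i : ℕ) : Header Q × List Cell := timeBlock M x (blockTime M x i)

/-- The protocol for the inputs `x`. -/
noncomputable def honestWord : ℕ → Header Q ⊕ Cell := blockWord (honestBlock M x)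

variable {M x}

theorem blockTime_succ_of_none {i k : ℕ} (h : blockTime M x i = (k, none)) :
    blockTime M x (i + 1) = (k, some 0) := by
  rw [blockTime, h]

theorem blockTime_succ_of_halted {i k t : ℕ} (h : blockTime M x i = (k, some t))
    (ht : M.halted (confAt M (prefixWord x k) t).1) :
    blockTime M x (i + 1) = (k + 1, none) := by
  simp only [blockTime, h]; rw [if_pos ht]

theorem blockTime_succ_of_not_halted {i k t : ℕ} (h : blockTime M x i = (k, some t))
    (ht : ¬ M.halted (confAt M (prefixWord x k) t).1) :
    blockTime M x (i + 1) = (k, some (t + 1)) := by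
  simp only [blockTime, h]; rw [if_neg ht]

theorem blockTime_succ_cases (i : ℕ) :
    ((blockTime M x (i + 1)).1 = (blockTime M x i).1 ∧ (blockTime M x (i + 1)).2 ≠ none) ∨
      ((blockTime M x (i + 1)) = ((blockTime M x i).1 + 1, none) ∧ (blockTime M x i).2 ≠ none) := by
  rcases h : blockTime M x i with ⟨k, _ | t⟩
  · simp [blockTime_succ_of_none h]
  · by_cases ht : M.halted (confAt M (prefixWord x k) t).1
    · simp [blockTime_succ_of_halted h ht]
    · simp [blockTime_succ_of_not_halted h ht]

theorem monotone_blockTime : Monotone fun i => (blockTime M x i).1 := by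
  refine monotone_nat_of_le_succ fun i => ?_
  rcases blockTime_succ_cases (M := M) (x := x) i with h | h
  · exact h.1.ge
  · rw [h.1]; simp

/-- The input block is the first of its stage, so everything before it belongs to earlier stages and
knows only their bits. -/
theorem blockTime_lt {i j k : ℕ} (hj : blockTime M x j = (k, none)) (hij : i < j) :
    (blockTime M x i).1 < k := by
  obtain ⟨j, rfl⟩ : ∃ j', j = j' + 1 := ⟨j - 1, by omega⟩
  have := monotone_blockTime (M := M) (x := x) (show i ≤ j by omega)
  simp only at this
  rcases blockTime_succ_cases (M := M) (x := x) j with h | h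
  · simp [hj] at h
  · rw [hj, Prod.mk.injEq] at h
    omega

theorem init_timeBlock_iff {c : ℕ × Option ℕ} :
    (∃ par, (timeBlock M x c).1 = .init par) ↔ c.2 = none := by
  rcases c with ⟨k, _ | t⟩ <;> simp [timeBlock, initHead]

theorem blockTime_of_follows {j j' k : ℕ} (hj : blockTime M x j = (k, none)) (hlt : j < j')
    (hj' : (blockTime M x j').2 = none)
    (hb : ∀ i, j < i → i < j' → (blockTime M x i).2 ≠ none) :
    blockTime M x j' = (k + 1, none) := by
  have : ∀ i, j ≤ i → i < j' → (blockTime M x i).1 = k := by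
    intro i hi
    induction i, hi using Nat.le_induction with
    | base => simp [hj]
    | succ i hi ih =>
      intro h
      rcases blockTime_succ_cases (M := M) (x := x) i with h' | h'
      · rw [h'.1, ih (by omega)]
      · exact absurd (by rw [h'.1]) (hb (i + 1) (by omega) h)
  obtain ⟨i, rfl⟩ : ∃ i, j' = i + 1 := ⟨j' - 1, by omega⟩
  rcases blockTime_succ_cases (M := M) (x := x) i with h' | h'
  · exact absurd hj' h'.2
  · rw [h'.1, this i (by omega) (by omega)]

/-- All rules but `copy` concern the record alone and hold by construction. The bits `x'` written by
Player 1 matter only in the rounds in which one of them is copied. -/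
theorem honestWord_isProtocol {x' : ℕ → Bool}
    (hcopy : ∀ i b, honestWord M x i = .inr (.new true b) → x' i = b) :
    IsProtocol M x' (honestWord M x) := by
  have hbl : ∀ i, BlockAt (honestWord M x) (blockStart (honestBlock M x) i)
    (timeBlock M x (blockTime M x i)).1 (timeBlock M x (blockTime M x i)).2 := blockAt_blockWord
  have hm := strictMono_blockStart (honestBlock M x)
  have h0 : BlockAt (honestWord M x) 0 (.init false) [.last] := by
    simpa [blockTime, timeBlock, initHead, initCells, prefixWord, blockStart] using hbl 0
  refine ⟨h0.head, h0.cell 0 _ rfl, h0.last, fun i q hl hi => ?_, hcopy,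
    Comparison.holds_of_rel fun p p' h g hf => ?_, Comparison.holds_of_rel fun p p' h g hf => ?_⟩
  · obtain ⟨j, rfl, hj⟩ := exists_eq_blockStart hi
    cases j with
    | zero => simp [blockStart, lastHalted] at hl
    | succ j =>
      have e := (hbl j).lastHalted_eq (M := M)
      rw [blockStart] at hl
      change lastHalted M (honestWord M x) _ = true at hl
      rw [show (honestBlock M x j).2 = (timeBlock M x (blockTime M x j)).2 from rfl, e] at hl
      rw [honestBlock] at hj
      rcases hbt : blockTime M x j with ⟨k, _ | t⟩
      · rw [hbt] at hl; simp [timeBlock, haltFlag, initHead] at hl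
      · rw [hbt, timeBlock, haltFlag_state] at hl
        rw [blockTime_succ_of_halted hbt hl] at hj
        simp [timeBlock, initHead] at hj
  · obtain ⟨j, rfl, rfl⟩ := exists_eq_blockStart hf.head
    obtain ⟨j', rfl, rfl⟩ := exists_eq_blockStart hf.head'
    have hjj : j < j' := hm.lt_iff_lt.1 hf.lt
    obtain rfl : j' = j + 1 := by
      by_contra hne
      exact hf.between _ _ (hm (Nat.lt_succ_self j)) (hm (by omega)) (blockWord_start (j + 1))
        trivial
    refine ⟨_, _, hbl j, hbl (j + 1), ?_⟩
    have hsrc := hf.src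
    simp only [honestBlock] at hsrc ⊢
    rw [stepComparison_rel_iff]
    change haltFlag M _ = false at hsrc
    rcases hbt : blockTime M x j with ⟨k, _ | t⟩
    · rw [blockTime_succ_of_none hbt]
      refine ⟨rfl, ?_⟩
      have e := nextCells_init M (f := haltFlag M (.state (confAt M (prefixWord x k) 0).1))
        (prefixWord x k) (prefixWord x k).length.bodd
      exact e.symm
    · rw [hbt, timeBlock] at hsrc
      have hnh : ¬ M.halted (confAt M (prefixWord x k) t).1 := by
        rw [← haltFlag_state, hsrc]; simp
      rw [blockTime_succ_of_not_halted hbt hnh]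
      have e1 := nextHead_conf M
        (f := haltFlag M (.state (confAt M (prefixWord x k) t).1))
        (length_confAt_le (M := M) (prefixWord x k) t) (confAt M (prefixWord x k) t).1
      have e2 := nextCells_conf M (f := haltFlag M (.state (confAt M (prefixWord x k) t).1))
        (f' := haltFlag M (.state (confAt M (prefixWord x k) (t + 1)).1))
        (length_confAt_le (M := M) (prefixWord x k) t) (confAt M (prefixWord x k) t).1
      rw [Prod.mk.eta, ← confAt_succ] at e1 e2
      exact ⟨e1.symm, e2.symm⟩
  · obtain ⟨j, rfl, rfl⟩ := exists_eq_blockStart hf.head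
    obtain ⟨j', rfl, rfl⟩ := exists_eq_blockStart hf.head'
    have hjj : j < j' := hm.lt_iff_lt.1 hf.lt
    refine ⟨_, _, hbl j, hbl j', ?_⟩
    have h1 := init_timeBlock_iff.1 hf.src
    obtain ⟨k, hk⟩ : ∃ k, blockTime M x j = (k, none) := ⟨_, Prod.ext rfl h1⟩
    have hk' := blockTime_of_follows hk hjj (init_timeBlock_iff.1 hf.tgt) fun i h2 h3 h4 =>
      hf.between _ _ (hm h2) (hm h3) (blockWord_start i) (init_timeBlock_iff.2 h4)
    rw [honestBlock, honestBlock, hk, hk', timeBlock, timeBlock, prefixWord_succ]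
    exact initComparison_rel_iff.2 ⟨_, rfl, rfl⟩

theorem eq_of_initCells_eq {s s' : List Bool} (h : initCells s = initCells s') : s = s' := by
  have hl : s.length = s'.length := by
    have := congrArg List.length h
    simpa using this
  refine List.ext_getElem hl fun j h1 h2 => ?_
  have e1 := bit?_initCells h1 (List.getElem?_eq_getElem (by simp; omega))
  have e2 := bit?_initCells h2 (List.getElem?_eq_getElem (by simp; omega))
  simp only [h] at e1
  rw [e1] at e2
  exact Option.some.inj e2

/-- The stages of the protocol for the inputs `x`. -/
theorem InitStages.of_honestWord {X : ℕ → Bool} {P : ℕ → ℕ}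
    (h : InitStages (honestWord M x) X P) :
    X = x ∧ ∀ k, ∃ j, P k = blockStart (honestBlock M x) j ∧ blockTime M x j = (k, none) := by
  have hkey : ∀ k, ∃ j, P k = blockStart (honestBlock M x) j ∧ blockTime M x j = (k, none) ∧
      prefixWord X k = prefixWord x k := by
    intro k
    obtain ⟨j, hj, hj'⟩ := exists_eq_blockStart (h.block k).head
    obtain ⟨m, hm⟩ : ∃ m, blockTime M x j = (m, none) :=
      ⟨_, Prod.ext rfl (init_timeBlock_iff.1 ⟨_, hj'.symm⟩)⟩
    have hb := blockAt_blockWord (bl := honestBlock M x) j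
    rw [honestBlock, hm, ← hj] at hb
    have := eq_of_initCells_eq ((h.block k).cells_unique hb)
    have hl := congrArg List.length this
    rw [length_prefixWord, length_prefixWord] at hl
    subst hl
    exact ⟨j, hj, hm, this⟩
  refine ⟨funext fun k => ?_, fun k => ?_⟩
  · obtain ⟨j, -, -, hk⟩ := hkey (k + 1)
    rw [prefixWord_succ, prefixWord_succ] at hk
    simpa using (List.append_inj' hk rfl).2
  · obtain ⟨j, h1, h2, -⟩ := hkey k
    exact ⟨j, h1, h2⟩

theorem prefixWord_congr {X : Type*} {x x' : ℕ → X} {k : ℕ} (h : ∀ i < k, x i = x' i) :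
    prefixWord x k = prefixWord x' k :=
  List.map_congr_left fun i hi => h i (List.mem_range.1 hi)

theorem timeBlock_congr {x' : ℕ → Bool} {c : ℕ × Option ℕ} (h : ∀ i < c.1, x i = x' i) :
    timeBlock M x c = timeBlock M x' c := by
  rcases c with ⟨k, _ | t⟩ <;> rw [timeBlock, timeBlock, prefixWord_congr h]

theorem blockTime_congr {x' : ℕ → Bool} {i k : ℕ} (h : ∀ i < k, x i = x' i)
    (hi : ∀ j < i, (blockTime M x j).1 ≤ k) : blockTime M x i = blockTime M x' i := by
  induction i with
  | zero => rfl
  | succ i ih =>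
    have ih := ih fun j hj => hi j (by omega)
    have hle := hi i (by omega)
    rcases hbt : blockTime M x i with ⟨m, _ | t⟩
    · rw [blockTime_succ_of_none hbt, blockTime_succ_of_none (ih ▸ hbt)]
    · rw [hbt] at hle
      have e : prefixWord x m = prefixWord x' m :=
        prefixWord_congr fun i hi => h i (by omega)
      by_cases ht : M.halted (confAt M (prefixWord x m) t).1
      · rw [blockTime_succ_of_halted hbt ht, blockTime_succ_of_halted (ih ▸ hbt) (e ▸ ht)]
      · rw [blockTime_succ_of_not_halted hbt ht,
          blockTime_succ_of_not_halted (ih ▸ hbt) (e ▸ ht)]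

/-- The protocol, up to the place where a bit is shown for the first time, depends only on the bits
before it. -/
theorem honestWord_congr {x' : ℕ → Bool} {X X' : ℕ → Bool} {P P' : ℕ → ℕ}
    (hs : InitStages (honestWord M x) X P) (hs' : InitStages (honestWord M x') X' P') {k : ℕ}
    (h : ∀ i < k, x i = x' i) : P (k + 1) = P' (k + 1) ∧
      ∀ p < P (k + 1) + 1 + k, honestWord M x p = honestWord M x' p := by
  obtain ⟨rfl, hP⟩ := hs.of_honestWord
  obtain ⟨rfl, hP'⟩ := hs'.of_honestWord
  obtain ⟨j, hj, hj'⟩ := hP (k + 1)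
  obtain ⟨l, hl, hl'⟩ := hP' (k + 1)
  have hle : ∀ i < j, (blockTime M X i).1 ≤ k := fun i hi => Nat.lt_succ_iff.1 (blockTime_lt hj' hi)
  have htime : ∀ i ≤ j, blockTime M X i = blockTime M X' i := fun i hi =>
    blockTime_congr h fun a ha => hle a (by omega)
  have hbl : ∀ i < j, honestBlock M X i = honestBlock M X' i := by
    intro i hi
    rw [honestBlock, honestBlock, ← htime i hi.le]
    exact timeBlock_congr fun a ha => h a (ha.trans_le (hle i hi))
  obtain rfl : l = j := by
    by_contra hne
    have e := (htime j le_rfl).symm.trans hj'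
    rcases Nat.lt_or_gt_of_ne hne with h1 | h1
    · have := blockTime_lt e h1
      simp [hl'] at this
    · have := blockTime_lt hl' h1
      simp [e] at this
  have hPP : P (k + 1) = P' (k + 1) := by rw [hj, hl, blockStart_congr hbl]
  refine ⟨hPP, fun p hp => ?_⟩
  rcases Nat.lt_or_ge p (P (k + 1)) with h1 | h1
  · exact blockWord_congr hbl (hj ▸ h1)
  · have hb := hs.block (k + 1)
    have hb' := hs'.block (k + 1)
    rw [← hPP] at hb'
    rcases Nat.eq_or_lt_of_le h1 with rfl | h1
    · rw [hb.head, hb'.head]; simp [initHead]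
    · obtain ⟨a, rfl⟩ : ∃ a, p = P (k + 1) + 1 + a := ⟨p - (P (k + 1) + 1), by omega⟩
      rw [hb.cell a _ (initCells_getElem?_of_lt (by simp; omega)),
        hb'.cell a _ (initCells_getElem?_of_lt (by simp; omega)), if_neg (by simp; omega),
        if_neg (by simp; omega)]
      simp [prefixWord, h a (by omega)]

end Honest

end

/-! ### Transfer of winning strategies from the protocol game. -/

section

open Turing.PartrecToTM2

/-! ### Plays -/

section Play

variable {X : Type*}

theorem rounds_succ (x : ℕ → X) (n : ℕ) :
    rounds x (n + 1) = rounds x n ++ [(x (2 * n), x (2 * n + 1))] := by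
  simp [rounds, List.range_succ]

@[simp]
theorem length_rounds (x : ℕ → X) (n : ℕ) : (rounds x n).length = n := by
  simp [rounds]

/-- The first rounds of the play of two strategies. -/
def playRounds (f : List (X × X) → X) (g : List (X × X) → X → X) : ℕ → List (X × X)
  | 0 => []
  | n + 1 => playRounds f g n ++
    [(f (playRounds f g n), g (playRounds f g n) (f (playRounds f g n)))]

/-- The play of two strategies. -/
def playOf (f : List (X × X) → X) (g : List (X × X) → X → X) (i : ℕ) : X :=
  if i % 2 = 0 then f (playRounds f g (i / 2))
  else g (playRounds f g (i / 2)) (f (playRounds f g (i / 2)))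

variable (f : List (X × X) → X) (g : List (X × X) → X → X)

theorem rounds_playOf (n : ℕ) : rounds (playOf f g) n = playRounds f g n := by
  induction n with
  | zero => rfl
  | succ n ih =>
    rw [rounds_succ, ih, playRounds, playOf, playOf, if_pos (by omega), if_neg (by omega),
      show 2 * n / 2 = n by omega, show (2 * n + 1) / 2 = n by omega]

theorem playOf_even (n : ℕ) : playOf f g (2 * n) = f (rounds (playOf f g) n) := by
  rw [rounds_playOf, playOf, if_pos (by omega), show 2 * n / 2 = n by omega]

theorem playOf_odd (n : ℕ) :
    playOf f g (2 * n + 1) = g (rounds (playOf f g) n) (playOf f g (2 * n)) := by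
  rw [playOf_even, rounds_playOf, playOf, if_neg (by omega), show (2 * n + 1) / 2 = n by omega]

variable {f g}

/-- The strategies have to agree only along one of the two plays; this is the source of all the
causality statements below. -/
theorem rounds_playOf_congr {f' : List (X × X) → X} {g' : List (X × X) → X → X} {n : ℕ}
    (hf : ∀ i < n, f (rounds (playOf f g) i) = f' (rounds (playOf f g) i))
    (hg : ∀ i < n, ∀ a, g (rounds (playOf f g) i) a = g' (rounds (playOf f g) i) a) :
    rounds (playOf f g) n = rounds (playOf f' g') n := by
  induction n with
  | zero => rfl
  | succ n ih =>
    have ih := ih (fun i hi => hf i (by omega)) fun i hi => hg i (by omega)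
    rw [rounds_succ, rounds_succ, playOf_odd, playOf_odd, playOf_even, playOf_even,
      hf n (by omega), hg n (by omega), ih]

theorem eq_of_rounds_eq {x x' : ℕ → X} {n : ℕ} (h : rounds x n = rounds x' n) {i : ℕ}
    (hi : i < 2 * n) : x i = x' i := by
  have := congrArg (fun l => l[i / 2]?) h
  simp only [rounds, List.getElem?_map, List.getElem?_range (show i / 2 < n by omega),
    Option.map_some, Option.some.injEq, Prod.mk.injEq] at this
  rcases Nat.even_or_odd' i with ⟨c, rfl | rfl⟩
  · rw [show 2 * c / 2 = c by omega] at this; exact this.1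
  · rw [show (2 * c + 1) / 2 = c by omega] at this; exact this.2

/-- An infinite word that starts with the given rounds. -/
def extendRounds [Inhabited X] (l : List (X × X)) (i : ℕ) : X :=
  if i % 2 = 0 then (l.getD (i / 2) default).1 else (l.getD (i / 2) default).2

theorem extendRounds_rounds [Inhabited X] (x : ℕ → X) {n i : ℕ} (hi : i < 2 * n) :
    extendRounds (rounds x n) i = x i := by
  have : (rounds x n).getD (i / 2) default = (x (2 * (i / 2)), x (2 * (i / 2) + 1)) := by
    simp [rounds, List.getD_eq_getElem?_getD, List.getElem?_range (show i / 2 < n by omega)]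
  rw [extendRounds, this]
  split_ifs <;> simp only <;> congr 1 <;> omega

theorem extendRounds_append [Inhabited X] (x : ℕ → X) (b : X) {n i : ℕ} (hi : i < 2 * n + 1) :
    extendRounds (rounds x n ++ [(x (2 * n), b)]) i = x i := by
  rcases Nat.lt_or_ge i (2 * n) with h | h
  · rw [← extendRounds_rounds x h, extendRounds, extendRounds,
      List.getD_append _ _ _ _ (by simp; omega)]
  · obtain rfl : i = 2 * n := by omega
    rw [extendRounds, if_pos (by omega), List.getD_append_right _ _ _ _ (by simp)]
    simp

end Play

/-! ### The game of the protocol -/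

section

variable {Q : Type} {M : StackMachine Q K' Γ'} {B : List Bool → List Bool → Bool}

/-- Whether a letter is the header of a block that lists an input. -/
def isInit : Header Q ⊕ Cell → Bool
  | .inl (.init _) => true
  | _ => false

/-- By counting input headers, Player 1 can tell from the letters of Player 2 alone which stage the
record has reached. -/
theorem InitStages.countP_eq {y : ℕ → Header Q ⊕ Cell} {X : ℕ → Bool} {P : ℕ → ℕ}
    (h : InitStages y X P) {k i : ℕ} (h1 : P k < i) (h2 : i ≤ P (k + 1)) :
    (prefixWord y i).countP isInit = k + 1 := by
  have hstep : ∀ k, (prefixWord y (P k)).countP isInit = k → ∀ i, P k < i → i ≤ P (k + 1) →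
      (prefixWord y i).countP isInit = k + 1 := by
    intro k hk i h1
    induction i, h1 using Nat.le_induction with
    | base =>
      intro _
      rw [Nat.succ_eq_add_one, prefixWord_succ, List.countP_append, hk, (h.block k).head]
      rfl
    | succ i h1 ih =>
      intro h2
      rw [prefixWord_succ, List.countP_append, ih (by omega)]
      have : isInit (y i) = false := by
        rcases hy : y i with (par | q) | c
        · exact absurd hy (h.first k i par h1 (by omega))
        · rfl
        · rfl
      simp [this]
  have hz : ∀ k, (prefixWord y (P k)).countP isInit = k := by
    intro k
    induction k with
    | zero => rw [h.zero]; rfl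
    | succ k ih => exact hstep k ih _ (h.lt k) le_rfl
  exact hstep k (hz k) i h1 h2

theorem InitStages.le_next {y : ℕ → Header Q ⊕ Cell} {X : ℕ → Bool} {P : ℕ → ℕ}
    (h : InitStages y X P) (k : ℕ) : P k + k + 2 ≤ P (k + 1) := by
  by_contra! hcon
  have h1 := (h.block k).isRight_of_lt (h.lt k) (by simp; omega)
  rw [(h.block (k + 1)).head] at h1
  simp at h1

theorem InitStages.countP_le {y : ℕ → Header Q ⊕ Cell} {X : ℕ → Bool} {P : ℕ → ℕ}
    (h : InitStages y X P) {k i : ℕ} (h2 : i ≤ P (k + 1)) :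
    (prefixWord y i).countP isInit ≤ k + 1 := by
  rw [← h.countP_eq (h.lt k) le_rfl]
  have : prefixWord y i = (prefixWord y (P (k + 1))).take i := by
    rw [prefixWord, prefixWord, ← List.map_take, List.take_range, min_eq_left h2]
  rw [this]
  exact (List.take_sublist _ _).countP_le

theorem exists_of_honestWord_eq_new {x : ℕ → Bool} {X : ℕ → Bool} {P : ℕ → ℕ}
    (h : InitStages (honestWord M x) X P) {i : ℕ} {par b : Bool}
    (hi : honestWord M x i = .inr (.new par b)) :
    ∃ k, i = P (k + 1) + 1 + k ∧ par = (k + 1).bodd ∧ b = x k := by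
  obtain ⟨j, h1, h2⟩ : ∃ j, blockStart (honestBlock M x) j ≤ i ∧
    i < blockStart (honestBlock M x) (j + 1) := ⟨_, blockNumber_spec i⟩
  have hb := blockAt_blockWord (bl := honestBlock M x) j
  have h3 : blockStart (honestBlock M x) j ≠ i := by
    intro he
    have := hb.head
    rw [he] at this
    exact Sum.inl_ne_inr (this.symm.trans hi)
  obtain ⟨a, rfl⟩ : ∃ a, i = blockStart (honestBlock M x) j + 1 + a :=
    ⟨i - (blockStart (honestBlock M x) j + 1), by omega⟩
  have ha : a < (honestBlock M x j).2.length := by rw [blockStart] at h2; omega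
  have hc := hb.cell a _ (List.getElem?_eq_getElem ha)
  have hc' := Sum.inr.inj (hc.symm.trans hi)
  have hq := List.getElem?_eq_getElem ha
  rw [hc', honestBlock] at hq
  rcases hbt : blockTime M x j with ⟨m, _ | t⟩
  · rw [hbt] at hq
    change (initCells (prefixWord x m))[a]? = _ at hq
    rw [honestBlock, hbt] at ha
    change a < (initCells (prefixWord x m)).length at ha
    rw [length_initCells, length_prefixWord] at ha
    rcases Nat.lt_or_ge a m with ham | ham
    · rw [initCells_getElem?_of_lt (by simpa using ham)] at hq
      simp only [length_prefixWord] at hq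
      split_ifs at hq with hm
      · subst hm
        simp only [prefixWord, List.getElem_map, List.getElem_range, Option.some.injEq,
          Cell.new.injEq] at hq
        obtain ⟨j', hj', hjt⟩ := h.of_honestWord.2 (a + 1)
        obtain rfl : j' = j := by
          rcases Nat.lt_trichotomy j' j with h4 | h4 | h4
          · simpa [hjt] using blockTime_lt hbt h4
          · exact h4
          · simpa [hbt] using blockTime_lt hjt h4
        exact ⟨a, by rw [hj'], hq.1.symm, hq.2.symm⟩
      · simp at hq
    · obtain rfl : a = m := by omega
      have := initCells_getElem?_length (prefixWord x a)
      rw [length_prefixWord, hq] at this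
      simp at this
  · rw [hbt] at hq
    change (runCells M (prefixWord x m) t)[a]? = _ at hq
    rw [runCells] at hq
    have := List.mem_of_getElem? hq
    simp [confCells] at this

theorem exists_stages_honestWord {F : List Bool → List Bool} (hM : M.Computes F) (x : ℕ → Bool) :
    ∃ P T, TableStages F (honestWord M x) x P T := by
  classical
  -- The bits of Player 1 are read off the record itself, so that `copy` holds for trivial reasons.
  have hp : IsProtocol M (fun i => decide (honestWord M x i = .inr (.new true true)))
      (honestWord M x) := by
    refine honestWord_isProtocol fun i b hb => ?_
    simp only [hb]
    cases b <;> simp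
  obtain ⟨X, P, T, h⟩ := hp.exists_stages hM
  obtain ⟨rfl, -⟩ := h.toInitStages.of_honestWord
  exact ⟨P, T, h⟩

variable (M) in
/-- The winning set of the game of the protocol. -/
def protocolGame : Set (ℕ → (Header Q ⊕ Cell) × (Header Q ⊕ Cell)) :=
  asProductLanguage {p | (gameAutomaton M).Accepts (pairWord p.1) (pairWord p.2)}

theorem mem_protocolGame {z : ℕ → (Header Q ⊕ Cell) × (Header Q ⊕ Cell)} :
    z ∈ protocolGame M ↔
      ((fun i => (z (2 * i + 1)).1) = (fun i => (z (2 * i + 1)).2) →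
        IsProtocol M (fun i => (z (2 * i)).1.isLeft) (fun i => (z (2 * i + 1)).1) →
        (branchAutomaton (letterVal ∘ Prod.snd)).Accepts
          (pairWord fun i => (z i).1) (pairWord fun i => (z i).2)) :=
  gameAutomaton_accepts_iff

/-- Let the given strategy play against the correct record for `x`. Bit `2 * n` of the new strategy
is what the given one writes in the round `P x (2 * n + 1) + 1 + 2 * n`, where the record has to
show it; by `honestWord_congr` the play so far depends only on the bits before `2 * n`. If `x`
follows the new strategy, then `copy` holds, and Player 1 can have won only by a branch. -/
theorem exists_winning₁_of_protocolGame (hM : M.Computes (table B))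
    {F' : List (((Header Q ⊕ Cell) × (Header Q ⊕ Cell)) × ((Header Q ⊕ Cell) × (Header Q ⊕ Cell))) →
      (Header Q ⊕ Cell) × (Header Q ⊕ Cell)}
    (hF' : IsWinningStrategy₁ (protocolGame M) F') : ∃ F, IsWinningStrategy₁ (branchSet B) F := by
  choose P T hPT using exists_stages_honestWord hM
  let z : (ℕ → Bool) → ℕ → (Header Q ⊕ Cell) × (Header Q ⊕ Cell) := fun x =>
    playOf F' fun r _ => (honestWord M x r.length, honestWord M x r.length)
  have hodd : ∀ x i, z x (2 * i + 1) = (honestWord M x i, honestWord M x i) := fun x i => by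
    simp only [z]
    rw [playOf_odd, length_rounds]
  refine ⟨fun l => (z (extendRounds l) (2 * (P (extendRounds l) (2 * l.length + 1) + 1 +
    2 * l.length))).1.isLeft, fun x hx => ?_⟩
  have hmem : z x ∈ protocolGame M := hF' _ fun n => playOf_even _ _ n
  rw [mem_protocolGame] at hmem
  simp only [hodd, true_implies] at hmem
  refine ((hPT x).branch_iff ?_ ?_).1 (hmem (honestWord_isProtocol fun i b hb => ?_))
  · funext i; simp [pairWord, hodd]
  · funext i; simp [pairWord, hodd]
  · obtain ⟨k, rfl, hk, rfl⟩ := exists_of_honestWord_eq_new (hPT x).toInitStages hb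
    obtain ⟨n, rfl⟩ : ∃ n, k = 2 * n := by
      rcases Nat.even_or_odd' k with ⟨n, rfl | rfl⟩
      · exact ⟨n, rfl⟩
      · simp at hk
    have hext : ∀ i < 2 * n, x i = extendRounds (rounds x n) i := fun i hi =>
      (extendRounds_rounds x hi).symm
    obtain ⟨e1, e2⟩ := honestWord_congr (hPT x).toInitStages
      (hPT (extendRounds (rounds x n))).toInitStages hext
    have hxn := hx n
    simp only [length_rounds] at hxn
    rw [hxn, ← e1]
    simp only [z]
    rw [playOf_even, playOf_even, rounds_playOf_congr (fun _ _ => rfl) fun i hi a => ?_]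
    rw [length_rounds, e2 i hi]

/-- Let Player 1 offer the even bits of `x` in step with the record. The given strategy wins, so the
record is correct; it lists a word `X x` outside the set that has the even bits of `x`, and its odd
bits, which depend only on earlier bits of `x`, are the answers of Player 2. -/
theorem exists_winning₂_of_protocolGame (hM : M.Computes (table B))
    {F' : List (((Header Q ⊕ Cell) × (Header Q ⊕ Cell)) × ((Header Q ⊕ Cell) × (Header Q ⊕ Cell))) →
      (Header Q ⊕ Cell) × (Header Q ⊕ Cell) → (Header Q ⊕ Cell) × (Header Q ⊕ Cell)}
    (hF' : IsWinningStrategy₂ (protocolGame M) F') : ∃ F, IsWinningStrategy₂ (branchSet B) F := by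
  -- Only `isLeft` of the first component is looked at, so any header and any cell can stand for the
  -- two bits.
  let lett : Bool → (Header Q ⊕ Cell) × (Header Q ⊕ Cell) := fun b =>
    cond b (.inl (.init false), .inl (.init false)) (.inr .last, .inr .last)
  let f : (ℕ → Bool) → List (((Header Q ⊕ Cell) × (Header Q ⊕ Cell)) ×
      ((Header Q ⊕ Cell) × (Header Q ⊕ Cell))) → (Header Q ⊕ Cell) × (Header Q ⊕ Cell) :=
    -- Within stage `2 * n + 1` the count is `2 * n + 2` and bit `2 * n` is offered, just where the
    -- record has to copy it. Because of the rounding the same bit is offered in stage `2 * n + 2`,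
    -- where bit `2 * n + 1` is shown, and no later bit is used before.
    fun x r => lett (x (2 * (((r.map fun p => p.2.1).countP isInit - 2) / 2)))
  let z : (ℕ → Bool) → ℕ → (Header Q ⊕ Cell) × (Header Q ⊕ Cell) := fun x => playOf (f x) F'
  let y : (ℕ → Bool) → ℕ → Header Q ⊕ Cell := fun x i => (z x (2 * i + 1)).1
  have hmap : ∀ x i, ((rounds (z x) i).map fun p => p.2.1) = prefixWord (y x) i := fun x i => by
    simp [rounds, prefixWord, y]
  have hbit : ∀ x i, (z x (2 * i)).1.isLeft =
      x (2 * (((prefixWord (y x) i).countP isInit - 2) / 2)) := by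
    intro x i
    rw [← hmap]
    change (playOf (f x) F' (2 * i)).1.isLeft = _
    rw [playOf_even]
    simp only [f, lett]
    cases x _ <;> rfl
  have hz : ∀ x, z x ∉ protocolGame M := fun x => hF' _ fun n => playOf_odd _ _ n
  have hz' : ∀ x, y x = (fun i => (z x (2 * i + 1)).2) ∧
      IsProtocol M (fun i => (z x (2 * i)).1.isLeft) (y x) ∧
      ¬ (branchAutomaton (letterVal ∘ Prod.snd)).Accepts
          (pairWord fun i => (z x i).1) (pairWord fun i => (z x i).2) := by
    intro x
    have := hz x
    rw [mem_protocolGame] at this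
    push Not at this
    exact this
  choose X P T hPT using fun x => (hz' x).2.1.exists_stages hM
  have hX : ∀ x, X x ∉ branchSet B := by
    intro x hx
    refine (hz' x).2.2 (((hPT x).branch_iff ?_ ?_).2 hx)
    · funext i; simp [pairWord, y]
    · rw [(hz' x).1]; funext i; simp [pairWord]
  have heven : ∀ x n, X x (2 * n) = x (2 * n) := by
    intro x n
    have h := (hPT x).toInitStages
    have hn := h.new_eq (2 * n)
    have e := (hz' x).2.1.copy _ (X x (2 * n)) (by simpa using hn)
    rw [← e, hbit, h.countP_eq (k := 2 * n + 1) (by omega)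
      (by have := h.le_next (2 * n + 1); omega)]
    congr 2
    omega
  have hcongr : ∀ x x' n, (∀ i < 2 * n + 1, x i = x' i) →
      X x (2 * n + 1) = X x' (2 * n + 1) := by
    intro x x' n hxx
    have h := (hPT x).toInitStages
    have hr : rounds (z x) (P x (2 * n + 3)) = rounds (z x') (P x (2 * n + 3)) := by
      refine rounds_playOf_congr (fun i hi => ?_) fun _ _ _ => rfl
      have := h.countP_le (k := 2 * n + 2) hi.le
      simp only [f]
      rw [show (List.map (fun p => p.2.1) (rounds (playOf (f x) F') i)) = prefixWord (y x) i from
        hmap x i, hxx _ (by omega)]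
    have hy : ∀ i < P x (2 * n + 3), y x i = y x' i := fun i hi => by
      simp only [y]
      rw [eq_of_rounds_eq hr (by omega)]
    exact (((hPT x).toInitStages.unique (hPT x').toInitStages hy (2 * n + 2)
      (by
        have : P x (2 * n + 2) + (2 * n + 2) + 2 ≤ P x (2 * n + 3) := h.le_next (2 * n + 2)
        omega)).2 (2 * n + 1) (by omega)).symm
  refine ⟨fun l a => X (extendRounds (l ++ [(a, false)])) (2 * l.length + 1), fun x hx => ?_⟩
  have : X x = x := by
    funext i
    rcases Nat.even_or_odd' i with ⟨n, rfl | rfl⟩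
    · exact heven x n
    · have hxn := hx n
      simp only [length_rounds] at hxn
      rw [hxn]
      exact hcongr _ _ n fun i hi => (extendRounds_append x false hi).symm
  exact this ▸ hX x

end

/-- Determinacy of the games with infinitary rational winning sets implies that of the effective
analytic games over the binary alphabet. -/
theorem isDetermined_branchSet_of_detRational (h : DetRational) {B : List Bool → List Bool → Bool}
    (hB : Computable₂ B) : IsDetermined (branchSet B) := by
  obtain ⟨Q, hQ, M, hM⟩ := exists_stackMachine (computable_table hB)
  have hr := (gameAutomaton M).isInfinitaryRational
  rcases h _ _ _ hr with ⟨F, hF⟩ | ⟨F, hF⟩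
  · exact Or.inl (exists_winning₁_of_protocolGame hM hF)
  · exact Or.inr (exists_winning₂_of_protocolGame hM hF)

end

/-! ### The normal form of effective analytic sets, and causal maps as strategies. -/

section

open Filter

/-! ### A normal form of effective analytic sets -/

theorem take_prefixWord {X : Type*} (x : ℕ → X) {m k : ℕ} (h : m ≤ k) :
    (prefixWord x k).take m = prefixWord x m := by
  rw [prefixWord, prefixWord, ← List.map_take, List.take_range, min_eq_left h]

section Search

variable (p : ℕ × ℕ → Bool)

/-- One step of the search for the least `m` with `p (n, m)`, for one `n` after the other. -/
def searchStep (c : ℕ × ℕ) : ℕ × ℕ := bif p c then (c.1 + 1, 0) else (c.1, c.2 + 1)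

/-- The state of the search after `k` steps. -/
def searchState (k : ℕ) : ℕ × ℕ := Nat.rec (0, 0) (fun _ c => searchStep p c) k

variable {p}

theorem searchState_snd_le (k : ℕ) : (searchState p k).2 ≤ k := by
  induction k with
  | zero => exact le_rfl
  | succ k ih =>
    change (searchStep p (searchState p k)).2 ≤ k + 1
    rw [searchStep]
    cases p (searchState p k) <;> simp [ih]

theorem searchState_not (k m : ℕ) (hm : m < (searchState p k).2) :
    p ((searchState p k).1, m) = false := by
  induction k generalizing m with
  | zero => simp [searchState] at hm
  | succ k ih =>
    change m < (searchStep p (searchState p k)).2 at hm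
    change p ((searchStep p (searchState p k)).1, m) = false
    rw [searchStep] at hm ⊢
    rcases h : p (searchState p k) with _ | _
    · rw [h, cond_false] at hm
      rw [cond_false]
      rcases Nat.lt_succ_iff_lt_or_eq.1 hm with h' | rfl
      · exact ih m h'
      · exact h
    · rw [h, cond_true] at hm
      exact absurd hm (Nat.not_lt_zero _)

/-- The search leaves `n` only by a success and then goes on to `n + 1`; infinitely many successes
therefore visit every `n`. -/
theorem exists_searchState_fst (h : ∃ᶠ k in atTop, p (searchState p k) = true) (n : ℕ) :
    ∃ k, (searchState p k).1 = n ∧ p (searchState p k) = true := by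
  have key : ∀ d k, p (searchState p (k + d)) = true →
      ∃ k', (searchState p k').1 = (searchState p k).1 ∧ p (searchState p k') = true := by
    intro d
    induction d with
    | zero => exact fun k hk => ⟨k, rfl, hk⟩
    | succ d ih =>
      intro k hk
      rcases hp : p (searchState p k) with _ | _
      · obtain ⟨k', h1, h2⟩ := ih (k + 1) (by rwa [add_right_comm])
        refine ⟨k', h1.trans ?_, h2⟩
        change (searchStep p (searchState p k)).1 = _
        rw [searchStep, hp, cond_false]
      · exact ⟨k, rfl, hp⟩
  have key' : ∀ k, ∃ k', (searchState p k').1 = (searchState p k).1 ∧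
      p (searchState p k') = true := by
    intro k
    obtain ⟨l, hl, hl'⟩ := frequently_atTop.1 h k
    exact key (l - k) k (by rwa [Nat.add_sub_cancel' hl])
  induction n with
  | zero => exact key' 0
  | succ n ih =>
    obtain ⟨k, hk, hk'⟩ := ih
    obtain ⟨l, hl, hl'⟩ := key' (k + 1)
    refine ⟨l, hl.trans ?_, hl'⟩
    change (searchStep p (searchState p k)).1 = _
    rw [searchStep, hk', cond_true, hk]

/-- If there are only finitely many successes, the search is stuck at some `n` and tries all later
`m` in vain; the smaller ones have failed before by `searchState_not`. -/
theorem frequently_searchState_iff :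
    (∃ᶠ k in atTop, p (searchState p k) = true) ↔ ∀ n, ∃ m, p (n, m) = true := by
  constructor
  · intro h n
    obtain ⟨k, rfl, hk⟩ := exists_searchState_fst h n
    exact ⟨_, hk⟩
  · intro h
    rw [frequently_atTop]
    by_contra! hcon
    obtain ⟨N, hN⟩ := hcon
    have hst : ∀ i, searchState p (N + i) = ((searchState p N).1, (searchState p N).2 + i) := by
      intro i
      induction i with
      | zero => rfl
      | succ i ih =>
        change searchStep p (searchState p (N + i)) = _
        rw [searchStep, Bool.eq_false_iff.2 (hN (N + i) (by omega)), cond_false, ih]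
        rfl
    obtain ⟨m, hm⟩ := h (searchState p N).1
    have := searchState_not (p := p) (N + (m + 1)) m (by rw [hst]; simp; omega)
    rw [hst] at this
    simp [hm] at this

end Search

/-- Every effective analytic set is given by a computable property that has to hold infinitely
often. -/
theorem IsEffectiveAnalytic.exists_branchSet {X : Type*} [Primcodable X] {L : Set (ℕ → X)}
    (h : IsEffectiveAnalytic L) : ∃ B : List Bool → List X → Bool, Computable₂ B ∧
      L = branchSet B := by
  obtain ⟨R, ⟨hd, hR⟩, hL⟩ := h
  let q : List Bool × List X → ℕ × ℕ → Bool := fun w c =>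
    decide ((c.1, w.1.take c.2, w.2.take c.2) ∈ R)
  have hq : Computable₂ q := by
    refine hR.comp (Computable.pair (Computable.fst.comp Computable.snd) (Computable.pair ?_ ?_))
    · exact Primrec.list_take.to_comp.comp (Computable.snd.comp Computable.snd)
        (Computable.fst.comp Computable.fst)
    · exact Primrec.list_take.to_comp.comp (Computable.snd.comp Computable.snd)
        (Computable.snd.comp Computable.fst)
  refine ⟨fun t s => q (t, s) (searchState (q (t, s)) t.length), ?_, ?_⟩
  · have hs : Computable fun w : List Bool × List X => searchState (q w) w.1.length := by
      refine Computable.nat_rec (h := fun w (c : ℕ × ℕ × ℕ) => searchStep (q w) c.2)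
        (Computable.list_length.comp Computable.fst) (Computable.const (0, 0)) ?_
      have hc : Computable fun v : (List Bool × List X) × ℕ × ℕ × ℕ => v.2.2 :=
        Computable.snd.comp Computable.snd
      exact Computable.cond (hq.comp Computable.fst hc)
        (Computable.pair (Computable.succ.comp (Computable.fst.comp hc)) (Computable.const 0))
        (Computable.pair (Computable.fst.comp hc) (Computable.succ.comp (Computable.snd.comp hc)))
    exact hq.comp Computable.id hs
  · ext σ
    rw [hL]
    refine exists_congr fun τ => ?_
    let p : ℕ × ℕ → Bool := fun c => decide ((c.1, prefixWord τ c.2, prefixWord σ c.2) ∈ R)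
    -- During `k` steps the search looks only at prefixes of length at most `k`, so it can be
    -- carried out inside the prefixes of length `k`.
    have hqp : ∀ k c, c.2 ≤ k → q (prefixWord τ k, prefixWord σ k) c = p c := by
      intro k c hc
      simp only [q, p, take_prefixWord _ hc]
    have hst : ∀ k j, j ≤ k →
        searchState (q (prefixWord τ k, prefixWord σ k)) j = searchState p j := by
      intro k j
      induction j with
      | zero => intro _; rfl
      | succ j ih =>
        intro hj
        change searchStep _ (searchState _ j) = searchStep _ (searchState _ j)
        rw [ih (by omega), searchStep, searchStep,
          hqp _ _ ((searchState_snd_le j).trans (by omega))]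
    have hB : ∀ k, q (prefixWord τ k, prefixWord σ k)
        (searchState (q (prefixWord τ k, prefixWord σ k)) (prefixWord τ k).length) =
          p (searchState p k) := by
      intro k
      rw [length_prefixWord, hst k k le_rfl, hqp _ _ (searchState_snd_le k)]
    simp only [hB]
    rw [frequently_searchState_iff]
    simp [p]

/-- Requiring that the prefix has length at least `n` expresses "infinitely often" in the form "for
all n there is m". -/
theorem isEffectiveAnalytic_branchSet {X : Type*} [Primcodable X] {B : List Bool → List X → Bool}
    (hB : Computable₂ B) : IsEffectiveAnalytic (branchSet B) := by
  refine ⟨{p | p.1 ≤ p.2.1.length ∧ B p.2.1 p.2.2 = true}, ComputablePred.computable_iff.2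
    ⟨fun p => decide (p.1 ≤ p.2.1.length) && B p.2.1 p.2.2, ?_, by ext; simp⟩, fun σ => ?_⟩
  · have h1 : Primrec fun p : ℕ × List Bool × List X => decide (p.1 ≤ p.2.1.length) :=
      (Primrec.nat_le.comp Primrec.fst
        (Primrec.list_length.comp (Primrec.fst.comp Primrec.snd))).decide
    exact Primrec.and.to_comp.comp h1.to_comp (hB.comp (Computable.fst.comp Computable.snd)
      (Computable.snd.comp Computable.snd))
  · refine exists_congr fun τ => ?_
    simp [frequently_atTop]

/-! ### Transfer of strategies -/

section Transfer

variable {X : Type*} [Inhabited X] {A : Set (ℕ → X)}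

/-- A causal map on infinite words that copies the letters of Player 2 gives a strategy for
Player 1. -/
theorem exists_winning₁_of_causal (Φ : (ℕ → X) → ℕ → X) (hmem : ∀ x, Φ x ∈ A)
    (hodd : ∀ x n, Φ x (2 * n + 1) = x (2 * n + 1))
    (hcausal : ∀ x x' n, (∀ i < 2 * n, x i = x' i) → Φ x (2 * n) = Φ x' (2 * n)) :
    ∃ F, IsWinningStrategy₁ A F := by
  refine ⟨fun l => Φ (extendRounds l) (2 * l.length), fun x hx => ?_⟩
  have : Φ x = x := by
    funext i
    rcases Nat.even_or_odd' i with ⟨n, rfl | rfl⟩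
    · have hxn := hx n
      simp only [length_rounds] at hxn
      rw [hxn]
      exact hcausal _ _ n fun i hi => (extendRounds_rounds x hi).symm
    · exact hodd x n
  exact this ▸ hmem x

/-- A causal map on infinite words that copies the letters of Player 1 gives a strategy for
Player 2. -/
theorem exists_winning₂_of_causal (Φ : (ℕ → X) → ℕ → X) (hmem : ∀ x, Φ x ∉ A)
    (heven : ∀ x n, Φ x (2 * n) = x (2 * n))
    (hcausal : ∀ x x' n, (∀ i < 2 * n + 1, x i = x' i) → Φ x (2 * n + 1) = Φ x' (2 * n + 1)) :
    ∃ F, IsWinningStrategy₂ A F := by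
  refine ⟨fun l a => Φ (extendRounds (l ++ [(a, default)])) (2 * l.length + 1), fun x hx => ?_⟩
  have : Φ x = x := by
    funext i
    rcases Nat.even_or_odd' i with ⟨n, rfl | rfl⟩
    · exact heven x n
    · have hxn := hx n
      simp only [length_rounds] at hxn
      rw [hxn]
      exact hcausal _ _ n fun i hi => (extendRounds_append x default hi).symm
  exact this ▸ hmem x

end Transfer

/-! ### From the countably infinite alphabet to all alphabets -/

theorem isDetermined_of_isEmpty {X : Type*} [IsEmpty X] (A : Set (ℕ → X)) : IsDetermined A :=
  Or.inr ⟨fun _ a => a, fun x => isEmptyElim (x 0)⟩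

/-- The letters of the opponent are translated by `e`, and the whole play is translated back by `d`.
-/
theorem isDetermined_of_comp {X Y : Type*} [Inhabited X] {A : Set (ℕ → X)} {A' : Set (ℕ → Y)}
    {d : Y → X} {e : X → Y} (hde : ∀ a, d (e a) = a) (hA : ∀ y, y ∈ A' ↔ d ∘ y ∈ A)
    (h : IsDetermined A') : IsDetermined A := by
  rcases h with ⟨F, hF⟩ | ⟨F, hF⟩
  · refine Or.inl (exists_winning₁_of_causal
      (fun x => d ∘ playOf F fun r _ => e (x (2 * r.length + 1))) (fun x => ?_) (fun x n => ?_)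
      fun x x' n hxx => ?_)
    · exact (hA _).1 (hF _ fun n => playOf_even _ _ n)
    · rw [Function.comp_apply, playOf_odd, length_rounds, hde]
    · rw [Function.comp_apply, Function.comp_apply, playOf_even, playOf_even,
        rounds_playOf_congr (fun _ _ => rfl) fun i hi a => ?_]
      rw [length_rounds, hxx _ (by omega)]
  · refine Or.inr (exists_winning₂_of_causal
      (fun x => d ∘ playOf (fun r => e (x (2 * r.length))) F) (fun x => ?_) (fun x n => ?_)
      fun x x' n hxx => ?_)
    · exact fun h => hF _ (fun n => playOf_odd _ _ n) ((hA _).2 h)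
    · rw [Function.comp_apply, playOf_even, length_rounds, hde]
    · rw [Function.comp_apply, Function.comp_apply, playOf_odd, playOf_odd, playOf_even,
        playOf_even, rounds_playOf_congr (fun i hi => ?_) (fun _ _ _ => rfl), length_rounds,
        hxx _ (by omega)]
      rw [length_rounds, hxx _ (by omega)]

theorem detEffectiveAnalyticFinite_of_omega (h : DetEffectiveAnalyticOmega) :
    DetEffectiveAnalyticFinite := by
  intro X _ _ A hA
  rcases isEmpty_or_nonempty X with hX | ⟨⟨a₀⟩⟩
  · exact isDetermined_of_isEmpty A
  let _ : Inhabited X := ⟨a₀⟩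
  obtain ⟨B, hB, rfl⟩ := hA.exists_branchSet
  let d : ℕ → X := fun n => (Encodable.decode n).getD a₀
  have hd : Primrec d := Primrec.option_getD.comp Primrec.decode (Primrec.const a₀)
  have hB' : Computable₂ fun (t : List Bool) (s : List ℕ) => B t (s.map d) :=
    hB.comp Computable.fst
      ((Primrec.list_map Primrec.snd (hd.comp Primrec.snd).to₂).to_comp)
  refine isDetermined_of_comp (d := d) (e := Encodable.encode) (by simp [d]) (fun y => ?_)
    (h _ (isEffectiveAnalytic_branchSet hB'))
  refine exists_congr fun τ => ?_
  simp only [prefixWord, List.map_map]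

end

/-! ### Reduction of games over ω to binary games. -/

section

open Filter

/-! ### Unary coding of plays over the countably infinite alphabet -/

/-- One round of the decoding. The state consists of the number of ones since the last zero, and of
the word decoded so far, whose length decides whose letters are taken into account. -/
def unaryStep (c : ℕ × List ℕ) (p : Bool × Bool) : ℕ × List ℕ :=
  bif (bif c.2.length.bodd then p.2 else p.1) then (c.1 + 1, c.2) else (0, c.2 ++ [c.1])

/-- The state of the decoding after some rounds. -/
def unaryState (l : List (Bool × Bool)) : ℕ × List ℕ := l.foldl unaryStep (0, [])

/-- The complete rounds in a finite play. -/
def pairsOf (s : List Bool) : List (Bool × Bool) :=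
  (List.range (s.length / 2)).map fun k => (s.getD (2 * k) false, s.getD (2 * k + 1) false)

/-- The word decoded from a finite play. -/
def unaryWord (s : List Bool) : List ℕ := (unaryState (pairsOf s)).2

/-- The property for the coded game: either a new letter has been completed and the decoded word
has the property `B`, or it is the turn of Player 2 and the length of the decoded word is the one
that has been guessed. -/
def unaryProperty (B : List Bool → List ℕ → Bool) (t s : List Bool) : Bool :=
  bif t.headI then
    decide ((unaryWord (s.take (s.length - 1))).length < (unaryWord s).length) &&
      B (t.tail.take (unaryWord s).length) (unaryWord s)
  else (unaryWord s).length.bodd && (decide (t.tail.idxOf false = (unaryWord s).length) &&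
    decide ((unaryWord s).length < t.tail.length))

theorem pairsOf_prefixWord (x : ℕ → Bool) (k : ℕ) : pairsOf (prefixWord x k) = rounds x (k / 2) := by
  rw [pairsOf, length_prefixWord, rounds]
  refine List.map_congr_left fun i hi => ?_
  rw [List.mem_range] at hi
  simp [prefixWord, List.getD_eq_getElem?_getD, List.getElem?_range (show 2 * i < k by omega),
    List.getElem?_range (show 2 * i + 1 < k by omega)]

section

open Primrec

theorem primrec_unaryWord : Primrec unaryWord := by
  have hpairs : Primrec pairsOf := by
    refine list_map (list_range.comp (nat_div.comp list_length (const 2))) ?_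
    have h2 : Primrec fun p : List Bool × ℕ => 2 * p.2 := nat_mul.comp (const 2) snd
    exact pair ((list_getD false).comp fst h2) ((list_getD false).comp fst (succ.comp h2))
  have hstep : Primrec₂ unaryStep := by
    have hc : Primrec fun v : (ℕ × List ℕ) × Bool × Bool => v.1.2.length.bodd :=
      nat_bodd.comp (list_length.comp (snd.comp fst))
    exact Primrec.cond (Primrec.cond hc (snd.comp snd) (fst.comp snd))
      (pair (succ.comp (fst.comp fst)) (snd.comp fst))
      (pair (const 0) (list_concat.comp (snd.comp fst) (fst.comp fst)))
  exact snd.comp (list_foldl hpairs (const (0, []))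
    (hstep.comp (fst.comp snd) (snd.comp snd)).to₂)

theorem computable_unaryProperty {B : List Bool → List ℕ → Bool} (hB : Computable₂ B) :
    Computable₂ (unaryProperty B) := by
  have hw : Primrec fun v : List Bool × List Bool => unaryWord v.2 := primrec_unaryWord.comp snd
  have hl : Primrec fun v : List Bool × List Bool => (unaryWord v.2).length := list_length.comp hw
  have hl' : Primrec fun v : List Bool × List Bool =>
      (unaryWord (v.2.take (v.2.length - 1))).length :=
    list_length.comp (primrec_unaryWord.comp
      (list_take.comp (nat_sub.comp (list_length.comp snd) (const 1)) snd))
  have ht : Primrec fun v : List Bool × List Bool => v.1.tail := list_tail.comp fst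
  refine Computable.cond (list_headI.comp fst).to_comp
    (Primrec.and.to_comp.comp (nat_lt.comp hl' hl).decide.to_comp
      (hB.comp (list_take.comp hl ht).to_comp hw.to_comp)) (Primrec.to_comp ?_)
  exact Primrec.and.comp (nat_bodd.comp hl) (Primrec.and.comp
    (Primrec.eq.comp (list_idxOf.comp (const false) ht) hl).decide
    (nat_lt.comp hl (list_length.comp ht)).decide)

end

section

variable (x : ℕ → Bool)

/-- The number of ones since the last zero. -/
def unaryCount (n : ℕ) : ℕ := (unaryState (rounds x n)).1

/-- The word decoded from the first rounds. -/
def decoded (n : ℕ) : List ℕ := (unaryState (rounds x n)).2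

/-- The letter that is taken into account in a round. -/
def unaryBit (n : ℕ) : Bool := bif (decoded x n).length.bodd then x (2 * n + 1) else x (2 * n)

/-- From some round on, the decoded word is not extended, and its length has the given parity. -/
def Stalls (r : Bool) : Prop :=
  ∃ N, (decoded x N).length.bodd = r ∧ ∀ n ≥ N, (decoded x n).length = (decoded x N).length

/-- The play codes the infinite word `X`. -/
structure Decodes (X : ℕ → ℕ) : Prop where
  eq : ∀ n, decoded x n = prefixWord X (decoded x n).length
  exists_length : ∀ m, ∃ n, (decoded x n).length = m

variable {x}

theorem unaryState_rounds_succ (n : ℕ) : unaryState (rounds x (n + 1)) =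
    bif unaryBit x n then (unaryCount x n + 1, decoded x n)
    else (0, decoded x n ++ [unaryCount x n]) := by
  rw [unaryState, rounds_succ, List.foldl_append]
  rfl

theorem decoded_zero : decoded x 0 = [] := rfl

theorem decoded_succ_of_true {n : ℕ} (h : unaryBit x n = true) :
    decoded x (n + 1) = decoded x n := by
  rw [decoded, unaryState_rounds_succ, h]; rfl

theorem unaryCount_succ_of_true {n : ℕ} (h : unaryBit x n = true) :
    unaryCount x (n + 1) = unaryCount x n + 1 := by
  rw [unaryCount, unaryState_rounds_succ, h]; rfl

theorem decoded_succ_of_false {n : ℕ} (h : unaryBit x n = false) :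
    decoded x (n + 1) = decoded x n ++ [unaryCount x n] := by
  rw [decoded, unaryState_rounds_succ, h]; rfl

theorem unaryCount_succ_of_false {n : ℕ} (h : unaryBit x n = false) :
    unaryCount x (n + 1) = 0 := by
  rw [unaryCount, unaryState_rounds_succ, h]; rfl

theorem length_decoded_succ_le (n : ℕ) :
    (decoded x (n + 1)).length ≤ (decoded x n).length + 1 := by
  rcases h : unaryBit x n with _ | _
  · rw [decoded_succ_of_false h]; simp
  · rw [decoded_succ_of_true h]; omega

theorem length_decoded_le (n : ℕ) : (decoded x n).length ≤ n := by
  induction n with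
  | zero => exact le_rfl
  | succ n ih => exact (length_decoded_succ_le n).trans (by omega)

theorem decoded_prefix {m n : ℕ} (h : m ≤ n) : decoded x m <+: decoded x n := by
  induction n, h using Nat.le_induction with
  | base => exact List.prefix_rfl
  | succ n h ih =>
    refine ih.trans ?_
    rcases h : unaryBit x n with _ | _
    · rw [decoded_succ_of_false h]; exact List.prefix_append _ _
    · rw [decoded_succ_of_true h]

theorem length_decoded_mono {m n : ℕ} (h : m ≤ n) :
    (decoded x m).length ≤ (decoded x n).length := (decoded_prefix h).length_le

theorem exists_length_decoded_of_unbounded (h : ∀ m, ∃ n, m ≤ (decoded x n).length) (m : ℕ) :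
    ∃ n, (decoded x n).length = m := by
  classical
  refine ⟨Nat.find (h m), le_antisymm ?_ (Nat.find_spec (h m))⟩
  rcases hn : Nat.find (h m) with _ | n
  · rw [decoded_zero]; simp
  · have h1 := Nat.find_min (h m) (show n < Nat.find (h m) by omega)
    have h2 := length_decoded_succ_le (x := x) n
    omega

theorem exists_decodes (h : ∀ m, ∃ n, m ≤ (decoded x n).length) : ∃ X, Decodes x X := by
  have hl := exists_length_decoded_of_unbounded h
  choose N hN using hl
  refine ⟨fun i => (decoded x (N (i + 1))).getD i 0, fun n => ?_, fun m => ⟨N m, hN m⟩⟩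
  refine List.ext_getElem (by simp) fun i h1 h2 => ?_
  have h3 : i < (decoded x (N (i + 1))).length := by rw [hN]; omega
  simp only [prefixWord, List.getElem_map, List.getElem_range]
  rw [List.getD_eq_getElem _ _ h3]
  rcases Nat.le_total n (N (i + 1)) with h | h
  · exact (decoded_prefix h).getElem h1
  · exact ((decoded_prefix h).getElem h3).symm

theorem unbounded_of_not_stalls (h0 : ¬ Stalls x false) (h1 : ¬ Stalls x true) (m : ℕ) :
    ∃ n, m ≤ (decoded x n).length := by
  induction m with
  | zero => exact ⟨0, Nat.zero_le _⟩
  | succ m ih =>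
    obtain ⟨N, hN⟩ := ih
    by_contra! hcon
    have hst : Stalls x (decoded x N).length.bodd := ⟨N, rfl, fun n hn => by
      have := hcon n
      have := length_decoded_mono (x := x) hn
      omega⟩
    cases h : (decoded x N).length.bodd <;> rw [h] at hst <;> contradiction

theorem unaryWord_prefixWord (k : ℕ) : unaryWord (prefixWord x k) = decoded x (k / 2) := by
  rw [unaryWord, pairsOf_prefixWord, decoded]

theorem tail_prefixWord {X : Type*} (τ : ℕ → X) (k : ℕ) :
    (prefixWord τ k).tail = prefixWord (fun i => τ (i + 1)) (k - 1) := by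
  cases k with
  | zero => rfl
  | succ k => simp [prefixWord, List.range_succ_eq_map, Function.comp_def]

theorem headI_prefixWord (τ : ℕ → Bool) {k : ℕ} (hk : 0 < k) : (prefixWord τ k).headI = τ 0 := by
  obtain ⟨k, rfl⟩ : ∃ j, k = j + 1 := ⟨k - 1, by omega⟩
  simp [prefixWord, List.range_succ_eq_map]

variable {B : List Bool → List ℕ → Bool}

/-- The strict inequality lets a decoded prefix count only in the round that completes it. Otherwise
a single good prefix would count infinitely often in a play that stalls. -/
theorem unaryProperty_of_true {τ : ℕ → Bool} (hτ : τ 0 = true) {k : ℕ} (hk : 0 < k) :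
    unaryProperty B (prefixWord τ k) (prefixWord x k) = true ↔
      (decoded x ((k - 1) / 2)).length < (decoded x (k / 2)).length ∧
        B (prefixWord (fun i => τ (i + 1)) (decoded x (k / 2)).length) (decoded x (k / 2)) = true := by
  have hle := length_decoded_le (x := x) (k / 2)
  rw [unaryProperty, headI_prefixWord τ hk, hτ, cond_true, length_prefixWord,
    take_prefixWord x (by omega), unaryWord_prefixWord, unaryWord_prefixWord, tail_prefixWord,
    take_prefixWord _ (by omega)]
  simp

/-- The last condition excludes the value that `idxOf` takes when no zero occurs. -/
theorem unaryProperty_of_false {τ : ℕ → Bool} (hτ : τ 0 = false) {k : ℕ} (hk : 0 < k) :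
    unaryProperty B (prefixWord τ k) (prefixWord x k) = true ↔
      (decoded x (k / 2)).length.bodd = true ∧
        (prefixWord (fun i => τ (i + 1)) (k - 1)).idxOf false = (decoded x (k / 2)).length ∧
        (decoded x (k / 2)).length < k - 1 := by
  rw [unaryProperty, headI_prefixWord τ hk, hτ, cond_false, unaryWord_prefixWord, tail_prefixWord]
  simp

theorem idxOf_prefixWord {τ : ℕ → Bool} {c k : ℕ} (h1 : ∀ i < c, τ i = true) (h2 : τ c = false)
    (hk : c < k) : (prefixWord τ k).idxOf false = c := by
  have hl : c < (prefixWord τ k).length := by simpa using hk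
  have hnot : false ∉ prefixWord τ c := by
    intro h
    obtain ⟨i, hi, hi'⟩ := List.mem_map.1 h
    rw [h1 i (List.mem_range.1 hi)] at hi'
    simp at hi'
  have : prefixWord τ k = prefixWord τ c ++ false :: (prefixWord τ k).drop (c + 1) := by
    conv_lhs => rw [← List.take_append_drop c (prefixWord τ k), take_prefixWord τ hk.le,
      List.drop_eq_getElem_cons hl]
    simp [prefixWord, h2]
  rw [this, List.idxOf_append_of_notMem hnot]
  simp

/-- Player 1 wins the coded game if Player 2 stalls, or the play codes a win of Player 1. -/
theorem mem_branchSet_unaryProperty : x ∈ branchSet (unaryProperty B) ↔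
    Stalls x true ∨ ∃ X, Decodes x X ∧ X ∈ branchSet B := by
  constructor
  · rintro ⟨τ, hτ⟩
    rw [frequently_atTop] at hτ
    rcases h0 : τ 0 with _ | _
    · left
      have hex : ∃ c, τ (c + 1) = false := by
        obtain ⟨k, hk, hk'⟩ := hτ 1
        rw [unaryProperty_of_false h0 (by omega)] at hk'
        obtain ⟨-, h1, h2⟩ := hk'
        by_contra! hcon
        rw [List.idxOf_of_notMem, length_prefixWord] at h1
        · omega
        · intro h
          obtain ⟨i, hi, hi'⟩ := List.mem_map.1 h
          exact hcon i hi'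
      classical
      -- The place of the first zero is the guessed length. The decoded length is monotone, so if it
      -- equals `c` infinitely often it is eventually constant.
      set c := Nat.find hex
      have hlen : ∀ N, ∃ n ≥ N, (decoded x n).length.bodd = true ∧ (decoded x n).length = c := by
        intro N
        obtain ⟨k, hk, hk'⟩ := hτ (2 * N + c + 2)
        rw [unaryProperty_of_false h0 (by omega)] at hk'
        obtain ⟨h1, h2, -⟩ := hk'
        rw [idxOf_prefixWord (c := c) (fun i hi => by simpa using Nat.find_min hex hi)
          (Nat.find_spec hex) (by omega)] at h2
        exact ⟨k / 2, by omega, h1, h2.symm⟩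
      obtain ⟨N, -, h1, h2⟩ := hlen 0
      refine ⟨N, h1, fun n hn => ?_⟩
      obtain ⟨m, hm, -, h3⟩ := hlen n
      have h4 := length_decoded_mono (x := x) hn
      have h5 := length_decoded_mono (x := x) hm
      omega
    · right
      have hub : ∀ m, ∃ n, m ≤ (decoded x n).length := by
        intro m
        induction m with
        | zero => exact ⟨0, Nat.zero_le _⟩
        | succ m ih =>
          obtain ⟨n, hn⟩ := ih
          obtain ⟨k, hk, hk'⟩ := hτ (2 * n + 1)
          rw [unaryProperty_of_true h0 (by omega)] at hk'
          have := length_decoded_mono (x := x) (show n ≤ (k - 1) / 2 by omega)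
          exact ⟨k / 2, by omega⟩
      obtain ⟨X, hX⟩ := exists_decodes hub
      refine ⟨X, hX, fun i => τ (i + 1), frequently_atTop.2 fun m => ?_⟩
      obtain ⟨n, hn⟩ := hub m
      obtain ⟨k, hk, hk'⟩ := hτ (2 * n + 1)
      rw [unaryProperty_of_true h0 (by omega)] at hk'
      refine ⟨_, hn.trans (length_decoded_mono (show n ≤ k / 2 by omega)), ?_⟩
      rw [← hX.eq]
      exact hk'.2
  · rintro (⟨N, h1, h2⟩ | ⟨X, hX, τ, hτ⟩)
    · refine ⟨fun i => Nat.casesOn i false fun i => decide (i < (decoded x N).length),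
        frequently_atTop.2 fun m => ⟨2 * (m + N + (decoded x N).length + 1), by omega, ?_⟩⟩
      rw [unaryProperty_of_false rfl (by omega), h2 _ (by omega), idxOf_prefixWord
        (c := (decoded x N).length) (fun i hi => by simpa using hi) (by simp) (by omega)]
      exact ⟨h1, rfl, by omega⟩
    · refine ⟨fun i => Nat.casesOn i true τ, frequently_atTop.2 fun N => ?_⟩
      -- A good prefix longer than all that is decoded by round `N`; the first round that completes
      -- it comes after `N`.
      obtain ⟨j, hj, hj'⟩ := frequently_atTop.1 hτ ((decoded x N).length + 1)
      classical
      have hex := hX.exists_length j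
      have hn := Nat.find_spec hex
      have hmin := fun m => Nat.find_min hex (m := m)
      generalize Nat.find hex = n at hn hmin
      have hN : N < n := by
        by_contra! hcon
        have := length_decoded_mono (x := x) hcon
        omega
      refine ⟨2 * n, by omega, ?_⟩
      rw [unaryProperty_of_true rfl (by omega), show 2 * n / 2 = n by omega,
        show (2 * n - 1) / 2 = n - 1 by omega]
      refine ⟨lt_of_le_of_ne (length_decoded_mono (by omega)) fun h => ?_, ?_⟩
      · exact hmin (n - 1) (by omega) (h.trans hn)
      · rw [hX.eq n, length_prefixWord, hn]
        exact hj'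

/-! ### Simulation of the coded game -/

/-- In the rounds of one of the players, the letters of `σ` are written. -/
def Copies (x : ℕ → Bool) (r : Bool) (σ : ℕ → ℕ) : Prop :=
  ∀ n, (decoded x n).length.bodd = r →
    unaryBit x n = decide (unaryCount x n < σ (decoded x n).length)

variable {r : Bool} {σ : ℕ → ℕ}

theorem Copies.count_le (h : Copies x r σ) (n : ℕ) (hn : (decoded x n).length.bodd = r) :
    unaryCount x n ≤ σ (decoded x n).length := by
  induction n with
  | zero => exact Nat.zero_le _
  | succ n ih =>
    rcases hb : unaryBit x n with _ | _
    · rw [unaryCount_succ_of_false hb]; exact Nat.zero_le _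
    · rw [decoded_succ_of_true hb] at hn ⊢
      rw [unaryCount_succ_of_true hb]
      have := h n hn
      rw [hb] at this
      exact of_decide_eq_true this.symm

theorem Copies.getElem_eq (h : Copies x r σ) (n i : ℕ) (hi : i < (decoded x n).length)
    (hr : i.bodd = r) : (decoded x n)[i] = σ i := by
  induction n generalizing i with
  | zero => simp [decoded_zero] at hi
  | succ n ih =>
    rcases hb : unaryBit x n with _ | _
    · have e := decoded_succ_of_false hb
      simp only [e] at hi ⊢
      rcases Nat.lt_or_ge i (decoded x n).length with h1 | h1
      · rw [List.getElem_append_left h1]; exact ih i h1 hr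
      · obtain rfl : i = (decoded x n).length := by
          simp only [List.length_append, List.length_singleton] at hi
          omega
        have h2 := h n hr
        rw [hb] at h2
        have h3 := of_decide_eq_false h2.symm
        have h4 := h.count_le n hr
        simp
        omega
    · have e := decoded_succ_of_true hb
      simp only [e] at hi ⊢
      exact ih i hi hr

/-- A player who copies `σ` writes at most `σ i` ones for the letter with number `i` and then closes
it with a zero. -/
theorem Copies.not_stalls (h : Copies x r σ) : ¬ Stalls x r := by
  rintro ⟨N, hN, hst⟩
  have hb : ∀ n ≥ N, unaryBit x n = true := by
    intro n hn
    by_contra hf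
    have e := decoded_succ_of_false (Bool.eq_false_iff.2 hf)
    have h1 := hst n hn
    have h2 := hst (n + 1) (by omega)
    rw [e, List.length_append, List.length_singleton] at h2
    omega
  have hc : ∀ d, d ≤ unaryCount x (N + d) := by
    intro d
    induction d with
    | zero => exact Nat.zero_le _
    | succ d ih =>
      rw [← add_assoc, unaryCount_succ_of_true (hb _ (by omega))]
      omega
  have h1 := hc (σ (decoded x N).length + 1)
  have h2 := hst (N + (σ (decoded x N).length + 1)) (by omega)
  have h3 := h.count_le (N + (σ (decoded x N).length + 1)) (by rw [h2, hN])
  rw [h2] at h3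
  omega

theorem Decodes.eq_of_copies {X : ℕ → ℕ} (hX : Decodes x X) (h : Copies x r σ) {i : ℕ}
    (hi : i.bodd = r) : X i = σ i := by
  obtain ⟨n, hn⟩ := hX.exists_length (i + 1)
  have h1 := h.getElem_eq n i (by omega) hi
  have h2 : (decoded x n)[i]? = some (X i) := by
    rw [hX.eq n, hn]
    simp [prefixWord]
  rw [List.getElem?_eq_getElem (by omega), h1] at h2
  exact (Option.some.inj h2).symm

theorem Decodes.eq_of_rounds_eq {x' : ℕ → Bool} {X X' : ℕ → ℕ} (hX : Decodes x X)
    (hX' : Decodes x' X') {K n : ℕ} (hn : (decoded x n).length = K + 1)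
    (h : rounds x n = rounds x' n) : X K = X' K := by
  have e : decoded x n = decoded x' n := by rw [decoded, decoded, h]
  have h1 := hX.eq n
  have h2 := hX'.eq n
  rw [← e, hn, h1, hn] at h2
  rw [prefixWord_succ, prefixWord_succ] at h2
  simpa using (List.append_inj' h2 rfl).2

end

/-- Let the winner of the coded game play against an opponent who writes the letters of `σ` in
unary. The opponent never stalls, and the winner cannot stall either, as this would lose; so the
play decodes to a word with the opponent's letters from `σ`, and the winner's letters depend
causally on `σ`. -/
theorem isDetermined_of_unaryProperty {B : List Bool → List ℕ → Bool}
    (h : IsDetermined (branchSet (unaryProperty B))) : IsDetermined (branchSet B) := by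
  let bit : (ℕ → ℕ) → Bool → List (Bool × Bool) → Bool := fun σ r l =>
    (unaryState l).2.length.bodd == r &&
      decide ((unaryState l).1 < σ (unaryState l).2.length)
  have hcopies : ∀ x r σ, (∀ n, (decoded x n).length.bodd = r →
      unaryBit x n = bit σ r (rounds x n)) → Copies x r σ := by
    intro x r σ h n hn
    rw [h n hn]
    change ((decoded x n).length.bodd == r &&
      decide (unaryCount x n < σ (decoded x n).length)) = _
    rw [hn, beq_self_eq_true, Bool.true_and]
  -- While the letter with number `K` is being written it is the turn of the other player, so `σ K`
  -- is not consulted.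
  have hcongr : ∀ x (r : Bool) σ σ' K n, K.bodd = !r → (∀ i < K, σ i = σ' i) →
      (decoded x n).length ≤ K → bit σ r (rounds x n) = bit σ' r (rounds x n) := by
    intro x r σ σ' K n hK hσ hn
    simp only [bit]
    rw [show (unaryState (rounds x n)).2 = decoded x n from rfl]
    rcases hr : (decoded x n).length.bodd == r with _ | _
    · rfl
    · rw [beq_iff_eq] at hr
      rcases Nat.eq_or_lt_of_le hn with h' | h'
      · rw [h', hK] at hr
        simp at hr
      · rw [hσ _ h']
  have hfirst : ∀ {x X}, Decodes x X → ∀ K, ∃ n, (decoded x n).length = K + 1 ∧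
      ∀ i < n, (decoded x i).length ≤ K := by
    intro x X hX K
    classical
    refine ⟨Nat.find (hX.exists_length (K + 1)), Nat.find_spec (hX.exists_length (K + 1)),
      fun i hi => ?_⟩
    have h1 := Nat.find_min (hX.exists_length (K + 1)) hi
    have h2 := length_decoded_mono (x := x) hi.le
    rw [Nat.find_spec (hX.exists_length (K + 1))] at h2
    omega
  rcases h with ⟨F, hF⟩ | ⟨F, hF⟩
  · left
    let z : (ℕ → ℕ) → ℕ → Bool := fun σ => playOf F fun l _ => bit σ true l
    have hz : ∀ σ, Copies (z σ) true σ := fun σ => hcopies _ _ _ fun n hn => by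
      rw [unaryBit, hn, cond_true]
      exact playOf_odd _ _ n
    have hX : ∀ σ, ∃ X, Decodes (z σ) X ∧ X ∈ branchSet B := fun σ =>
      (mem_branchSet_unaryProperty.1 (hF (z σ) fun n => playOf_even _ _ n)).resolve_left
        (hz σ).not_stalls
    choose X hX hXB using hX
    refine exists_winning₁_of_causal X hXB (fun σ n => (hX σ).eq_of_copies (hz σ) (by simp))
      fun σ σ' n hσ => ?_
    obtain ⟨m, hm, hm'⟩ := hfirst (hX σ) (2 * n)
    refine (hX σ).eq_of_rounds_eq (hX σ') hm (rounds_playOf_congr (fun _ _ => rfl) fun i hi _ => ?_)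
    exact hcongr _ _ _ _ (2 * n) i (by simp) hσ (hm' i hi)
  · right
    let z : (ℕ → ℕ) → ℕ → Bool := fun σ => playOf (bit σ false) F
    have hz : ∀ σ, Copies (z σ) false σ := fun σ => hcopies _ _ _ fun n hn => by
      rw [unaryBit, hn, cond_false]
      exact playOf_even _ _ n
    have hX : ∀ σ, ∃ X, Decodes (z σ) X ∧ X ∉ branchSet B := fun σ => by
      have hn := hF (z σ) fun n => playOf_odd _ _ n
      rw [mem_branchSet_unaryProperty, not_or, not_exists] at hn
      obtain ⟨X, hX⟩ := exists_decodes (unbounded_of_not_stalls (hz σ).not_stalls hn.1)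
      exact ⟨X, hX, fun hB => hn.2 X ⟨hX, hB⟩⟩
    choose X hX hXB using hX
    refine exists_winning₂_of_causal X hXB (fun σ n => (hX σ).eq_of_copies (hz σ) (by simp))
      fun σ σ' n hσ => ?_
    obtain ⟨m, hm, hm'⟩ := hfirst (hX σ) (2 * n + 1)
    refine (hX σ).eq_of_rounds_eq (hX σ') hm (rounds_playOf_congr (fun i hi => ?_) fun _ _ _ => rfl)
    exact hcongr _ _ _ _ (2 * n + 1) i (by simp) hσ (hm' i hi)

theorem detEffectiveAnalyticOmega_of_detRational (h : DetRational) : DetEffectiveAnalyticOmega := by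
  intro A hA
  obtain ⟨B, hB, rfl⟩ := hA.exists_branchSet
  exact isDetermined_of_unaryProperty
    (isDetermined_branchSet_of_detRational h (computable_unaryProperty hB))

end

/-! ### Infinitary rational relations are effective analytic. -/

section

open Filter

/-! ### Infinitary rational relations are effective analytic -/

/-- Two words are compatible if one of them is a prefix of the other. -/
def Compatible {S : Type*} (a b : List S) : Prop := a.take b.length = b.take a.length

theorem flatten_eq_prefixWord_of_compatible {S : Type*} {w : ℕ → List S} {x : ℕ → S} {m : ℕ}
    (hm : 0 < m) {C : ℕ → Prop} (hC : ∀ k, ∃ k' ≥ k, C k')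
    (h : ∀ k, C k → Compatible (prefixWord w (k / m)).flatten (prefixWord x k)) (n : ℕ) :
    (prefixWord w n).flatten = prefixWord x (prefixWord w n).flatten.length := by
  set l := (prefixWord w n).flatten.length with hl
  -- This `k` is so large that `n` blocks of `m` bits have been read and the prefix of `x` has at
  -- least `l` letters.
  obtain ⟨k, hk, hk'⟩ := hC (m * n + l)
  have hn : n ≤ k / m := (Nat.le_div_iff_mul_le hm).2 (by rw [mul_comm]; omega)
  have h1 := h k hk'
  rw [Compatible, length_prefixWord] at h1
  have h2 : prefixWord w (k / m) = prefixWord w n ++ (prefixWord w (k / m)).drop n := by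
    conv_lhs => rw [← List.take_append_drop n (prefixWord w (k / m)), take_prefixWord w hn]
  have h3 := congrArg (List.take l) h1
  have h4 : l ≤ (prefixWord w (k / m)).flatten.length := by
    rw [h2, List.flatten_append, List.length_append]; omega
  rw [List.take_take, List.take_take, min_eq_left (by omega), min_eq_left h4,
    take_prefixWord x (by omega), h2, List.flatten_append, List.take_append_of_le_length hl.le,
    hl, List.take_length] at h3
  exact h3

theorem IsInfiniteConcat.compatible {S : Type*} {w : ℕ → List S} {x : ℕ → S}
    (h : IsInfiniteConcat w x) (n k : ℕ) :
    Compatible (prefixWord w n).flatten (prefixWord x k) := by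
  rw [Compatible, length_prefixWord]
  have := h.1 n
  generalize (prefixWord w n).flatten.length = l at this
  rw [this]
  rcases Nat.le_total l k with hlk | hlk
  · rw [List.take_of_length_le (by simpa using hlk), take_prefixWord x hlk]
  · rw [take_prefixWord x hlk, List.take_of_length_le (by simpa using hlk)]

theorem frequently_iff_countP {D : Type*} {δ : ℕ → D} {a : D → Bool} :
    (∃ᶠ i in atTop, a (δ i) = true) ↔ ∀ n, ∃ N, n ≤ (prefixWord δ N).countP a := by
  constructor
  · intro h n
    induction n with
    | zero => exact ⟨0, Nat.zero_le _⟩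
    | succ n ih =>
      obtain ⟨N, hN⟩ := ih
      obtain ⟨i, hi, hi'⟩ := frequently_atTop.1 h N
      refine ⟨i + 1, ?_⟩
      have : (prefixWord δ N).countP a ≤ (prefixWord δ i).countP a := by
        rw [← take_prefixWord δ hi]
        exact (List.take_sublist _ _).countP_le
      rw [prefixWord_succ, List.countP_append, List.countP_singleton, if_pos hi']
      omega
  · intro h
    rw [frequently_atTop]
    by_contra! hcon
    obtain ⟨m, hm⟩ := hcon
    have hle : ∀ N, (prefixWord δ N).countP a ≤ m := by
      intro N
      induction N with
      | zero => exact Nat.zero_le _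
      | succ N ih =>
        rcases Nat.lt_or_ge N m with hN | hN
        · have := (List.countP_le_length (p := a) (l := prefixWord δ (N + 1)))
          rw [length_prefixWord] at this
          omega
        · rw [prefixWord_succ, List.countP_append, List.countP_singleton, if_neg (hm N hN)]
          omega
    obtain ⟨N, hN⟩ := h (m + 1)
    have := hle N
    omega

theorem exists_primcodable (D : Type) [Finite D] : Nonempty (Primcodable D) := by
  obtain ⟨n, ⟨e⟩⟩ := Finite.exists_equiv_fin D
  exact ⟨Primcodable.ofEquiv (Fin n) e⟩

section Blocks

variable {D : Type} [Primcodable D] (d₀ : D) (m : ℕ)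

/-- The element coded by the `i`-th block of length `m` of a binary word. -/
def blockValue (t : List Bool) (i : ℕ) : D :=
  (Encodable.decode (((List.range m).map fun a => t.getD (m * i + a) false).idxOf false)).getD d₀

/-- The word coded by a binary word. -/
def blockValues (t : List Bool) : List D := (List.range (t.length / m)).map (blockValue d₀ m t)

theorem primrec_blockValues : Primrec (blockValues d₀ m) := by
  refine Primrec.list_map (Primrec.list_range.comp (Primrec.nat_div.comp Primrec.list_length
    (Primrec.const m))) (Primrec.option_getD.comp (Primrec.decode.comp (Primrec.list_idxOf.comp
      (Primrec.const false) (Primrec.list_map (Primrec.const _) ?_))) (Primrec.const d₀))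
  exact (Primrec.list_getD false).comp (Primrec.fst.comp Primrec.fst)
    (Primrec.nat_add.comp (Primrec.nat_mul.comp (Primrec.const m) (Primrec.snd.comp Primrec.fst))
      Primrec.snd)

variable {m}

/-- The infinite word coded by an infinite binary word. -/
def blockStream (m : ℕ) (τ : ℕ → Bool) (i : ℕ) : D :=
  (Encodable.decode ((prefixWord (fun a => τ (m * i + a)) m).idxOf false)).getD d₀

theorem blockValues_prefixWord (hm : 0 < m) (τ : ℕ → Bool) (k : ℕ) :
    blockValues d₀ m (prefixWord τ k) = prefixWord (blockStream d₀ m τ) (k / m) := by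
  rw [blockValues, length_prefixWord, prefixWord.eq_def (blockStream d₀ m τ)]
  refine List.map_congr_left fun i hi => ?_
  rw [List.mem_range, Nat.lt_div_iff_mul_lt hm] at hi
  have : ((List.range m).map fun a => (prefixWord τ k).getD (m * i + a) false) =
      prefixWord (fun a => τ (m * i + a)) m := by
    refine List.map_congr_left fun a ha => ?_
    rw [List.mem_range] at ha
    have : m * i + a < k := by rw [mul_comm]; omega
    simp [prefixWord, List.getD_eq_getElem?_getD, List.getElem?_range this]
  rw [blockValue, this, blockStream]

/-- Each element is written in unary in its block; since its code is below `m`, there is room for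
the zero that ends it. -/
theorem exists_blockStream_eq (hm : ∀ d : D, Encodable.encode d < m) (δ : ℕ → D) :
    ∃ τ, blockStream d₀ m τ = δ := by
  have hm0 : 0 < m := (Nat.zero_le _).trans_lt (hm d₀)
  refine ⟨fun j => decide (j % m < Encodable.encode (δ (j / m))), funext fun i => ?_⟩
  have key : ∀ a < m, (m * i + a) % m = a ∧ (m * i + a) / m = i := fun a ha => by
    rw [Nat.mul_add_mod, Nat.mod_eq_of_lt ha, Nat.mul_add_div hm0, Nat.div_eq_of_lt ha]
    simp
  have h1 : ∀ a < Encodable.encode (δ i),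
      decide ((m * i + a) % m < Encodable.encode (δ ((m * i + a) / m))) = true := fun a ha => by
    rw [(key a (ha.trans (hm _))).1, (key a (ha.trans (hm _))).2]
    exact decide_eq_true ha
  have h2 : decide ((m * i + Encodable.encode (δ i)) % m <
      Encodable.encode (δ ((m * i + Encodable.encode (δ i)) / m))) = false := by
    rw [(key _ (hm _)).1, (key _ (hm _)).2]
    simp
  rw [blockStream, idxOf_prefixWord h1 h2 (hm _), Encodable.encodek, Option.getD_some]

end Blocks

namespace TwoTapeBuchi

variable {K S G : Type} (M : TwoTapeBuchi K S G)

open Classical in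
/-- The state reached by a transition from a state. -/
noncomputable def chainStep (o : Option K) (d : M.trans) : Option K :=
  if o = some d.1.1 then some d.1.2.2.2 else none

/-- The states of a sequence of transitions. -/
def stateSeq (δ : ℕ → M.trans) : ℕ → K
  | 0 => M.start
  | i + 1 => (δ i).1.2.2.2

variable {M}

theorem foldl_chainStep (δ : ℕ → M.trans) (N : ℕ) :
    ((prefixWord δ N).foldl M.chainStep (some M.start) ≠ none ↔
      ∀ i < N, (δ i).1.1 = M.stateSeq δ i) ∧
    ((∀ i < N, (δ i).1.1 = M.stateSeq δ i) →
      (prefixWord δ N).foldl M.chainStep (some M.start) = some (M.stateSeq δ N)) := by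
  induction N with
  | zero => simp [prefixWord, stateSeq]
  | succ N ih =>
    rw [prefixWord_succ, List.foldl_append, List.foldl_cons, List.foldl_nil]
    by_cases h : ∀ i < N, (δ i).1.1 = M.stateSeq δ i
    · rw [ih.2 h, chainStep]
      have : (∀ i < N + 1, (δ i).1.1 = M.stateSeq δ i) ↔ M.stateSeq δ N = (δ N).1.1 :=
        ⟨fun h' => (h' N (by omega)).symm, fun h' i hi => by
          rcases Nat.lt_succ_iff_lt_or_eq.1 hi with hi | rfl
          exacts [h i hi, h'.symm]⟩
      rw [this]
      have hs : M.stateSeq δ (N + 1) = (δ N).1.2.2.2 := rfl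
      by_cases h' : M.stateSeq δ N = (δ N).1.1 <;> simp [h', hs]
    · have hn : (prefixWord δ N).foldl M.chainStep (some M.start) = none := by
        by_contra hne
        exact h (ih.1.1 hne)
      have h' : ¬ ∀ i < N + 1, (δ i).1.1 = M.stateSeq δ i := fun h' => h fun i hi => h' i (by omega)
      rw [hn, chainStep]
      simp only [h', reduceCtorEq, if_false, ne_eq, not_true_eq_false, false_imp_iff, and_self]

-- The word τ is read as a sequence of transitions. The relation demands of the part decoded so far
-- that it is a chain from the start state, that the words on its tapes do not contradict σ, and
-- that it has produced `n` letters on each tape and `n` accepting visits. What has been read may be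
-- longer or shorter than the given prefix of σ, hence `Compatible`.
open Classical in
theorem isEffectiveAnalytic [Finite K] [Primcodable S] [Primcodable G] (M : TwoTapeBuchi K S G) :
    IsEffectiveAnalytic (asProductLanguage M.relation) := by
  have hfin : Finite M.trans := M.finite_trans
  rcases isEmpty_or_nonempty M.trans with he | ⟨⟨d₀⟩⟩
  · refine ⟨∅, ComputablePred.computable_iff.2 ⟨fun _ => false, Computable.const _, by
      ext; simp⟩, fun σ => ⟨?_, ?_⟩⟩
    · rintro ⟨q, u, v, hc, -⟩
      exact he.elim ⟨_, hc.2 0⟩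
    · rintro ⟨τ, h⟩
      obtain ⟨_, h⟩ := h 0
      exact h.elim
  obtain ⟨_⟩ := exists_primcodable K
  obtain ⟨hcode⟩ := exists_primcodable M.trans
  obtain ⟨m, hm⟩ : ∃ m, ∀ d : M.trans, hcode.toEncodable.encode d < m := by
    obtain ⟨b, hb⟩ := (Set.finite_range hcode.toEncodable.encode).bddAbove
    exact ⟨b + 1, fun d => Nat.lt_succ_of_le (hb ⟨d, rfl⟩)⟩
  have hm0 : 0 < m := (Nat.zero_le _).trans_lt (hm d₀)
  let u : M.trans → List S := fun d => d.1.2.1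
  let v : M.trans → List G := fun d => d.1.2.2.1
  let a : M.trans → Bool := fun d => decide (d.1.1 ∈ M.accept)
  let dl : List Bool → List M.trans := blockValues d₀ m
  let R : ℕ × List Bool × List (S × G) → Prop := fun p =>
    (dl p.2.1).foldl M.chainStep (some M.start) ≠ none ∧
      (Compatible ((dl p.2.1).flatMap u) (p.2.2.map Prod.fst) ∧
        Compatible ((dl p.2.1).flatMap v) (p.2.2.map Prod.snd)) ∧
      p.1 ≤ ((dl p.2.1).flatMap u).length ∧ p.1 ≤ ((dl p.2.1).flatMap v).length ∧
      p.1 ≤ ((dl p.2.1).filter fun d => a d).length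
  have hR : PrimrecPred R := by
    have hdl : Primrec fun p : ℕ × List Bool × List (S × G) => dl p.2.1 :=
      (primrec_blockValues d₀ m).comp (Primrec.fst.comp Primrec.snd)
    have hu : Primrec fun p : ℕ × List Bool × List (S × G) => (dl p.2.1).flatMap u :=
      Primrec.list_flatMap hdl ((Primrec.dom_finite u).comp Primrec.snd).to₂
    have hv : Primrec fun p : ℕ × List Bool × List (S × G) => (dl p.2.1).flatMap v :=
      Primrec.list_flatMap hdl ((Primrec.dom_finite v).comp Primrec.snd).to₂
    have hx : Primrec fun p : ℕ × List Bool × List (S × G) => p.2.2.map Prod.fst :=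
      Primrec.list_map (Primrec.snd.comp Primrec.snd) (Primrec.fst.comp Primrec.snd).to₂
    have hy : Primrec fun p : ℕ × List Bool × List (S × G) => p.2.2.map Prod.snd :=
      Primrec.list_map (Primrec.snd.comp Primrec.snd) (Primrec.snd.comp Primrec.snd).to₂
    have hacc : PrimrecPred fun d : M.trans => a d = true :=
      Primrec.eq.comp (Primrec.dom_finite a) (Primrec.const true)
    refine PrimrecPred.and (PrimrecPred.not (Primrec.eq.comp (Primrec.list_foldl hdl
      (Primrec.const (some M.start)) (((Primrec.dom_finite fun p : Option K × M.trans =>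
        M.chainStep p.1 p.2).comp Primrec.snd).to₂)) (Primrec.const none)))
      (PrimrecPred.and (PrimrecPred.and ?_ ?_) (PrimrecPred.and ?_ (PrimrecPred.and ?_ ?_)))
    · exact Primrec.eq.comp (Primrec.list_take.comp (Primrec.list_length.comp hx) hu)
        (Primrec.list_take.comp (Primrec.list_length.comp hu) hx)
    · exact Primrec.eq.comp (Primrec.list_take.comp (Primrec.list_length.comp hy) hv)
        (Primrec.list_take.comp (Primrec.list_length.comp hv) hy)
    · exact Primrec.nat_le.comp Primrec.fst (Primrec.list_length.comp hu)
    · exact Primrec.nat_le.comp Primrec.fst (Primrec.list_length.comp hv)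
    · refine Primrec.nat_le.comp Primrec.fst (Primrec.list_length.comp ?_)
      exact ((Primrec.listFilter hacc).comp hdl).of_eq fun p => by simp
  obtain ⟨hdec, hR⟩ := hR
  refine ⟨{p | R p}, ⟨hdec, hR.to_comp⟩, fun σ => ?_⟩
  have hRiff : ∀ τ δ, blockStream d₀ m τ = δ → ∀ n k, R (n, prefixWord τ k, prefixWord σ k) ↔
      (∀ i < k / m, (δ i).1.1 = M.stateSeq δ i) ∧
      (Compatible (prefixWord (u ∘ δ) (k / m)).flatten (prefixWord (fun i => (σ i).1) k) ∧
        Compatible (prefixWord (v ∘ δ) (k / m)).flatten (prefixWord (fun i => (σ i).2) k)) ∧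
      n ≤ (prefixWord (u ∘ δ) (k / m)).flatten.length ∧
      n ≤ (prefixWord (v ∘ δ) (k / m)).flatten.length ∧
      n ≤ (prefixWord δ (k / m)).countP a := by
    rintro τ δ rfl n k
    simp only [R, dl]
    rw [blockValues_prefixWord d₀ hm0, (foldl_chainStep _ _).1, List.countP_eq_length_filter]
    simp only [prefixWord, List.map_map, List.flatMap_def, Function.comp_def]
  have hmono : ∀ {T : Type} (w : ℕ → List T) {i j : ℕ}, i ≤ j →
      (prefixWord w i).flatten.length ≤ (prefixWord w j).flatten.length := by
    intro T w i j hij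
    rw [← take_prefixWord w hij]
    exact ((List.take_sublist _ _).flatten).length_le
  constructor
  · rintro ⟨q, U, V, ⟨hq0, hq⟩, hs, hU, hV⟩
    let δ : ℕ → M.trans := fun i => ⟨_, hq i⟩
    have hst : ∀ i, M.stateSeq δ i = q i := by
      intro i
      cases i with
      | zero => exact hq0.symm
      | succ i => rfl
    obtain ⟨τ, hτ⟩ := exists_blockStream_eq d₀ hm δ
    refine ⟨τ, fun n => ?_⟩
    obtain ⟨N₁, h₁⟩ := hU.2 n
    obtain ⟨N₂, h₂⟩ := hV.2 n
    obtain ⟨N₃, h₃⟩ := (frequently_iff_countP (δ := δ) (a := a)).1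
      ((frequently_mem_iff_of_finite.2 hs).mono fun i hi => decide_eq_true hi) n
    -- By this time all three counts, which are monotone, have reached `n`; the factor `m` is the
    -- number of bits per transition.
    refine ⟨m * (N₁ + N₂ + N₃), (hRiff τ δ hτ n _).2 ?_⟩
    rw [Nat.mul_div_cancel_left _ hm0]
    refine ⟨fun i _ => (hst i).symm, ⟨hU.compatible _ _, hV.compatible _ _⟩,
      h₁.trans (hmono U (by omega)), h₂.trans (hmono V (by omega)), h₃.trans ?_⟩
    rw [← take_prefixWord δ (show N₃ ≤ N₁ + N₂ + N₃ by omega)]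
    exact (List.take_sublist _ _).countP_le
  · rintro ⟨τ, h⟩
    set δ : ℕ → M.trans := blockStream d₀ m τ with hδ
    have h' := fun n => (h n).imp fun k => (hRiff τ δ rfl n k).1
    choose k hk using h'
    -- To have `n` accepting visits at least `n` transitions are needed, so the witnesses are
    -- unbounded and the conditions on finite parts extend to the whole run.
    have hlarge : ∀ n, n ≤ k n / m := fun n =>
      ((hk n).2.2.2.2.trans List.countP_le_length).trans (by rw [length_prefixWord])
    have hst : ∀ i, (δ i).1.1 = M.stateSeq δ i := fun i =>
      (hk (i + 1)).1 i (hlarge (i + 1))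
    have hC : ∀ l, ∃ k' ≥ l, ∃ n, k' = k n := fun l =>
      ⟨k l, (hlarge l).trans (Nat.div_le_self _ _), l, rfl⟩
    refine ⟨M.stateSeq δ, u ∘ δ, v ∘ δ, ⟨rfl, fun i => ?_⟩, ?_, ⟨?_, fun N => ?_⟩, ?_, fun N => ?_⟩
    · rw [← hst i]
      exact (δ i).2
    · refine frequently_mem_iff_of_finite.1 ?_
      refine ((frequently_iff_countP (δ := δ) (a := a)).2 fun n => ⟨_, (hk n).2.2.2.2⟩).mono
        fun i hi => ?_
      rw [← hst i]
      exact of_decide_eq_true hi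
    · refine flatten_eq_prefixWord_of_compatible hm0 hC ?_
      rintro _ ⟨n, rfl⟩
      exact (hk n).2.1.1
    · exact ⟨_, (hk N).2.2.1⟩
    · refine flatten_eq_prefixWord_of_compatible hm0 hC ?_
      rintro _ ⟨n, rfl⟩
      exact (hk n).2.1.2
    · exact ⟨_, (hk N).2.2.2.1⟩

end TwoTapeBuchi

theorem detRational_of_finite (h : DetEffectiveAnalyticFinite) : DetRational := by
  rintro S G _ _ _ ⟨K, _, M, rfl⟩
  obtain ⟨_⟩ := exists_primcodable S
  obtain ⟨_⟩ := exists_primcodable G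
  exact h (S × G) _ M.isEffectiveAnalytic

end

theorem theorem3p5 :
    (DetEffectiveAnalyticFinite ↔ DetRational) ∧ (DetEffectiveAnalyticOmega ↔ DetRational) :=
  ⟨⟨detRational_of_finite, fun h =>
      detEffectiveAnalyticFinite_of_omega (detEffectiveAnalyticOmega_of_detRational h)⟩,
    fun h => detRational_of_finite (detEffectiveAnalyticFinite_of_omega h),
    detEffectiveAnalyticOmega_of_detRational⟩
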